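/- All graphs are finite and simple. $P_k$ is the path on $k$ vertices, $K_q$ the complete graph and $\overline{K}_q$ the edgeless graph on $q$ vertices ($K_0$ and $\overline{K}_0$ are empty), $\cup$ denotes disjoint union, $t\cdot G$ is the disjoint union of $t$ copies of $G$, and $G+H$ is obtained from $G\cup H$ by joining each vertex of $G$ to each vertex of $H$. $ex(n,F)$ is the maximum number of edges of a graph on $n$ vertices that does not contain $F$ as a (not necessarily induced) subgraph; a graph on $n$ vertices with $ex(n,F)$ edges that does not contain $F$ is called extremal for $F$. For integers $n\ge m\ge l\ge 3$ write $n=(m-1)+t(l-1)+r$ with $t\ge 0$ and $0\le r<l-1$, and put $$[n,m,l]=\binom{m-1}{2}+t\binom{l-1}{2}+\binom r2,\qquad [n,m]=\binom{\lfloor m/2\rfloor-1}{2}+\Big\lfloor\frac{m-2}{2}\Big\rfloor\Big(n-\Big\lfloor\frac m2\Big\rfloor+1\Big).$$ For even $k\ge 4$ and $N\ge 1$ write $N=(k-1)t+r$ with $0\le r<k-1$, and let $\mathcal E(N,k)$ be the class of graphs isomorphic to $t\cdot K_{k-1}\cup K_r$ or, in case $r\in\{\frac k2,\frac{k-2}2\}$,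 to $$(t-s-1)\cdot K_{k-1}\cup\Big(K_{\frac{k-2}{2}}+\overline{K}_{\frac k2+s(k-1)+r}\Big)\quad\text{for some integer } 0\le s<t.$$ **Theorem.** Let $m\ge 1$, let $k_1\ge k_2\ge\dots\ge k_m\ge 3$ be integers, at most one of the terms $k_1,\dots,k_m$ being odd, put $s_j=\sum_{i=1}^{j}k_i$, and let $n\ge s_m$. Then $$ex(n,P_{k_1}\cup\dots\cup P_{k_m})=M:=\max\big\{[n,s_1,k_1],[n,s_2,k_2],\dots,[n,s_m,k_m],[n,s_m]\big\}.$$ Moreover, if all $k_i$ are even, then a graph $G$ on $n$ vertices is extremal for $P_{k_1}\cup\dots\cup P_{k_m}$ if and only if at least one of the following holds: 1. $[n,k_1,k_1]=M$ and $G\in\mathcal E(n,k_1)$; 2. for some $2\le j\le m$, $[n,s_j,k_j]=M$ and $G$ is isomorphic to $K_{s_j-1}\cup H$ for some $H\in\mathcal E(n-s_j+1,k_j)$; 3. $[n,s_m]=M$ and $G$ is isomorphic to $K_{\frac{s_m}{2}-1}+\overline{K}_{n-\frac{s_m}{2}+1}$. -/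

import Mathlib

namespace DisjointPaths

/-- The disjoint union of a family of graphs. -/
def disjointUnion {ι : Type*} {V : ι → Type*} (G : ∀ i, SimpleGraph (V i)) :
    SimpleGraph (Σ i, V i) where
  Adj x y := ∃ i a b, (G i).Adj a b ∧ x = ⟨i, a⟩ ∧ y = ⟨i, b⟩
  symm := ⟨by
    rintro x y ⟨i, a, b, h, hx, hy⟩
    exact ⟨i, b, a, h.symm, hy, hx⟩⟩
  loopless := ⟨by
    rintro x ⟨i, a, b, h, hx, hy⟩
    rw [hx] at hy
    cases hy
    exact h.ne rfl⟩

/-- `t · K_q`: the disjoint union of `t` complete graphs on `q` vertices. -/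
def cliques (t q : ℕ) : SimpleGraph (Σ _ : Fin t, Fin q) :=
  disjointUnion fun _ => SimpleGraph.completeGraph (Fin q)

/-- `G + H`: the disjoint union of `G` and `H` together with all edges between them. -/
def join {V W : Type*} (G : SimpleGraph V) (H : SimpleGraph W) : SimpleGraph (V ⊕ W) :=
  (G ⊕g H) ⊔ completeBipartiteGraph V W

/-- The join `K_c + (complement of K_q)` of a clique on `c` vertices and `q` isolated vertices. -/
def cliqueJoinEmpty (c q : ℕ) : SimpleGraph (Fin c ⊕ Fin q) :=
  join (SimpleGraph.completeGraph (Fin c)) (SimpleGraph.emptyGraph (Fin q))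

/-- `P_{k 0} ∪ … ∪ P_{k (m-1)}`: disjoint paths, the `i`-th one on `k i` vertices. -/
def linearForest {m : ℕ} (k : Fin m → ℕ) : SimpleGraph (Σ i : Fin m, Fin (k i)) :=
  disjointUnion fun i => SimpleGraph.pathGraph (k i)

/-- `[n, m, l]`: if `n ≤ m - 1` this is `n.choose 2`; otherwise, writing
`n = (m - 1) + t (l - 1) + r` with `0 ≤ r < l - 1`, it is
`(m - 1).choose 2 + t * (l - 1).choose 2 + r.choose 2`. -/
def cliqueBound (n m l : ℕ) : ℕ :=
  if n ≤ m - 1 then n.choose 2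
  else (m - 1).choose 2 + (n - (m - 1)) / (l - 1) * (l - 1).choose 2
    + ((n - (m - 1)) % (l - 1)).choose 2

/-- `[n, m]`, with all divisions rounded down. -/
def joinBound (n m : ℕ) : ℕ :=
  (m / 2 - 1).choose 2 + ((m - 2) / 2) * (n - m / 2 + 1)

/-- The partial sum of `k` up to and including the index `j`. -/
def partialSum {m : ℕ} (k : Fin m → ℕ) (j : Fin m) : ℕ := ∑ i ∈ Finset.Iic j, k i

/-- The maximum of the numbers `[n, s_j, k_j]`, where `s_j` is the `j`-th partial sum of `k`,
and of `[n, s]`, where `s` is the sum of `k`. -/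
def pathsBound {m : ℕ} (n : ℕ) (k : Fin m → ℕ) : ℕ :=
  max (Finset.univ.sup fun j => cliqueBound n (partialSum k j) (k j))
    (joinBound n (∑ i, k i))

/-- The graphs `Ex(N, P_k)`, explicitly, for even `k`: write `N = (k - 1) t + r` with
`0 ≤ r < k - 1`; the graph is `t · K_{k-1} ∪ K_r` or, if `r = k/2` or `r = (k-2)/2`,
`(t - s - 1) · K_{k-1} ∪ (K_{(k-2)/2} + (q isolated vertices))` for some `s < t`, where
`q = k/2 + s (k - 1) + r`. -/
def IsPathExtremalGraph (k : ℕ) {N : ℕ} (G : SimpleGraph (Fin N)) : Prop :=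
  ∃ t r : ℕ, N = (k - 1) * t + r ∧ r < k - 1 ∧
    (Nonempty (G ≃g cliques t (k - 1) ⊕g SimpleGraph.completeGraph (Fin r)) ∨
      ((r = k / 2 ∨ r = (k - 2) / 2) ∧ ∃ s < t,
        Nonempty (G ≃g cliques (t - s - 1) (k - 1) ⊕g
          cliqueJoinEmpty ((k - 2) / 2) (k / 2 + s * (k - 1) + r))))

end DisjointPaths

/-! Lower bound. A clique on `s_j - 1` vertices cannot host the first `j` paths, so next to a graph
without `P_{k_j}` it gives a forest-free graph. In `K_c + (isolated vertices)` the clique is a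
vertex cover, and a path on `k_i` vertices needs `⌊k_i/2⌋` covering vertices. As at most one `k_i`
is odd, these floors add up to `⌊s_m/2⌋`.

Upper bound. Pack the paths, longest first, into the components of `G`, the paths assigned to one
component being consecutive pieces of a single long path (`exists_component_weights`). If `G` is
forest-free, this fails at some `j`. Let `c D` be the number of vertices packed into the component
`D`; these weights sum to `s_{j-1}`, and no component `D` has a path on `c D + k_j` vertices. Each
component is therefore a connected graph without a long path, to which Kopylov's theorem applies
(`kopylov_bound`): saturate the graph, delete vertices of small degree, and observe that what
remains is empty or a clique that survives a second, weaker deletion process (`core_of_saturated`).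
The engine is Pósa's rotation argument (`hasPath_of_pair`). The resulting edge bound is convex in
the size of the clique, so only its two extreme values matter (`kopylov_numeric`).

The bounds are superadditive when components are merged and weights added (`sum_componentBound_le`).
Hence `G` has at most `mainBound` edges, which is at most `M`, or it is connected and may exceed
`mainBound` by the single extra edge in Kopylov's bound for odd paths. For `j` not the last index,
the strict growth of the join bound absorbs that edge. For `j` the last, `G` contains a clique
joined to one edge and many isolated vertices, and this contains the forest because some path is
even (`linearForest_isContained_of_join_edge`).

Extremal graphs. For even lengths, equality is traced back through the same inequalities. All weight
must lie in one component, which is either all of `G` and a clique join, or a clique on `s_j - 1`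
vertices whose complement is extremal for `P_{k_j}`. -/

namespace DisjointPaths

open Finset

variable {V : Type*}

/-! ### Paths as vertex lists and rotations -/

/-- A list of vertices traversing a path of `G`. -/
def IsPathList (G : SimpleGraph V) (l : List V) : Prop := l.IsChain G.Adj ∧ l.Nodup

/-- `G` contains a path on `K` vertices. -/
def HasPath (G : SimpleGraph V) (K : ℕ) : Prop := ∃ l, IsPathList G l ∧ K ≤ l.length

theorem HasPath.mono {G : SimpleGraph V} {K L : ℕ} (h : HasPath G L) (hK : K ≤ L) :
    HasPath G K := by
  obtain ⟨l, hl, hL⟩ := h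
  exact ⟨l, hl, hK.trans hL⟩

theorem isChain_adj_reverse {G : SimpleGraph V} {l : List V} (h : l.IsChain G.Adj) :
    l.reverse.IsChain G.Adj := by
  rw [List.isChain_reverse]
  exact h.imp fun _ _ h => h.symm

/-- The new path runs along `B` backwards to `y`, jumps to position `j` of `x :: A`, goes back to
`x`, jumps to position `i` and continues to the end. Only the positions strictly between `j` and `i`
are lost. The hypotheses are phrased with `[·]?`, so that `i = A.length + 1` is allowed and means
that nothing follows after `x`. -/
theorem hasPath_of_rotate {G : SimpleGraph V} {x y : V} {A B : List V}
    (hA : (x :: A).IsChain G.Adj) (hB : (y :: B).IsChain G.Adj)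
    (hnd : ((x :: A) ++ (y :: B)).Nodup) {i j : ℕ} (hji : j < i) (hi : i ≤ A.length + 1)
    (hj : ∀ a, (x :: A)[j]? = some a → G.Adj y a)
    (hx : ∀ a, (x :: A)[i]? = some a → G.Adj x a) :
    HasPath G (B.length + 1 + (j + 1) + (A.length + 1 - i)) := by
  refine ⟨(y :: B).reverse ++ (((x :: A).take (j + 1)).reverse ++ (x :: A).drop i), ⟨?_, ?_⟩, ?_⟩
  · rw [List.isChain_append]
    refine ⟨isChain_adj_reverse hB, ?_, ?_⟩
    · rw [List.isChain_append]
      refine ⟨isChain_adj_reverse (hA.take _), hA.drop _, ?_⟩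
      intro a ha b hb
      rw [List.getLast?_reverse] at ha
      simp at ha
      rw [List.head?_drop] at hb
      subst ha
      exact hx b hb
    · intro a ha b hb
      rw [List.getLast?_reverse] at ha
      simp only [List.head?_cons, Option.mem_def, Option.some.injEq] at ha
      subst ha
      rw [List.head?_append, List.head?_reverse, List.getLast?_take] at hb
      have hlt : j < (x :: A).length := by simp; omega
      simp at hb
      rcases hb with hb | hb
      · exact hj b hb
      · simp at hlt
        omega
  · have h1 := List.nodup_append.1 hnd
    rw [List.nodup_append]
    refine ⟨List.nodup_reverse.2 h1.2.1, ?_, ?_⟩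
    · rw [List.nodup_append]
      refine ⟨List.nodup_reverse.2 (h1.1.sublist (List.take_sublist _ _)),
        h1.1.sublist (List.drop_sublist _ _), ?_⟩
      intro a ha b hb hab
      subst hab
      rw [List.mem_reverse] at ha
      exact List.disjoint_take_drop h1.1 (Nat.succ_le_of_lt hji) ha hb
    · intro a ha b hb hab
      subst hab
      rw [List.mem_reverse] at ha
      rw [List.mem_append, List.mem_reverse] at hb
      refine h1.2.2 a ?_ a ha rfl
      rcases hb with hb | hb
      · exact List.mem_of_mem_take hb
      · exact List.mem_of_mem_drop hb
  · simp
    omega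

-- Every neighbour of `y` at position `j` forbids neighbours of `x` at the next few positions, since
-- a rotation there would lose too few vertices to destroy a path on `K` vertices. Thus the
-- positions of the neighbours of `x` and the shifted positions of the neighbours of `y` are
-- disjoint. The last neighbour of `y`, if there is one, excludes a whole block of further
-- positions, which gives the sharper second bound.
open Classical in
theorem card_neighbors_side {G : SimpleGraph V} {x y : V} {A B : List V} {K : ℕ}
    (hA : (x :: A).IsChain G.Adj) (hB : (y :: B).IsChain G.Adj)
    (hnd : ((x :: A) ++ (y :: B)).Nodup) (hK : ¬ HasPath G K)
    (hlen : K ≤ A.length + 1 + (B.length + 1)) :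
    #((x :: A).toFinset.filter (G.Adj x)) + #((x :: A).toFinset.filter (G.Adj y)) ≤ A.length ∧
    (((x :: A).toFinset.filter (G.Adj y)).Nonempty →
      #((x :: A).toFinset.filter (G.Adj x)) + #((x :: A).toFinset.filter (G.Adj y))
        + (B.length + 1) + 1 ≤ K) := by
  set L := x :: A with hL
  set f : V → ℕ := fun v => L.idxOf v with hf
  set Nx := L.toFinset.filter (G.Adj x) with hNx
  set Ny := L.toFinset.filter (G.Adj y) with hNy
  have hLlen : L.length = A.length + 1 := by simp [hL]
  have hget : ∀ v ∈ L, L[f v]? = some v := by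
    intro v hv
    have : f v < L.length := List.idxOf_lt_length_iff.2 hv
    rw [List.getElem?_eq_getElem this]
    simp [hf]
  have hinj : Set.InjOn f {v | v ∈ L} := by
    intro u hu v hv huv
    have h1 := hget u hu
    rw [huv, hget v hv] at h1
    exact (Option.some.inj h1).symm
  -- A rotation may lose up to `A.length + B.length + 2 - K` vertices, so it is harmless to move
  -- forward by one more position than that. The block must also end before the end of the path:
  -- otherwise the variant with an empty tail is long enough.
  have hgap : ∀ v ∈ Ny, ∀ u, f v < u → u ≤ f v + (A.length + B.length + 3 - K) →
      u < A.length + 1 ∧ ∀ w ∈ Nx, f w ≠ u := by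
    intro v hv u hu1 hu2
    rw [hNy, mem_filter, List.mem_toFinset] at hv
    have hfv : f v < L.length := List.idxOf_lt_length_iff.2 hv.1
    have hjv : ∀ a, L[f v]? = some a → G.Adj y a := by
      intro a ha
      rw [hget v hv.1] at ha
      exact Option.some.inj ha ▸ hv.2
    have hup : u < A.length + 1 := by
      by_contra hcon
      refine hK ((hasPath_of_rotate hA hB hnd (i := A.length + 1) (j := f v) (by omega) le_rfl hjv
        ?_).mono (by omega))
      intro a ha
      rw [← hL, List.getElem?_eq_none (by omega)] at ha
      cases ha
    refine ⟨hup, ?_⟩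
    intro w hw hwu
    rw [hNx, mem_filter, List.mem_toFinset] at hw
    refine hK ((hasPath_of_rotate hA hB hnd (i := u) (j := f v) hu1 hup.le hjv ?_).mono (by omega))
    intro a ha
    rw [← hL, ← hwu, hget w hw.1] at ha
    exact Option.some.inj ha ▸ hw.2
  have hcx : #(Nx.image f) = #Nx := card_image_of_injOn fun u hu v hv h =>
    hinj (List.mem_toFinset.1 (mem_filter.1 hu).1) (List.mem_toFinset.1 (mem_filter.1 hv).1) h
  have hcy : #(Ny.image fun v => f v + 1) = #Ny := card_image_of_injOn fun u hu v hv h =>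
    hinj (List.mem_toFinset.1 (mem_filter.1 hu).1) (List.mem_toFinset.1 (mem_filter.1 hv).1)
      (Nat.succ_injective h)
  have hdisj : Disjoint (Nx.image f) (Ny.image fun v => f v + 1) := by
    rw [disjoint_left]
    intro u hu hu'
    obtain ⟨w, hw, rfl⟩ := mem_image.1 hu
    obtain ⟨v, hv, hvw⟩ := mem_image.1 hu'
    exact (hgap v hv (f w) (by omega) (by omega)).2 w hw rfl
  have hsub : Nx.image f ∪ (Ny.image fun v => f v + 1) ⊆ Ico 1 (A.length + 1) := by
    intro u hu
    rw [mem_Ico]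
    rcases mem_union.1 hu with hu | hu
    · obtain ⟨w, hw, rfl⟩ := mem_image.1 hu
      have hw' := (mem_filter.1 hw)
      have h1 : f w < L.length := List.idxOf_lt_length_iff.2 (List.mem_toFinset.1 hw'.1)
      refine ⟨?_, by omega⟩
      rw [Nat.one_le_iff_ne_zero]
      intro h0
      have := hget w (List.mem_toFinset.1 hw'.1)
      rw [h0, hL] at this
      simp at this
      exact G.ne_of_adj hw'.2 this
    · obtain ⟨v, hv, rfl⟩ := mem_image.1 hu
      exact ⟨by omega, (hgap v hv (f v + 1) (by omega) (by omega)).1⟩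
  constructor
  · have := card_le_card hsub
    rw [card_union_of_disjoint hdisj, hcx, hcy] at this
    simpa using this
  · intro hne
    -- After the last neighbour of `y`, the positions `f v + 2, …, f v + g` lie in neither of the
    -- two sets, so these `g - 1` positions can be added to the count.
    obtain ⟨v, hv, hmax⟩ := exists_max_image Ny f hne
    set g := A.length + B.length + 3 - K with hg
    have hd2 : Disjoint (Nx.image f ∪ (Ny.image fun v => f v + 1)) (Ioc (f v + 1) (f v + g)) := by
      rw [disjoint_left]
      intro u hu hu'
      rw [mem_Ioc] at hu'
      rcases mem_union.1 hu with hu | hu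
      · obtain ⟨w, hw, rfl⟩ := mem_image.1 hu
        exact (hgap v hv (f w) (by omega) (by omega)).2 w hw rfl
      · obtain ⟨w, hw, rfl⟩ := mem_image.1 hu
        have := hmax w hw
        omega
    have hs2 : (Nx.image f ∪ (Ny.image fun v => f v + 1)) ∪ (Ioc (f v + 1) (f v + g)) ⊆
        Ico 1 (A.length + 1) := by
      refine union_subset hsub ?_
      intro u hu
      rw [mem_Ioc] at hu
      rw [mem_Ico]
      exact ⟨by omega, (hgap v hv u (by omega) (by omega)).1⟩
    have := card_le_card hs2
    rw [card_union_of_disjoint hd2, card_union_of_disjoint hdisj, hcx, hcy, Nat.card_Ioc,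
      Nat.card_Ico] at this
    omega

-- The last neighbour `v` of `x` closes a cycle with the initial segment of the path, and this cycle
-- has more vertices than `x` has neighbours on the path. A vertex on the cycle is the start of a
-- path around it; a vertex behind the cycle can walk back to `x`.
open Classical in
theorem exists_long_path_from {G : SimpleGraph V} {x : V} {A : List V}
    (hA : IsPathList G (x :: A)) {a : V} (ha : a ∈ x :: A) :
    ∃ l, IsPathList G (a :: l) ∧ (∀ v ∈ l, v ∈ x :: A) ∧
      #((x :: A).toFinset.filter (G.Adj x)) ≤ l.length := by
  set L := x :: A with hL
  set f : V → ℕ := fun v => L.idxOf v with hf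
  set Nx := L.toFinset.filter (G.Adj x) with hNx
  have hget : ∀ v ∈ L, L[f v]? = some v := by
    intro v hv
    have : f v < L.length := List.idxOf_lt_length_iff.2 hv
    rw [List.getElem?_eq_getElem this]
    simp [hf]
  rcases Nx.eq_empty_or_nonempty with h0 | hne
  · exact ⟨[], ⟨by simp, by simp⟩, by simp, by simp [h0]⟩
  obtain ⟨v, hv, hmax⟩ := exists_max_image Nx f hne
  have hv' := mem_filter.1 hv
  have hvL : v ∈ L := List.mem_toFinset.1 hv'.1
  have hinj : Set.InjOn f {v | v ∈ L} := by
    intro u hu v hv huv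
    have h1 := hget u hu
    rw [huv, hget v hv] at h1
    exact (Option.some.inj h1).symm
  have hcard : #Nx ≤ f v := by
    rw [← card_image_of_injOn (s := Nx) (f := f) fun u hu v hv h =>
      hinj (List.mem_toFinset.1 (mem_filter.1 hu).1) (List.mem_toFinset.1 (mem_filter.1 hv).1) h]
    have : Nx.image f ⊆ Ioc 0 (f v) := by
      intro u hu
      obtain ⟨w, hw, rfl⟩ := mem_image.1 hu
      rw [mem_Ioc]
      refine ⟨?_, hmax w hw⟩
      rw [Nat.pos_iff_ne_zero]
      intro h0
      have hw' := mem_filter.1 hw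
      have := hget w (List.mem_toFinset.1 hw'.1)
      rw [h0, hL] at this
      simp at this
      exact G.ne_of_adj hw'.2 this
    simpa using card_le_card this
  have hfa : f a < L.length := List.idxOf_lt_length_iff.2 ha
  have hfv : f v < L.length := List.idxOf_lt_length_iff.2 hvL
  have hLa : L[f a] = a := by simp [hf]
  have hLv : L[f v] = v := by simp [hf]
  obtain ⟨l, hl⟩ : ∃ l, (L.take (f a + 1)).reverse = a :: l := by
    rw [List.take_add_one, List.getElem?_eq_getElem hfa, hLa]
    simp
  have hll : l.length = f a := by
    have := congrArg List.length hl
    simp only [List.length_reverse, List.length_take, List.length_cons] at this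
    omega
  have hlsub : ∀ u ∈ a :: l, u ∈ L := by
    intro u hu
    rw [← hl, List.mem_reverse] at hu
    exact List.mem_of_mem_take hu
  rcases lt_or_ge (f v) (f a) with hlt | hge
  · refine ⟨l, ?_, fun u hu => hlsub u (List.mem_cons_of_mem _ hu), by omega⟩
    rw [← hl]
    exact ⟨isChain_adj_reverse (hA.1.take _),
      List.nodup_reverse.2 (hA.2.sublist (List.take_sublist _ _))⟩
  · refine ⟨l ++ ((L.take (f v + 1)).drop (f a + 1)).reverse, ?_, ?_, ?_⟩
    · rw [← List.cons_append, ← hl]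
      constructor
      · rw [List.isChain_append]
        refine ⟨isChain_adj_reverse (hA.1.take _), isChain_adj_reverse ((hA.1.take _).drop _), ?_⟩
        intro b hb c hc
        rw [List.getLast?_reverse] at hb
        rw [List.head?_reverse, List.getLast?_drop] at hc
        split_ifs at hc
        · cases hc
        rw [List.getLast?_take] at hc
        simp [hL] at hb
        have hfv' := hLv
        simp [hfv, hLv] at hc
        subst hb
        rw [← hc]
        exact hv'.2
      · rw [List.nodup_append]
        refine ⟨List.nodup_reverse.2 (hA.2.sublist (List.take_sublist _ _)),
          List.nodup_reverse.2 ((hA.2.sublist (List.take_sublist _ _)).sublist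
            (List.drop_sublist _ _)), ?_⟩
        intro b hb c hc hbc
        subst hbc
        rw [List.mem_reverse] at hb hc
        rw [List.drop_take] at hc
        exact List.disjoint_take_drop hA.2 le_rfl hb (List.mem_of_mem_take hc)
    · intro u hu
      rcases List.mem_append.1 hu with hu | hu
      · exact hlsub u (List.mem_cons_of_mem _ hu)
      · rw [List.mem_reverse] at hu
        exact List.mem_of_mem_take (List.mem_of_mem_drop hu)
    · simp
      omega

/-- In a connected graph, two sets of vertices are joined by a path that is internally disjoint
from both of them. -/
theorem exists_connecting_walk {G : SimpleGraph V} (hG : G.Connected) {X Y : Set V}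
    (hX : X.Nonempty) (hY : Y.Nonempty) :
    ∃ a ∈ X, ∃ b ∈ Y, ∃ p : G.Walk a b, p.IsPath ∧
      (∀ c ∈ p.support, c ∈ X → c = a) ∧ ∀ c ∈ p.support, c ∈ Y → c = b := by
  classical
  obtain ⟨a₀, ha₀⟩ := hX
  obtain ⟨b₀, hb₀⟩ := hY
  have hex : ∃ n, ∃ a ∈ X, ∃ b ∈ Y, ∃ p : G.Walk a b, p.length = n := by
    obtain ⟨p⟩ := hG.preconnected a₀ b₀
    exact ⟨p.length, a₀, ha₀, b₀, hb₀, p, rfl⟩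
  obtain ⟨a, ha, b, hb, p, hp⟩ := Nat.find_spec hex
  have hmin : ∀ a' ∈ X, ∀ b' ∈ Y, ∀ q : G.Walk a' b', p.length ≤ q.length := by
    intro a' ha' b' hb' q
    rw [hp]
    exact Nat.find_min' hex ⟨a', ha', b', hb', q, rfl⟩
  have hpath : p.IsPath := by
    have h1 := p.length_bypass_le_length
    have h2 := hmin a ha b hb p.bypass
    have : p.bypass = p := SimpleGraph.Walk.bypass_eq_self_of_length_le_length_bypass p h2
    rw [← this]
    exact p.bypass_isPath
  refine ⟨a, ha, b, hb, p, hpath, ?_, ?_⟩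
  · intro c hc hcX
    have h1 := congrArg SimpleGraph.Walk.length (p.take_spec hc)
    rw [SimpleGraph.Walk.length_append] at h1
    have h2 := hmin c hcX b hb (p.dropUntil c hc)
    exact (SimpleGraph.Walk.eq_of_length_eq_zero (p := p.takeUntil c hc) (by omega)).symm
  · intro c hc hcY
    have h1 := congrArg SimpleGraph.Walk.length (p.take_spec hc)
    rw [SimpleGraph.Walk.length_append] at h1
    have h2 := hmin a ha c hcY (p.takeUntil c hc)
    exact (SimpleGraph.Walk.eq_of_length_eq_zero (p := p.dropUntil c hc) (by omega))

/-- A shortest connection between `X` and `Y` meets each of them only in its endpoint, so it can be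
prolonged inside `X` and inside `Y`. -/
theorem hasPath_of_connected {G : SimpleGraph V} (hG : G.Connected) {X Y : Set V}
    (hX : X.Nonempty) (hY : Y.Nonempty) (hXY : Disjoint X Y) {d e : ℕ}
    (hd : ∀ a ∈ X, ∃ l, IsPathList G (a :: l) ∧ (∀ v ∈ l, v ∈ X) ∧ d ≤ l.length)
    (he : ∀ a ∈ Y, ∃ l, IsPathList G (a :: l) ∧ (∀ v ∈ l, v ∈ Y) ∧ e ≤ l.length) :
    HasPath G (d + e + 2) := by
  obtain ⟨a, ha, b, hb, p, hp, hpX, hpY⟩ := exists_connecting_walk hG hX hY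
  obtain ⟨l, hl, hlX, hld⟩ := hd a ha
  obtain ⟨l', hl', hlY, hle⟩ := he b hb
  have hab : a ≠ b := fun h => Set.disjoint_left.1 hXY ha (h ▸ hb)
  have hplen : 1 ≤ p.length := by
    rw [Nat.one_le_iff_ne_zero]
    exact fun h => hab (SimpleGraph.Walk.eq_of_length_eq_zero h)
  have hsl : p.support.length = p.length + 1 := p.length_support
  refine ⟨l.reverse ++ (p.support ++ l'), ⟨?_, ?_⟩, by simp; omega⟩
  · rw [List.isChain_append]
    have h1 := (List.isChain_cons.1 hl.1)
    have h2 := (List.isChain_cons.1 hl'.1)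
    refine ⟨isChain_adj_reverse h1.2, ?_, ?_⟩
    · rw [List.isChain_append]
      refine ⟨p.isChain_adj_support, h2.2, ?_⟩
      intro u hu v hv
      rw [List.getLast?_eq_some_getLast p.support_ne_nil, p.getLast_support] at hu
      simp only [Option.mem_def, Option.some.injEq] at hu
      subst hu
      exact h2.1 v hv
    · intro u hu v hv
      rw [List.getLast?_reverse] at hu
      rw [← p.cons_tail_support] at hv
      simp only [List.cons_append, List.head?_cons, Option.mem_def, Option.some.injEq] at hv
      subst hv
      exact (h1.1 u hu).symm
  · rw [List.nodup_append]
    have h1 := List.nodup_cons.1 hl.2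
    have h2 := List.nodup_cons.1 hl'.2
    refine ⟨List.nodup_reverse.2 h1.2, ?_, ?_⟩
    · rw [List.nodup_append]
      refine ⟨hp.support_nodup, h2.2, ?_⟩
      intro u hu v hv huv
      subst huv
      exact h2.1 (hpY u hu (hlY u hv) ▸ hv)
    · intro u hu v hv huv
      subst huv
      rw [List.mem_reverse] at hu
      rcases List.mem_append.1 hv with hv | hv
      · exact h1.1 (hpX u hv (hlX u hu) ▸ hu)
      · exact Set.disjoint_left.1 hXY (hlX u hu) (hlY u hv)

open Classical in
/-- A variant of a lemma of Pósa: two disjoint paths starting in vertices of large degree can be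
recombined into a long path. -/
theorem hasPath_of_pair {G : SimpleGraph V} (hG : G.Connected) {x y : V} {A B : List V} {K : ℕ}
    (hA : (x :: A).IsChain G.Adj) (hB : (y :: B).IsChain G.Adj)
    (hnd : ((x :: A) ++ (y :: B)).Nodup) (hlen : K ≤ A.length + 1 + (B.length + 1))
    (hdeg : K ≤ #(((x :: A) ++ (y :: B)).toFinset.filter (G.Adj x)) +
      #(((x :: A) ++ (y :: B)).toFinset.filter (G.Adj y)) + 1) : HasPath G K := by
  by_contra hK
  have hnd' : ((y :: B) ++ (x :: A)).Nodup := List.nodup_append_comm.1 hnd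
  have h1 := card_neighbors_side hA hB hnd hK hlen
  have h2 := card_neighbors_side hB hA hnd' hK (by omega)
  have hsplit : ∀ z, #(((x :: A) ++ (y :: B)).toFinset.filter (G.Adj z)) =
      #((x :: A).toFinset.filter (G.Adj z)) + #((y :: B).toFinset.filter (G.Adj z)) := by
    intro z
    rw [List.toFinset_append, filter_union, card_union_of_disjoint]
    refine disjoint_filter_filter ?_
    rw [disjoint_left]
    intro u hu hu'
    rw [List.mem_toFinset] at hu hu'
    exact (List.nodup_append.1 hnd).2.2 u hu u hu' rfl
  rw [hsplit, hsplit] at hdeg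
  -- If one of `x`, `y` has a neighbour on the path of the other, the sharp bound on that side and
  -- the simple bound on the other side add up to degree sum at most `K - 2`. If there are no cross
  -- neighbours, each path carries long paths from all of its vertices, and a connection between the
  -- two is long enough.
  rcases ((x :: A).toFinset.filter (G.Adj y)).eq_empty_or_nonempty with e1 | n1
  · rcases ((y :: B).toFinset.filter (G.Adj x)).eq_empty_or_nonempty with e2 | n2
    · rw [e1, e2, card_empty] at hdeg
      have h3 := List.nodup_append.1 hnd
      refine hK ((hasPath_of_connected hG (X := {v | v ∈ x :: A}) (Y := {v | v ∈ y :: B})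
        ⟨x, by simp⟩ ⟨y, by simp⟩ ?_
        (fun a ha => exists_long_path_from ⟨hA, h3.1⟩ ha)
        (fun a ha => exists_long_path_from ⟨hB, h3.2.1⟩ ha)).mono (by omega))
      rw [Set.disjoint_left]
      intro u hu hu'
      exact h3.2.2 u hu u hu' rfl
    · have := h2.2 n2
      have := h1.1
      omega
  · have := h1.2 n1
    have := h2.1
    omega

/-! ### Saturated graphs: vertices of large degree are adjacent -/

/-- Adding any edge to `G` creates a path on `K` vertices. -/
def Saturated (G : SimpleGraph V) (K : ℕ) : Prop :=
  ∀ x y, x ≠ y → ¬ G.Adj x y → HasPath (G ⊔ SimpleGraph.edge x y) K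

theorem exists_saturated [Finite V] {G : SimpleGraph V} {K : ℕ} (hK : ¬ HasPath G K) :
    ∃ G', G ≤ G' ∧ ¬ HasPath G' K ∧ Saturated G' K := by
  obtain ⟨G', hle, hmax⟩ := Finite.exists_le_maximal (p := fun H => ¬ HasPath H K) hK
  refine ⟨G', hle, hmax.prop, fun x y hxy hadj => ?_⟩
  by_contra hcon
  have h1 := hmax.le_of_ge hcon le_sup_left
  refine hadj (h1 ?_)
  rw [SimpleGraph.sup_adj, SimpleGraph.edge_adj]
  exact Or.inr ⟨Or.inl ⟨rfl, rfl⟩, hxy⟩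

/-- The long path must use the added edge; cutting it there leaves two disjoint paths of `G`
starting at `x` and at `y`, which is the input of the rotation argument. -/
theorem exists_pair_of_hasPath_sup_edge {G : SimpleGraph V} {K : ℕ} {x y : V}
    (hK : ¬ HasPath G K) (h : HasPath (G ⊔ SimpleGraph.edge x y) K) :
    ∃ A B, (x :: A).IsChain G.Adj ∧ (y :: B).IsChain G.Adj ∧ ((x :: A) ++ (y :: B)).Nodup ∧
      K ≤ A.length + 1 + (B.length + 1) := by
  obtain ⟨l, hl, hlen⟩ := h
  have hnot : ¬ l.IsChain G.Adj := fun hc => hK ⟨l, ⟨hc, hl.2⟩, hlen⟩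
  rw [List.isChain_iff_forall_rel_of_append_cons_cons] at hnot
  push Not at hnot
  obtain ⟨a, b, l₁, l₂, hsplit, hab⟩ := hnot
  have hadj := List.isChain_iff_forall_rel_of_append_cons_cons.1 hl.1 hsplit
  subst hsplit
  rw [SimpleGraph.sup_adj, SimpleGraph.edge_adj] at hadj
  have hxy := hadj.resolve_left hab
  have hnd : ((l₁ ++ [a]) ++ (b :: l₂)).Nodup := by simpa using hl.2
  have hch : ((l₁ ++ [a]) ++ (b :: l₂)).IsChain (G ⊔ SimpleGraph.edge x y).Adj := by
    simpa using hl.1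
  have hnd' := List.nodup_append.1 hnd
  have key : ∀ L : List V, L.IsChain (G ⊔ SimpleGraph.edge x y).Adj → (a ∉ L ∨ b ∉ L) →
      L.IsChain G.Adj := by
    intro L hL hor
    refine hL.imp_of_mem_imp fun u v hu hv huv => ?_
    rw [SimpleGraph.sup_adj, SimpleGraph.edge_adj] at huv
    refine huv.resolve_right fun h' => ?_
    aesop
  have hbn : b ∉ l₁ ++ [a] := fun hb => hnd'.2.2 b hb b (by simp) rfl
  have han : a ∉ b :: l₂ := fun ha => hnd'.2.2 a (by simp) a ha rfl
  have hc1 := key _ hch.left_of_append (Or.inr hbn)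
  have hc2 := key _ hch.right_of_append (Or.inl han)
  have hc1' : (a :: l₁.reverse).IsChain G.Adj := by
    have := isChain_adj_reverse hc1
    simpa using this
  have hnd1 : ((a :: l₁.reverse) ++ (b :: l₂)).Nodup := by
    have : ((l₁ ++ [a]).reverse ++ (b :: l₂)).Nodup := by
      rw [List.nodup_append]
      refine ⟨List.nodup_reverse.2 hnd'.1, hnd'.2.1, fun u hu => hnd'.2.2 u (List.mem_reverse.1 hu)⟩
    simpa using this
  simp only [List.length_append, List.length_cons] at hlen
  rcases hxy.1 with ⟨rfl, rfl⟩ | ⟨rfl, rfl⟩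
  · exact ⟨l₁.reverse, l₂, hc1', hc2, hnd1, by simp; omega⟩
  · exact ⟨l₂, l₁.reverse, hc2, hc1', List.nodup_append_comm.1 hnd1, by simp; omega⟩

-- Among all non-adjacent pairs in `T × S` and all disjoint pairs of paths starting there, a choice
-- with the most vertices keeps all `T`-neighbours of `x` and all `S`-neighbours of `y` on the two
-- paths. The rotation argument then applies to the degrees counted in `T` and `S`.
open Classical in
theorem adj_of_large_degrees [Fintype V] {G : SimpleGraph V} {K a b : ℕ} (hG : G.Connected)
    (hK : ¬ HasPath G K) (hsat : Saturated G K) {S T : Finset V}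
    (hT : ∀ x ∈ T, a ≤ #(T.filter (G.Adj x))) (hS : ∀ x ∈ S, b ≤ #(S.filter (G.Adj x)))
    (hab : K ≤ a + b + 1) {x y : V} (hx : x ∈ T) (hy : y ∈ S) (hxy : x ≠ y) : G.Adj x y := by
  by_contra hadj
  let P : ℕ → Prop := fun n => ∃ x ∈ T, ∃ y ∈ S, ∃ A B, x ≠ y ∧ ¬ G.Adj x y ∧
    (x :: A).IsChain G.Adj ∧ (y :: B).IsChain G.Adj ∧ ((x :: A) ++ (y :: B)).Nodup ∧
      n = A.length + 1 + (B.length + 1)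
  have hbound : ∀ n, P n → n ≤ Fintype.card V := by
    rintro n ⟨x, -, y, -, A, B, -, -, -, -, hnd, rfl⟩
    have := hnd.length_le_card
    simp at this
    omega
  obtain ⟨A₀, B₀, h1, h2, h3, h4⟩ := exists_pair_of_hasPath_sup_edge hK (hsat x y hxy hadj)
  have hP₀ : P (A₀.length + 1 + (B₀.length + 1)) :=
    ⟨x, hx, y, hy, A₀, B₀, hxy, hadj, h1, h2, h3, rfl⟩
  obtain ⟨N, hN, hmax, hKN⟩ : ∃ N, P N ∧ (∀ m, P m → m ≤ N) ∧ K ≤ N := by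
    refine ⟨Nat.findGreatest P (Fintype.card V), Nat.findGreatest_spec (hbound _ hP₀) hP₀,
      fun m hm => Nat.le_findGreatest (hbound m hm) hm,
      h4.trans (Nat.le_findGreatest (hbound _ hP₀) hP₀)⟩
  obtain ⟨x, hx, y, hy, A, B, hxy, hadj, hA, hB, hnd, rfl⟩ := hN
  have hnd' := List.nodup_append.1 hnd
  -- A common neighbour outside the paths would link them into one path on more than `K` vertices.
  -- Hence a neighbour of `x` outside is not adjacent to `y`, and it could replace `x` in a larger
  -- choice.
  have hext : ∀ z, z ∉ (x :: A) ++ (y :: B) → G.Adj x z → ¬ G.Adj y z := by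
    intro z hz hxz hyz
    refine hK ⟨(x :: A).reverse ++ (z :: y :: B), ⟨?_, ?_⟩, ?_⟩
    · rw [List.isChain_append]
      refine ⟨isChain_adj_reverse hA, List.isChain_cons_cons.2 ⟨hyz.symm, hB⟩, ?_⟩
      intro u hu v hv
      rw [List.getLast?_reverse] at hu
      simp at hu hv
      subst hu hv
      exact hxz
    · have : (z :: ((x :: A) ++ (y :: B))).Nodup := List.nodup_cons.2 ⟨hz, hnd⟩
      have h5 : ((x :: A) ++ (z :: (y :: B))).Nodup := List.nodup_middle.2 this
      rw [List.nodup_append] at h5 ⊢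
      exact ⟨List.nodup_reverse.2 h5.1, h5.2.1, fun u hu => h5.2.2 u (List.mem_reverse.1 hu)⟩
    · simp; omega
  have hxn : ∀ z ∈ T, G.Adj x z → z ∈ (x :: A) ++ (y :: B) := by
    intro z hzT hxz
    by_contra hz
    have hyz := hext z hz hxz
    have hzy : z ≠ y := by
      rintro rfl
      simp at hz
    have := hmax _ ⟨z, hzT, y, hy, x :: A, B, hzy, fun h => hyz h.symm,
      List.isChain_cons_cons.2 ⟨hxz.symm, hA⟩, hB, List.nodup_cons.2 ⟨hz, hnd⟩, rfl⟩
    simp at this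
  have hyn : ∀ z ∈ S, G.Adj y z → z ∈ (x :: A) ++ (y :: B) := by
    intro z hzS hyz
    by_contra hz
    have hxz : ¬ G.Adj x z := fun h => hext z hz h hyz
    have hzx : x ≠ z := by
      rintro rfl
      simp at hz
    have := hmax _ ⟨x, hx, z, hzS, A, y :: B, hzx, hxz, hA,
      List.isChain_cons_cons.2 ⟨hyz.symm, hB⟩,
      List.nodup_middle.2 (List.nodup_cons.2 ⟨hz, hnd⟩), rfl⟩
    simp at this
  refine hK (hasPath_of_pair hG hA hB hnd hKN ?_)
  have c1 : #(T.filter (G.Adj x)) ≤ #(((x :: A) ++ (y :: B)).toFinset.filter (G.Adj x)) := by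
    refine card_le_card fun z hz => ?_
    rw [mem_filter] at hz ⊢
    exact ⟨List.mem_toFinset.2 (hxn z hz.1 hz.2), hz.2⟩
  have c2 : #(S.filter (G.Adj y)) ≤ #(((x :: A) ++ (y :: B)).toFinset.filter (G.Adj y)) := by
    refine card_le_card fun z hz => ?_
    rw [mem_filter] at hz ⊢
    exact ⟨List.mem_toFinset.2 (hyn z hz.1 hz.2), hz.2⟩
  have := hT x hx
  have := hS y hy
  omega

open Classical in
-- Disintegration and Kopylov's bound
/-- The number of ordered pairs of adjacent vertices in `T`. -/
noncomputable def adjPairs (G : SimpleGraph V) (T : Finset V) : ℕ :=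
  ∑ x ∈ T, #(T.filter (G.Adj x))

open Classical in
theorem adjPairs_erase (G : SimpleGraph V) {T : Finset V} {x : V} (hx : x ∈ T) :
    adjPairs G T = adjPairs G (T.erase x) + 2 * #(T.filter (G.Adj x)) := by
  unfold adjPairs
  rw [← add_sum_erase T _ hx]
  have h1 : ∀ y ∈ T.erase x, #(T.filter (G.Adj y)) =
      #((T.erase x).filter (G.Adj y)) + if G.Adj x y then 1 else 0 := by
    intro y hy
    rw [filter_erase]
    split_ifs with h
    · rw [card_erase_add_one]
      exact mem_filter.2 ⟨hx, h.symm⟩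
    · rw [erase_eq_of_notMem]
      · rfl
      · exact fun h' => h (mem_filter.1 h').2.symm
  rw [sum_congr rfl h1, sum_add_distrib, ← card_filter]
  have h2 : (T.erase x).filter (G.Adj x) = T.filter (G.Adj x) := by
    rw [filter_erase, erase_eq_of_notMem]
    exact fun h' => G.irrefl (mem_filter.1 h').2
  rw [h2]
  ring

open Classical in
theorem card_filter_adj_lt (G : SimpleGraph V) {T : Finset V} {x : V} (hx : x ∈ T) :
    #(T.filter (G.Adj x)) + 1 ≤ #T := by
  rw [← card_erase_add_one hx]
  refine Nat.add_le_add_right (card_le_card fun y hy => ?_) 1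
  rw [mem_filter] at hy
  exact mem_erase.2 ⟨hy.2.ne', hy.1⟩

theorem adjPairs_le (G : SimpleGraph V) (T : Finset V) : adjPairs G T + #T ≤ #T * #T := by
  classical
  unfold adjPairs
  calc _ = ∑ x ∈ T, (#(T.filter (G.Adj x)) + 1) := by simp [sum_add_distrib]
    _ ≤ ∑ x ∈ T, #T := sum_le_sum fun x hx => card_filter_adj_lt G hx
    _ = _ := by simp

open Classical in
/-- Every vertex of `S` has more than `d` neighbours in `S`. -/
def IsCore (G : SimpleGraph V) (d : ℕ) (S : Finset V) : Prop :=
  ∀ x ∈ S, d < #(S.filter (G.Adj x))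

/-- `S` is the largest set in which every vertex has more than `d` neighbours. -/
def IsMaxCore (G : SimpleGraph V) (d : ℕ) (S : Finset V) : Prop :=
  IsCore G d S ∧ ∀ T, IsCore G d T → T ⊆ S

theorem exists_isMaxCore [Fintype V] (G : SimpleGraph V) (d : ℕ) : ∃ S, IsMaxCore G d S := by
  classical
  refine ⟨univ.filter fun x => ∃ T, IsCore G d T ∧ x ∈ T, ?_, ?_⟩
  · intro x hx
    obtain ⟨T, hT, hxT⟩ := (mem_filter.1 hx).2
    refine (hT x hxT).trans_le (card_le_card (filter_subset_filter _ fun y hy => ?_))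
    exact mem_filter.2 ⟨mem_univ _, T, hT, hy⟩
  · intro T hT y hy
    exact mem_filter.2 ⟨mem_univ _, T, hT, hy⟩

/-- A set strictly larger than the core is not a core, so it has a vertex with at most `d`
neighbours inside it. This vertex lies outside `S`; deleting it costs at most `2 * d` ordered pairs,
and the process can be stopped at any size `q`. -/
theorem IsMaxCore.exists_card_eq {G : SimpleGraph V} {d : ℕ} {S : Finset V} (hS : IsMaxCore G d S)
    {T : Finset V} (hST : S ⊆ T) {q : ℕ} (hq : #S ≤ q) (hqT : q ≤ #T) :
    ∃ W, S ⊆ W ∧ W ⊆ T ∧ #W = q ∧ adjPairs G T ≤ adjPairs G W + 2 * d * (#T - q) := by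
  classical
  obtain ⟨n, hn⟩ := Nat.exists_eq_add_of_le hqT
  induction n generalizing T with
  | zero => exact ⟨T, hST, Subset.rfl, by omega, by omega⟩
  | succ n ih =>
    have hnc : ¬ IsCore G d T := by
      intro hc
      have := card_le_card (hS.2 T hc)
      omega
    unfold IsCore at hnc
    push Not at hnc
    obtain ⟨x, hxT, hx⟩ := hnc
    have hxS : x ∉ S := by
      intro hxS
      have h1 := hS.1 x hxS
      have h2 := card_le_card (filter_subset_filter (G.Adj x) hST)
      omega
    have hc := card_erase_of_mem hxT
    obtain ⟨W, h1, h2, h3, h4⟩ := ih (T := T.erase x) (subset_erase.2 ⟨hST, hxS⟩)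
      (by omega) (by omega)
    refine ⟨W, h1, h2.trans (erase_subset _ _), h3, ?_⟩
    rw [adjPairs_erase G hxT]
    have e1 : #T - q = (#(T.erase x) - q) + 1 := by omega
    rw [e1, Nat.mul_add, mul_one]
    omega

theorem IsMaxCore.adjPairs_le {G : SimpleGraph V} {d : ℕ} {S : Finset V} (hS : IsMaxCore G d S)
    {T : Finset V} (hST : S ⊆ T) : adjPairs G T ≤ adjPairs G S + 2 * d * (#T - #S) := by
  obtain ⟨W, h1, h2, h3, h4⟩ := hS.exists_card_eq hST le_rfl (card_le_card hST)
  rwa [← eq_of_subset_of_card_le h1 h3.le] at h4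

/-- The number of edges of the join of a clique on `h` vertices and `n - h` isolated vertices. -/
def joinEdges (h n : ℕ) : ℕ := h.choose 2 + h * (n - h)

theorem two_mul_choose_two (a : ℕ) : 2 * a.choose 2 + a = a * a := by
  rw [Nat.choose_two_right, Nat.mul_div_cancel' (Nat.even_mul_pred_self a).two_dvd]
  cases a with
  | zero => rfl
  | succ a => simp; ring

theorem two_mul_joinEdges {h n : ℕ} (hn : h ≤ n) :
    2 * joinEdges h n + h * h + h = 2 * h * n := by
  obtain ⟨a, rfl⟩ := Nat.exists_eq_add_of_le hn
  unfold joinEdges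
  have := two_mul_choose_two h
  rw [Nat.add_sub_cancel_left]
  nlinarith

/-- The deletion is stopped at `d + 1` vertices, where the trivial bound by a complete graph is
exactly `joinEdges d (d + 1)`; every vertex put back adds at most `d` edges, as in the join. -/
theorem adjPairs_le_of_isMaxCore_empty {G : SimpleGraph V} {d : ℕ} (hS : IsMaxCore G d ∅)
    {T : Finset V} (hT : d + 1 ≤ #T) : adjPairs G T ≤ 2 * joinEdges d #T := by
  obtain ⟨W, h1, h2, h3, h4⟩ := hS.exists_card_eq (empty_subset T) (q := d + 1) (by simp) hT
  have h5 := DisjointPaths.adjPairs_le G W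
  have h6 := two_mul_joinEdges (h := d) (n := #T) (by omega)
  rw [h3] at h5
  obtain ⟨a, ha⟩ := Nat.exists_eq_add_of_le hT
  rw [ha] at h4 h6 ⊢
  rw [Nat.add_sub_cancel_left] at h4
  nlinarith

theorem exists_isPathList_of_clique {G : SimpleGraph V} {S : Finset V}
    (hS : ∀ x ∈ S, ∀ y ∈ S, x ≠ y → G.Adj x y) {a : V} (ha : a ∈ S) :
    ∃ l, IsPathList G (a :: l) ∧ (∀ v ∈ l, v ∈ S) ∧ #S - 1 ≤ l.length := by
  classical
  refine ⟨(S.erase a).toList, ⟨?_, ?_⟩, ?_, ?_⟩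
  · have hnd : (a :: (S.erase a).toList).Nodup := by simp [nodup_toList]
    refine List.Pairwise.isChain (List.Pairwise.imp_of_mem ?_ hnd)
    intro u v hu hv huv
    have hm : ∀ w ∈ a :: (S.erase a).toList, w ∈ S := by
      intro w hw
      rw [List.mem_cons, mem_toList] at hw
      rcases hw with rfl | hw
      · exact ha
      · exact mem_of_mem_erase hw
    exact hS u (hm u hu) v (hm v hv) huv
  · simp [nodup_toList]
  · intro v hv
    exact mem_of_mem_erase (mem_toList.1 hv)
  · rw [length_toList, card_erase_of_mem ha]

/-- A clique on `K - 1` vertices, together with a connection to any vertex outside, already gives a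
path on `K` vertices. -/
theorem card_le_of_clique [Fintype V] {G : SimpleGraph V} {K : ℕ} (hG : G.Connected)
    (hK : ¬ HasPath G K) (hcard : K ≤ Fintype.card V) {S : Finset V}
    (hS : ∀ x ∈ S, ∀ y ∈ S, x ≠ y → G.Adj x y) (hne : S.Nonempty) : #S + 2 ≤ K := by
  classical
  by_contra hlt
  have hpos : 0 < #S := hne.card_pos
  by_cases hSK : K ≤ #S
  · obtain ⟨a, ha⟩ := hne
    obtain ⟨l, hl, -, hlen⟩ := exists_isPathList_of_clique hS ha
    exact hK ⟨a :: l, hl, by simp; omega⟩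
  · obtain ⟨v, hv⟩ : ∃ v, v ∉ S := by
      by_contra hall
      push Not at hall
      have : #S = Fintype.card V := by rw [eq_univ_iff_forall.2 hall, card_univ]
      omega
    refine hK ((hasPath_of_connected hG (X := (S : Set V)) (Y := {v}) hne ⟨v, rfl⟩ (by simpa)
      (d := #S - 1) (e := 0) ?_ ?_).mono (by omega))
    · intro a ha
      obtain ⟨l, hl, h1, h2⟩ := exists_isPathList_of_clique hS (mem_coe.1 ha)
      exact ⟨l, hl, h1, h2⟩
    · intro a _
      exact ⟨[], ⟨by simp, by simp⟩, by simp, by simp⟩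

open Classical in
theorem card_filter_adj_of_clique {G : SimpleGraph V} {S : Finset V}
    (hS : ∀ x ∈ S, ∀ y ∈ S, x ≠ y → G.Adj x y) {x : V} (hx : x ∈ S) :
    #(S.filter (G.Adj x)) = #S - 1 := by
  rw [← card_erase_of_mem hx]
  congr 1
  ext y
  rw [mem_filter, mem_erase]
  exact ⟨fun h => ⟨h.2.ne', h.1⟩, fun h => ⟨h.2, hS x hx y h.2 h.1.symm⟩⟩

/-- Kopylov's structure theorem: the core of a saturated connected graph is a clique, which is
stable under a further disintegration. -/
theorem core_of_saturated [Fintype V] {G : SimpleGraph V} {K : ℕ} (hG : G.Connected)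
    (hK : ¬ HasPath G K) (hsat : Saturated G K) (hK2 : 2 ≤ K) (hcard : K ≤ Fintype.card V)
    {S : Finset V} (hS : IsMaxCore G (K / 2 - 1) S) (hne : S.Nonempty) :
    (∀ x ∈ S, ∀ y ∈ S, x ≠ y → G.Adj x y) ∧ K / 2 + 1 ≤ #S ∧ #S + 2 ≤ K ∧
      IsMaxCore G (K - 1 - #S) S := by
  classical
  have hcl : ∀ x ∈ S, ∀ y ∈ S, x ≠ y → G.Adj x y := by
    intro x hx y hy hxy
    refine adj_of_large_degrees hG hK hsat (S := S) (T := S) (a := K / 2) (b := K / 2) ?_ ?_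
      (by omega) hx hy hxy
    · intro z hz
      have := hS.1 z hz
      omega
    · intro z hz
      have := hS.1 z hz
      omega
  have hlow : K / 2 + 1 ≤ #S := by
    obtain ⟨x, hx⟩ := hne
    have h1 := hS.1 x hx
    have h2 := card_filter_adj_lt G hx
    omega
  have hup := card_le_of_clique hG hK hcard hcl hne
  refine ⟨hcl, hlow, hup, ?_⟩
  -- The threshold is chosen so that a degree of at least `K - #S` in `T` and the degree `#S - 1` in
  -- the clique `S` add up to `K - 1`. A vertex of `T` outside `S` would then be adjacent to all of
  -- `S` and enlarge the original core.
  obtain ⟨T, hT⟩ := exists_isMaxCore G (K - 1 - #S)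
  have hST : S ⊆ T := by
    refine hT.2 S fun x hx => ?_
    rw [card_filter_adj_of_clique hcl hx]
    omega
  have hTS : T ⊆ S := by
    intro x hxT
    by_contra hxS
    have hall : ∀ y ∈ S, G.Adj x y := by
      intro y hy
      refine adj_of_large_degrees hG hK hsat (S := S) (T := T) (a := K - #S) (b := #S - 1) ?_ ?_
        (by omega) hxT hy (by rintro rfl; exact hxS hy)
      · intro z hz
        have := hT.1 z hz
        omega
      · intro z hz
        rw [card_filter_adj_of_clique hcl hz]
    have hcl' : ∀ u ∈ insert x S, ∀ v ∈ insert x S, u ≠ v → G.Adj u v := by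
      intro u hu v hv huv
      rw [mem_insert] at hu hv
      rcases hu with rfl | hu <;> rcases hv with rfl | hv
      · exact absurd rfl huv
      · exact hall v hv
      · exact (hall u hu).symm
      · exact hcl u hu v hv huv
    refine hxS (hS.2 (insert x S) (fun z hz => ?_) (mem_insert_self x S))
    rw [card_filter_adj_of_clique hcl' hz, card_insert_of_notMem hxS]
    omega
  rwa [← Subset.antisymm hST hTS] at hT

theorem adjPairs_mono {G H : SimpleGraph V} (hGH : G ≤ H) (T : Finset V) :
    adjPairs G T ≤ adjPairs H T := by
  classical
  refine sum_le_sum fun x _ => card_le_card fun y hy => ?_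
  rw [mem_filter] at hy ⊢
  exact ⟨hy.1, hGH hy.2⟩

theorem adjPairs_add_card_of_clique {G : SimpleGraph V} {S : Finset V}
    (hS : ∀ x ∈ S, ∀ y ∈ S, x ≠ y → G.Adj x y) : adjPairs G S + #S = #S * #S := by
  classical
  unfold adjPairs
  rw [sum_congr rfl fun x hx => card_filter_adj_of_clique hS hx]
  simp only [sum_const, smul_eq_mul]
  cases h : #S with
  | zero => rfl
  | succ a => simp; ring

/-- Kopylov's bound for the number of edges of a connected graph without a path on `K`
vertices. -/
theorem kopylov_bound [Fintype V] {G : SimpleGraph V} {K : ℕ} (hG : G.Connected)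
    (hK : ¬ HasPath G K) (hK2 : 2 ≤ K) (hcard : K ≤ Fintype.card V) :
    adjPairs G univ ≤ 2 * joinEdges (K / 2 - 1) (Fintype.card V) ∨
      ∃ r, K / 2 + 1 ≤ r ∧ r + 2 ≤ K ∧
        adjPairs G univ + r ≤ r * r + 2 * (K - 1 - r) * (Fintype.card V - r) := by
  obtain ⟨G', hle, hK', hsat⟩ := exists_saturated hK
  have hG' := hG.mono hle
  have hmono := adjPairs_mono hle univ
  obtain ⟨S, hS⟩ := exists_isMaxCore G' (K / 2 - 1)
  rcases S.eq_empty_or_nonempty with rfl | hne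
  · left
    refine hmono.trans ((adjPairs_le_of_isMaxCore_empty hS ?_).trans ?_)
    · rw [card_univ]; omega
    · rw [card_univ]
  · right
    obtain ⟨h1, h2, h3, h4⟩ := core_of_saturated hG' hK' hsat hK2 hcard hS hne
    refine ⟨#S, h2, h3, ?_⟩
    have h5 := h4.adjPairs_le (subset_univ S)
    have h6 := adjPairs_add_card_of_clique h1
    rw [card_univ] at h5
    omega

/-! ### Arithmetic of the bounds -/

/-- The number of edges of `t · K_{k-1} ∪ K_r`, where `N = (k - 1) t + r` and `r < k - 1`. -/
def pathEdges (k N : ℕ) : ℕ := N / (k - 1) * (k - 1).choose 2 + (N % (k - 1)).choose 2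

theorem two_mul_pathEdges (k N : ℕ) :
    2 * pathEdges k N + N % (k - 1) * (k - 1) + N =
      N * (k - 1) + N % (k - 1) * (N % (k - 1)) := by
  have h1 := two_mul_choose_two (k - 1)
  have h2 := two_mul_choose_two (N % (k - 1))
  have h3 := Nat.div_add_mod N (k - 1)
  unfold pathEdges
  generalize N / (k - 1) = t at *
  generalize N % (k - 1) = r at *
  subst h3
  nlinarith

theorem pathEdges_of_le {k N : ℕ} (hN : N ≤ k - 1) : pathEdges k N = N.choose 2 := by
  rcases hN.lt_or_eq with h | h
  · simp [pathEdges, Nat.div_eq_of_lt h, Nat.mod_eq_of_lt h]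
  · subst h
    rcases Nat.eq_zero_or_pos (k - 1) with h0 | h0
    · simp [pathEdges, h0]
    · simp [pathEdges, Nat.div_self h0]

theorem two_mul_pathEdges_le {k : ℕ} (hk : 2 ≤ k) (N : ℕ) : 2 * pathEdges k N + N ≤ N * (k - 1) := by
  have h1 := two_mul_pathEdges k N
  have h2 : N % (k - 1) < k - 1 := Nat.mod_lt _ (by omega)
  have h3 := Nat.mul_le_mul_left (N % (k - 1)) h2.le
  omega

/-- With `r` the residue, `r * (q - r)` measures the deficit of `pathEdges` against its linear upper
bound. The deficit is strictly subadditive unless one residue vanishes; when `r + s` wraps around,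
the claim is checked in the complementary variables `q - r` and `q - s`. -/
theorem mod_mul_lt_of_ne_zero {q a b : ℕ} (hq : 0 < q) (ha : a % q ≠ 0) (hb : b % q ≠ 0) :
    (a + b) % q * q + a % q * (a % q) + b % q * (b % q) <
      (a + b) % q * ((a + b) % q) + a % q * q + b % q * q := by
  have h1 : a % q < q := Nat.mod_lt _ hq
  have h2 : b % q < q := Nat.mod_lt _ hq
  rw [Nat.add_mod]
  generalize a % q = r at *
  generalize b % q = s at *
  have hr : 0 < r := Nat.pos_of_ne_zero ha
  have hs : 0 < s := Nat.pos_of_ne_zero hb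
  rcases lt_or_ge (r + s) q with h | h
  · rw [Nat.mod_eq_of_lt h]
    nlinarith
  · have : (r + s) % q = r + s - q := by
      rw [Nat.mod_eq_sub_mod h, Nat.mod_eq_of_lt (by omega)]
    rw [this]
    obtain ⟨u, hu⟩ := Nat.exists_eq_add_of_le h
    rw [hu, Nat.add_sub_cancel_left]
    obtain ⟨α, hα⟩ := Nat.exists_eq_add_of_lt h1
    obtain ⟨β, hβ⟩ := Nat.exists_eq_add_of_lt h2
    have e1 : r = u + β + 1 := by omega
    have e2 : s = u + α + 1 := by omega
    have e3 : q = u + α + β + 2 := by omega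
    subst e1 e2
    rw [e3]
    nlinarith

theorem pathEdges_add_lt {k a b : ℕ} (hk : 2 ≤ k) (ha : a % (k - 1) ≠ 0) (hb : b % (k - 1) ≠ 0) :
    pathEdges k a + pathEdges k b < pathEdges k (a + b) := by
  have h1 := two_mul_pathEdges k a
  have h2 := two_mul_pathEdges k b
  have h3 := two_mul_pathEdges k (a + b)
  have h4 := mod_mul_lt_of_ne_zero (q := k - 1) (by omega) ha hb
  have h5 : (a + b) * (k - 1) = a * (k - 1) + b * (k - 1) := by ring
  omega

theorem pathEdges_add_of_mod_eq_zero {k a b : ℕ} (ha : a % (k - 1) = 0) :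
    pathEdges k (a + b) = pathEdges k a + pathEdges k b := by
  have h1 := two_mul_pathEdges k a
  have h2 := two_mul_pathEdges k b
  have h3 := two_mul_pathEdges k (a + b)
  have h4 : (a + b) % (k - 1) = b % (k - 1) := by
    rw [Nat.add_mod, ha, Nat.zero_add, Nat.mod_mod]
  have h5 : (a + b) * (k - 1) = a * (k - 1) + b * (k - 1) := by ring
  rw [h4] at h3
  rw [ha] at h1
  omega

theorem pathEdges_add_le {k : ℕ} (hk : 2 ≤ k) (a b : ℕ) :
    pathEdges k a + pathEdges k b ≤ pathEdges k (a + b) := by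
  by_cases ha : a % (k - 1) = 0
  · exact (pathEdges_add_of_mod_eq_zero ha).ge
  · by_cases hb : b % (k - 1) = 0
    · rw [add_comm a, pathEdges_add_of_mod_eq_zero hb, add_comm]
    · exact (pathEdges_add_lt hk ha hb).le

theorem pathEdges_succ_lt {k : ℕ} (hk : 2 ≤ k) (N : ℕ) :
    pathEdges k (N + 1) < pathEdges k N + (k - 1) := by
  have h1 := two_mul_pathEdges k N
  have h2 := two_mul_pathEdges k (N + 1)
  have h3 : N % (k - 1) < k - 1 := Nat.mod_lt _ (by omega)
  rw [← Nat.mod_add_mod] at h2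
  rcases Nat.lt_or_ge (N % (k - 1) + 1) (k - 1) with h | h
  · rw [Nat.mod_eq_of_lt h] at h2
    generalize N % (k - 1) = r at *
    generalize k - 1 = q at *
    nlinarith
  · have e : N % (k - 1) + 1 = k - 1 := by omega
    rw [e, Nat.mod_self] at h2
    generalize N % (k - 1) = r at *
    generalize k - 1 = q at *
    subst e
    nlinarith

theorem le_pathEdges_add_one {k : ℕ} (hk : 4 ≤ k) (N : ℕ) : N ≤ pathEdges k N + 1 := by
  have h1 := two_mul_pathEdges k N
  have h3 : N % (k - 1) < k - 1 := Nat.mod_lt _ (by omega)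
  have h4 : N % (k - 1) ≤ N := Nat.mod_le _ _
  have h5 : 3 ≤ k - 1 := by omega
  generalize N % (k - 1) = r at *
  generalize k - 1 = q at *
  obtain ⟨s, rfl⟩ := Nat.exists_eq_add_of_le h4
  have h6 : 2 * pathEdges k (r + s) + r + s = s * q + r * r := by nlinarith
  have h7 : 3 * r ≤ r * r + 2 := by
    rcases r with _ | _ | r
    · norm_num
    · norm_num
    · nlinarith
  nlinarith

/-- `cliqueBound` in a form without case distinction. -/
theorem cliqueBound_eq (k v c : ℕ) : cliqueBound v (c + k) k =
    (min v (c + k - 1)).choose 2 + pathEdges k (v - min v (c + k - 1)) := by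
  unfold cliqueBound
  split_ifs with h
  · rw [min_eq_left h, Nat.sub_self]
    simp [pathEdges]
  · rw [min_eq_right (by omega)]
    simp [pathEdges, add_assoc]

theorem cliqueBound_zero (k v : ℕ) : cliqueBound v (0 + k) k = pathEdges k v := by
  rw [cliqueBound_eq, Nat.zero_add]
  rcases le_total v (k - 1) with h | h
  · rw [min_eq_left h, pathEdges_of_le h, Nat.sub_self]
    simp [pathEdges]
  · rw [min_eq_right h, ← pathEdges_of_le le_rfl, ← pathEdges_add_of_mod_eq_zero (by simp)]
    congr 1
    omega

/-- Vertices are moved one by one from the path part to the clique: a clique on `b ≥ k - 1` vertices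
gains `b` edges, while `pathEdges` drops by less than `k - 1`. -/
theorem choose_add_pathEdges_le {k : ℕ} (hk : 2 ≤ k) {b c : ℕ} (hb : k - 1 ≤ b)
    (hbc : b ≤ c + k - 1) (w : ℕ) :
    b.choose 2 + pathEdges k w ≤ cliqueBound (b + w) (c + k) k ∧
      (0 < w → b < c + k - 1 →
        b.choose 2 + pathEdges k w < cliqueBound (b + w) (c + k) k) := by
  induction w generalizing b with
  | zero =>
    refine ⟨?_, fun h => absurd h (lt_irrefl 0)⟩
    rw [cliqueBound_eq, Nat.add_zero, min_eq_left hbc, Nat.sub_self]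
  | succ w ih =>
    rcases hbc.lt_or_eq with h | h
    · have h1 := (ih (b := b + 1) (by omega) h).1
      have h2 : (b + 1).choose 2 = b + b.choose 2 := by
        rw [Nat.choose_succ_succ' b 1, Nat.choose_one_right]
      have h3 := pathEdges_succ_lt hk w
      have h4 : b + 1 + w = b + (w + 1) := by ring
      rw [h4] at h1
      constructor
      · omega
      · intros; omega
    · refine ⟨?_, fun _ h' => absurd h' (by omega)⟩
      rw [cliqueBound_eq, min_eq_right (by omega), ← h, Nat.add_sub_cancel_left]

theorem cliqueBound_add_pathEdges_le {k c v : ℕ} (hk : 2 ≤ k) (hc : k ≤ c) (hv : c ≤ v) (w : ℕ) :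
    cliqueBound v (c + k) k + pathEdges k w ≤ cliqueBound (v + w) (c + k) k ∧
      (0 < w → v < c + k - 1 →
        cliqueBound v (c + k) k + pathEdges k w < cliqueBound (v + w) (c + k) k) := by
  rw [cliqueBound_eq k v]
  rcases le_total v (c + k - 1) with h | h
  · rw [min_eq_left h, Nat.sub_self]
    have := choose_add_pathEdges_le hk (b := v) (c := c) (by omega) h w
    simpa [pathEdges] using this
  · rw [min_eq_right h]
    refine ⟨?_, fun _ h' => absurd h' (by omega)⟩
    have h1 := (choose_add_pathEdges_le hk (b := c + k - 1) (c := c) (by omega) le_rfl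
      (v - (c + k - 1) + w)).1
    have h2 := pathEdges_add_le hk (v - (c + k - 1)) w
    have h3 : c + k - 1 + (v - (c + k - 1) + w) = v + w := by omega
    rw [h3] at h1
    omega

/-- The two cliques on `b₁` and `b₂` vertices are redistributed into one as large as allowed and a
remainder `y ≤ k - 1`. Since `y < b₁` and `y < b₂`, convexity of the binomial coefficient makes this
a strict gain, and the remainder goes into the path part. -/
theorem cliqueBound_add_lt {k c₁ c₂ v₁ v₂ : ℕ} (hk : 2 ≤ k) (hc₁ : k ≤ c₁) (hc₂ : k ≤ c₂)
    (hv₁ : c₁ ≤ v₁) (hv₂ : c₂ ≤ v₂) :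
    cliqueBound v₁ (c₁ + k) k + cliqueBound v₂ (c₂ + k) k <
      cliqueBound (v₁ + v₂) (c₁ + c₂ + k) k := by
  rw [cliqueBound_eq, cliqueBound_eq, cliqueBound_eq]
  obtain ⟨b₁, hb₁⟩ : ∃ b, b = min v₁ (c₁ + k - 1) := ⟨_, rfl⟩
  obtain ⟨b₂, hb₂⟩ : ∃ b, b = min v₂ (c₂ + k - 1) := ⟨_, rfl⟩
  obtain ⟨B, hB⟩ : ∃ b, b = min (v₁ + v₂) (c₁ + c₂ + k - 1) := ⟨_, rfl⟩
  rw [← hb₁, ← hb₂, ← hB]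
  obtain ⟨y, hy⟩ : ∃ y, b₁ + b₂ = B + y := Nat.exists_eq_add_of_le (by omega)
  have hyk : y ≤ k - 1 := by omega
  have e : v₁ + v₂ - B = y + ((v₁ - b₁) + (v₂ - b₂)) := by omega
  have h1 := pathEdges_add_le hk (v₁ - b₁) (v₂ - b₂)
  have h2 := pathEdges_add_le hk y ((v₁ - b₁) + (v₂ - b₂))
  rw [← e, pathEdges_of_le hyk] at h2
  have h3 : b₁.choose 2 + b₂.choose 2 < B.choose 2 + y.choose 2 := by
    have f1 := two_mul_choose_two b₁
    have f2 := two_mul_choose_two b₂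
    have f3 := two_mul_choose_two B
    have f4 := two_mul_choose_two y
    obtain ⟨α, hα⟩ : ∃ α, b₁ = y + 1 + α := Nat.exists_eq_add_of_le (by omega)
    obtain ⟨β, hβ⟩ : ∃ β, b₂ = y + 1 + β := Nat.exists_eq_add_of_le (by omega)
    have hB' : B = y + α + β + 2 := by omega
    rw [hα] at f1 ⊢
    rw [hβ] at f2 ⊢
    rw [hB'] at f3 ⊢
    linarith [Nat.zero_le (α * β)]
  omega

theorem joinEdges_add {h v w : ℕ} (hv : h ≤ v) : joinEdges h (v + w) = joinEdges h v + h * w := by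
  unfold joinEdges
  rw [Nat.sub_add_comm hv]
  ring

/-- A new vertex adds `h = (c + k) / 2 - 1 ≥ k - 1` edges to the join, but on average at most `(k -
2) / 2` to the path part. The spare `1` pays for the extra edge of odd connected components. -/
theorem joinEdges_add_pathEdges_lt {k c v w : ℕ} (hk : 3 ≤ k) (hc : k ≤ c) (hv : c + k ≤ v)
    (hw : 0 < w) : joinEdges ((c + k) / 2 - 1) v + pathEdges k w + 1 ≤
      joinEdges ((c + k) / 2 - 1) (v + w) := by
  rw [joinEdges_add (by omega)]
  have h1 := two_mul_pathEdges_le (by omega : 2 ≤ k) w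
  obtain ⟨q, hq⟩ : ∃ q, k = q + 1 := ⟨k - 1, by omega⟩
  have h2 : 2 * q ≤ 2 * ((c + k) / 2 - 1) + 1 := by omega
  have h3 : q ≤ (c + k) / 2 - 1 := by omega
  have h4 : k - 1 = q := by omega
  rw [h4] at h1
  have h5 : q * w ≤ ((c + k) / 2 - 1) * w := Nat.mul_le_mul_right _ h3
  have h6 : 2 * w ≤ q * w := Nat.mul_le_mul_right _ (by omega)
  nlinarith

theorem cliqueBound_add_joinEdges_lt {k c₁ c₂ v₁ v₂ : ℕ} (hk : 3 ≤ k) (hc₁ : k ≤ c₁) (hc₂ : k ≤ c₂)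
    (hv₁ : c₁ ≤ v₁) (hv₂ : c₂ + k ≤ v₂) :
    cliqueBound v₁ (c₁ + k) k + (joinEdges ((c₂ + k) / 2 - 1) v₂ + 1) <
      max (cliqueBound (v₁ + v₂) (c₁ + c₂ + k) k)
        (joinEdges ((c₁ + c₂ + k) / 2 - 1) (v₁ + v₂)) := by
  rw [cliqueBound_eq k v₁]
  obtain ⟨a, ha⟩ : ∃ b, b = min v₁ (c₁ + k - 1) := ⟨_, rfl⟩
  rw [← ha]
  obtain ⟨w, hw⟩ : ∃ w, v₁ = a + w := Nat.exists_eq_add_of_le (by omega)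
  obtain ⟨h, hh⟩ : ∃ h, h = (c₂ + k) / 2 - 1 := ⟨_, rfl⟩
  have hle : joinEdges h v₂ + pathEdges k w ≤ joinEdges h (v₂ + w) := by
    rcases Nat.eq_zero_or_pos w with rfl | hpos
    · simp [pathEdges]
    · have := joinEdges_add_pathEdges_lt hk hc₂ hv₂ hpos
      rw [← hh] at this
      omega
  rw [← hh]
  have e1 : v₁ - a = w := by omega
  rw [e1]
  obtain ⟨v, hv⟩ : ∃ v, v = v₂ + w := ⟨_, rfl⟩
  have e2 : v₁ + v₂ = a + v := by omega
  rw [← hv] at hle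
  rw [e2]
  suffices hmain : a.choose 2 + joinEdges h v + 1 <
      max (cliqueBound (a + v) (c₁ + c₂ + k) k) (joinEdges ((c₁ + c₂ + k) / 2 - 1) (a + v)) by
    omega
  have f1 := two_mul_choose_two a
  have f2 := two_mul_joinEdges (h := h) (n := v) (by omega)
  -- If the join is no larger than the clique, enlarging the clique by `c₂` vertices beats it;
  -- otherwise it is better to enlarge the dominating set of the join.
  rcases le_or_gt v a with hva | hva
  · refine lt_max_of_lt_left ?_
    have g1 := (choose_add_pathEdges_le (by omega : 2 ≤ k) (b := a + c₂) (c := c₁ + c₂) (by omega)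
      (by omega) (v - c₂)).1
    have e3 : a + c₂ + (v - c₂) = a + v := by omega
    rw [e3] at g1
    have f3 := two_mul_choose_two (a + c₂)
    have g2 : h * v ≤ h * a := Nat.mul_le_mul_left _ hva
    have g3 : (h + 1) * a ≤ c₂ * a := Nat.mul_le_mul_right _ (by omega)
    have g4 : c₂ ≤ c₂ * c₂ := Nat.le_mul_self _
    nlinarith
  · refine lt_max_of_lt_right ?_
    obtain ⟨d, hd⟩ : ∃ d, (c₁ + c₂ + k) / 2 - 1 = h + d := Nat.exists_eq_add_of_le (by omega)
    rw [hd]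
    have f3 := two_mul_joinEdges (h := h + d) (n := a + v) (by omega)
    have p1 : a * (a + c₂) ≤ a * (2 * h + 2 * d + 2) := Nat.mul_le_mul_left _ (by omega)
    have p2 : d * (2 * h + 2 + 2 * d) ≤ d * (2 * v) := Nat.mul_le_mul_left _ (by omega)
    have p3 : a * 3 ≤ a * c₂ := Nat.mul_le_mul_left _ (by omega)
    have p4 : 3 ≤ a := by omega
    linarith [Nat.zero_le (d * d)]

theorem joinEdges_add_joinEdges_lt {k c₁ c₂ v₁ v₂ : ℕ} (hk : 3 ≤ k) (hc₁ : k ≤ c₁) (hc₂ : k ≤ c₂)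
    (hv₁ : c₁ + k ≤ v₁) (hv₂ : c₂ + k ≤ v₂) :
    joinEdges ((c₁ + k) / 2 - 1) v₁ + 1 + (joinEdges ((c₂ + k) / 2 - 1) v₂ + 1) <
      joinEdges ((c₁ + c₂ + k) / 2 - 1) (v₁ + v₂) := by
  wlog hle : (c₂ + k) / 2 - 1 ≤ (c₁ + k) / 2 - 1 generalizing c₁ c₂ v₁ v₂
  · have := this hc₂ hc₁ hv₂ hv₁ (by omega)
    rw [add_comm c₁ c₂, add_comm v₁ v₂]
    omega
  obtain ⟨h₁, hh₁⟩ : ∃ h, h = (c₁ + k) / 2 - 1 := ⟨_, rfl⟩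
  obtain ⟨h₂, hh₂⟩ : ∃ h, h = (c₂ + k) / 2 - 1 := ⟨_, rfl⟩
  obtain ⟨d, hd⟩ : ∃ d, (c₁ + c₂ + k) / 2 - 1 = h₁ + d := Nat.exists_eq_add_of_le (by omega)
  rw [← hh₁, ← hh₂, hd]
  rw [← hh₁, ← hh₂] at hle
  have f1 := two_mul_joinEdges (h := h₁) (n := v₁) (by omega)
  have f2 := two_mul_joinEdges (h := h₂) (n := v₂) (by omega)
  have f3 := two_mul_joinEdges (h := h₁ + d) (n := v₁ + v₂) (by omega)
  have p1 : h₂ * v₂ ≤ h₁ * v₂ := Nat.mul_le_mul_right _ hle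
  have p2 : d * (2 * h₁ + d + 1 + 6) ≤ d * (2 * v₁ + 2 * v₂) := Nat.mul_le_mul_left _ (by omega)
  have p3 : 1 ≤ d := by omega
  nlinarith

/-- Up to terms linear in `v`, this compares `r * (k - 1 - r)` with its maximum at `r ≈ (k - 1) /
2`. For odd `k` the linear terms differ in favour of `pathEdges`, which pays for the extra edge. -/
theorem joinEdges_add_le_pathEdges {k v : ℕ} (hk : 3 ≤ k) (hv : k ≤ v) :
    joinEdges (k / 2 - 1) v + k % 2 ≤ pathEdges k v := by
  have h1 := two_mul_pathEdges k v
  have h2 := two_mul_joinEdges (h := k / 2 - 1) (n := v) (by omega)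
  have h3 : v % (k - 1) < k - 1 := Nat.mod_lt _ (by omega)
  obtain ⟨h, hh⟩ : ∃ h, h = k / 2 - 1 := ⟨_, rfl⟩
  rw [← hh] at h2 ⊢
  generalize v % (k - 1) = r at *
  rcases Nat.mod_two_eq_zero_or_one k with hp | hp
  · have e : k - 1 = 2 * h + 1 := by omega
    rw [e] at h1 h3
    rw [hp]
    have h4 : (2 * h + 1) * r ≤ r * r + h * h + h := by
      rcases le_or_gt r h with hr | hr
      · obtain ⟨s, rfl⟩ := Nat.exists_eq_add_of_le hr
        nlinarith
      · obtain ⟨s, rfl⟩ := Nat.exists_eq_add_of_lt hr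
        nlinarith
    nlinarith
  · have e : k - 1 = 2 * h + 2 := by omega
    rw [e] at h1 h3
    rw [hp]
    have h4 : (2 * h + 2) * r ≤ r * r + (h + 1) * (h + 1) := by
      rcases le_or_gt r (h + 1) with hr | hr
      · obtain ⟨s, hs⟩ := Nat.exists_eq_add_of_le hr
        rw [show 2 * h + 2 = (h + 1) + (h + 1) by ring, hs]
        nlinarith
      · obtain ⟨s, rfl⟩ := Nat.exists_eq_add_of_lt hr
        nlinarith
    have h5 : 2 * h + 3 ≤ v := by omega
    nlinarith

/-- Equality forces `r * (k - 1 - r)` to be maximal, which for the odd number `k - 1` happens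
exactly at its two middle values. -/
theorem mod_eq_of_joinEdges_eq {k v : ℕ} (hk : 3 ≤ k) (hp : k % 2 = 0) (hv : k ≤ v)
    (heq : joinEdges (k / 2 - 1) v = pathEdges k v) :
    v % (k - 1) = k / 2 ∨ v % (k - 1) = (k - 2) / 2 := by
  have h1 := two_mul_pathEdges k v
  have h2 := two_mul_joinEdges (h := k / 2 - 1) (n := v) (by omega)
  obtain ⟨h, hh⟩ : ∃ h, h = k / 2 - 1 := ⟨_, rfl⟩
  rw [← hh] at h2 heq
  generalize v % (k - 1) = r at *
  have e : k - 1 = 2 * h + 1 := by omega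
  rw [e] at h1
  have h4 : r * r + h * h + h = (2 * h + 1) * r := by nlinarith
  by_contra hcon
  rcases lt_or_ge r h with hr | hr
  · obtain ⟨s, rfl⟩ := Nat.exists_eq_add_of_lt hr
    nlinarith
  · have hr' : h + 1 < r := by omega
    obtain ⟨s, rfl⟩ := Nat.exists_eq_add_of_lt hr'
    nlinarith

/-- The bound for a graph on `v` vertices that is the union of components, where the component
`D` has no path on `c_D + k` vertices and `c` is the sum of all `c_D`. -/
def mainBound (k v c : ℕ) : ℕ :=
  max (cliqueBound v (c + k) k) (if v < c + k then 0 else joinEdges ((c + k) / 2 - 1) v)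

/-- The bound for a connected graph on `v` vertices without a path on `c + k` vertices. -/
def componentBound (k v c : ℕ) : ℕ :=
  max (cliqueBound v (c + k) k)
    (if v < c + k then 0 else joinEdges ((c + k) / 2 - 1) v + (c + k) % 2)

theorem mainBound_le_componentBound (k v c : ℕ) : mainBound k v c ≤ componentBound k v c := by
  unfold mainBound componentBound
  split_ifs <;> omega

theorem componentBound_zero {k : ℕ} (hk : 3 ≤ k) (v : ℕ) :
    componentBound k v 0 = pathEdges k v := by
  unfold componentBound
  rw [cliqueBound_zero, Nat.zero_add]
  refine max_eq_left ?_
  split_ifs with h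
  · exact Nat.zero_le _
  · exact joinEdges_add_le_pathEdges hk (by omega)

theorem mainBound_zero {k : ℕ} (hk : 3 ≤ k) (v : ℕ) : mainBound k v 0 = pathEdges k v := by
  refine le_antisymm ?_ ?_
  · rw [← componentBound_zero hk]
    exact mainBound_le_componentBound k v 0
  · rw [← cliqueBound_zero]
    exact le_max_left _ _

theorem componentBound_add_pathEdges_le {k v w c : ℕ} (hk : 3 ≤ k) (hc : k ≤ c) (hv : c ≤ v)
    (hw : 0 < w) : componentBound k v c + pathEdges k w ≤ mainBound k (v + w) c := by
  unfold componentBound mainBound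
  have h1 := (cliqueBound_add_pathEdges_le (by omega : 2 ≤ k) hc hv w).1
  split_ifs with h h' h'
  · omega
  · have : cliqueBound v (c + k) k + pathEdges k w ≤ cliqueBound (v + w) (c + k) k := h1
    omega
  · omega
  · have h2 := joinEdges_add_pathEdges_lt hk hc (by omega : c + k ≤ v) hw
    omega

theorem componentBound_add_lt {k v₁ v₂ c₁ c₂ : ℕ} (hk : 3 ≤ k) (hc₁ : k ≤ c₁) (hc₂ : k ≤ c₂)
    (hv₁ : c₁ ≤ v₁) (hv₂ : c₂ ≤ v₂) :
    componentBound k v₁ c₁ + componentBound k v₂ c₂ < mainBound k (v₁ + v₂) (c₁ + c₂) := by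
  have h1 := cliqueBound_add_lt (by omega : 2 ≤ k) hc₁ hc₂ hv₁ hv₂
  unfold componentBound mainBound
  rcases lt_or_ge v₁ (c₁ + k) with a1 | a1
  · rcases lt_or_ge v₂ (c₂ + k) with a2 | a2
    · rw [if_pos a1, if_pos a2]
      omega
    · have h2 := cliqueBound_add_joinEdges_lt hk hc₁ hc₂ hv₁ a2
      rw [if_pos a1, if_neg (by omega), if_neg (by omega)]
      omega
  · have h3 := cliqueBound_add_joinEdges_lt hk hc₂ hc₁ hv₂ a1
    rw [add_comm c₂ c₁, add_comm v₂ v₁] at h3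
    rcases lt_or_ge v₂ (c₂ + k) with a2 | a2
    · rw [if_neg (by omega), if_pos a2, if_neg (by omega)]
      omega
    · have h2 := cliqueBound_add_joinEdges_lt hk hc₁ hc₂ hv₁ a2
      have h4 := joinEdges_add_joinEdges_lt hk hc₁ hc₂ a1 a2
      rw [if_neg (by omega), if_neg (by omega), if_neg (by omega)]
      omega

theorem componentBound_add_le {k v₁ v₂ c₁ c₂ : ℕ} (hk : 3 ≤ k) (hc₁ : c₁ = 0 ∨ k ≤ c₁)
    (hc₂ : c₂ = 0 ∨ k ≤ c₂) (hv₁ : c₁ ≤ v₁) (hv₂ : c₂ ≤ v₂) (h₁ : 0 < v₁) (h₂ : 0 < v₂) :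
    componentBound k v₁ c₁ + componentBound k v₂ c₂ ≤ mainBound k (v₁ + v₂) (c₁ + c₂) := by
  rcases hc₁ with rfl | hc₁
  · rw [componentBound_zero hk, Nat.zero_add]
    rcases hc₂ with rfl | hc₂
    · rw [componentBound_zero hk, mainBound_zero hk]
      exact pathEdges_add_le (by omega) _ _
    · rw [add_comm, add_comm v₁]
      exact componentBound_add_pathEdges_le hk hc₂ hv₂ h₁
  · rcases hc₂ with rfl | hc₂
    · rw [componentBound_zero hk, Nat.add_zero]
      exact componentBound_add_pathEdges_le hk hc₁ hv₁ h₂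
    · exact (componentBound_add_lt hk hc₁ hc₂ hv₁ hv₂).le

/-- Convexity in `r` of the edge bound coming from a core of size `r`. -/
theorem kopylov_convex {K h r v e : ℕ} (hr : h + 2 ≤ r) (hrK : r + 2 ≤ K) (hv : K ≤ v)
    (he : 2 * e + r ≤ r * r + 2 * (K - 1 - r) * (v - r)) :
    2 * e + (K - 2) ≤ (K - 2) * (K - 2) + 2 * (v - (K - 2)) ∨
      2 * e + (h + 2) + 2 * (r - (h + 2)) ≤
        (h + 2) * (h + 2) + 2 * (K - 1 - (h + 2)) * (v - (h + 2)) := by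
  obtain ⟨α, rfl⟩ := Nat.exists_eq_add_of_le hr
  obtain ⟨β, rfl⟩ := Nat.exists_eq_add_of_le hrK
  obtain ⟨γ, rfl⟩ := Nat.exists_eq_add_of_le hv
  have e1 : h + 2 + α + 2 + β - 1 - (h + 2 + α) = β + 1 := by omega
  have e2 : h + 2 + α + 2 + β + γ - (h + 2 + α) = β + 2 + γ := by omega
  have e3 : h + 2 + α + 2 + β - 2 = h + 2 + α + β := by omega
  have e4 : h + 2 + α + 2 + β + γ - (h + 2 + α + β) = γ + 2 := by omega
  have e5 : h + 2 + α - (h + 2) = α := by omega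
  have e6 : h + 2 + α + 2 + β - 1 - (h + 2) = α + β + 1 := by omega
  have e7 : h + 2 + α + 2 + β + γ - (h + 2) = α + β + γ + 2 := by omega
  rw [e1, e2] at he
  rw [e3, e4, e5, e6, e7]
  -- The bound is a convex quadratic in the core size. The case distinction says towards which end
  -- of the range `h + 2, …, K - 2` it increases.
  rcases le_or_gt (β + 2 * γ + 7) (2 * (h + 2 + α)) with hc | hc
  · left
    linarith [Nat.mul_le_mul_left β hc]
  · right
    have hc' : 2 * (h + 2 + α) ≤ β + 2 * γ + 6 := Nat.le_of_lt_succ hc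
    linarith [Nat.mul_le_mul_left α hc', Nat.zero_le (α * β), Nat.le_mul_self α]

/-- The extreme core size `K - 2`, with `K = c + k`, corresponds to a clique with pendant edges.
Enlarging the clique by one vertex gains `K - 2 ≥ 3` edges, while the path part, having nearly as
many edges as vertices for `k ≥ 4`, loses too little to compensate. -/
theorem pendant_clique_lt {k c v e : ℕ} (hk : 4 ≤ k) (hK : 5 ≤ c + k) (hv : c + k ≤ v)
    (he : 2 * e + (c + k - 2) ≤ (c + k - 2) * (c + k - 2) + 2 * (v - (c + k - 2))) :
    e < cliqueBound v (c + k) k := by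
  rw [cliqueBound_eq, min_eq_right (by omega)]
  obtain ⟨N, rfl⟩ := Nat.exists_eq_add_of_le hv
  obtain ⟨K, hK'⟩ : ∃ K, c + k = K + 2 := ⟨c + k - 2, by omega⟩
  rw [hK'] at he ⊢
  have e1 : K + 2 + N - (K + 2 - 1) = N + 1 := by omega
  have e2 : K + 2 + N - (K + 2 - 2) = N + 2 := by omega
  have e3 : K + 2 - 2 = K := by omega
  have e4 : K + 2 - 1 = K + 1 := by omega
  rw [e2, e3] at he
  rw [e1, e4]
  have h1 := le_pathEdges_add_one hk (N + 1)
  have h2 := two_mul_choose_two (K + 1)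
  nlinarith

/-- For `k = 3` the path part is only a matching, so the clique bound alone does not suffice: it
wins when there are few vertices outside the clique, and the join wins when there are many. -/
theorem pendant_clique_le_of_three {c v e : ℕ} (hc : 3 ≤ c) (hv : c + 3 ≤ v)
    (he : 2 * e + (c + 3 - 2) ≤ (c + 3 - 2) * (c + 3 - 2) + 2 * (v - (c + 3 - 2))) :
    e ≤ mainBound 3 v c := by
  unfold mainBound
  rw [cliqueBound_eq, min_eq_right (by omega), if_neg (by omega)]
  obtain ⟨N, rfl⟩ := Nat.exists_eq_add_of_le hv
  have e1 : c + 3 + N - (c + 3 - 1) = N + 1 := by omega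
  have e2 : c + 3 + N - (c + 3 - 2) = N + 2 := by omega
  have e3 : c + 3 - 2 = c + 1 := by omega
  have e4 : c + 3 - 1 = c + 2 := by omega
  rw [e2, e3] at he
  rw [e1, e4]
  have h1 := two_mul_pathEdges 3 (N + 1)
  have h2 := two_mul_choose_two (c + 2)
  have h3 : (N + 1) % (3 - 1) < 2 := Nat.mod_lt _ (by norm_num)
  norm_num at h1 h3
  have h4 : N ≤ 2 * pathEdges 3 (N + 1) := by
    generalize (N + 1) % 2 = r at *
    interval_cases r <;> omega
  rcases le_or_gt N (2 * c - 2) with hN | hN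
  · refine le_max_of_le_left ?_
    have hN' : N + 2 ≤ 2 * c := by omega
    linarith
  · refine le_max_of_le_right ?_
    obtain ⟨h, hh⟩ : ∃ h, h = (c + 3) / 2 - 1 := ⟨_, rfl⟩
    rw [← hh]
    have h5 := two_mul_joinEdges (h := h) (n := c + 3 + N) (by omega)
    rcases Nat.mod_two_eq_zero_or_one (c + 3) with hp | hp
    · obtain ⟨g, rfl⟩ : ∃ g, h = g + 2 := ⟨h - 2, by omega⟩
      have hc' : c = 2 * g + 3 := by omega
      obtain ⟨M, rfl⟩ : ∃ M, N = 2 * c - 1 + M := ⟨N - (2 * c - 1), by omega⟩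
      have e5 : 2 * c - 1 = 4 * g + 5 := by omega
      rw [e5] at he h5 ⊢
      subst hc'
      linarith [Nat.zero_le (g * g), Nat.zero_le (g * M)]
    · obtain ⟨g, rfl⟩ : ∃ g, h = g + 2 := ⟨h - 2, by omega⟩
      have hc' : c = 2 * g + 4 := by omega
      obtain ⟨M, rfl⟩ : ∃ M, N = 2 * c - 1 + M := ⟨N - (2 * c - 1), by omega⟩
      have e5 : 2 * c - 1 = 4 * g + 7 := by omega
      rw [e5] at he h5 ⊢
      subst hc'
      linarith [Nat.zero_le (g * g), Nat.zero_le (g * M)]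

/-- Apart from the pendant clique, the other extreme is the smallest core, on `(c + k) / 2 + 1`
vertices. For even `c + k` it stays below the join; for odd `c + k` it exceeds the join by at most
one edge, and the slack linear in `r` shows that only this smallest core can do so. -/
theorem kopylov_numeric {k c v r e : ℕ} (hk : 3 ≤ k) (hc : c = 0 ∨ k ≤ c) (hv : c + k ≤ v)
    (hr : (c + k) / 2 + 1 ≤ r) (hrK : r + 2 ≤ c + k)
    (he : 2 * e + r ≤ r * r + 2 * (c + k - 1 - r) * (v - r)) :
    e ≤ componentBound k v c ∧ (4 ≤ k → (c + k) % 2 = 0 → e < mainBound k v c) ∧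
      (mainBound k v c < e → r = (c + k) / 2 + 1) := by
  obtain ⟨h, hh⟩ : ∃ h, h = (c + k) / 2 - 1 := ⟨_, rfl⟩
  have hmc := mainBound_le_componentBound k v c
  rcases kopylov_convex (h := h) (by omega) hrK hv he with h1 | h1
  · rcases Nat.lt_or_ge 3 k with hk4 | hk3
    · have h2 := pendant_clique_lt (by omega) (by omega) hv h1
      have h3 : e < mainBound k v c := h2.trans_le (le_max_left _ _)
      exact ⟨by omega, fun _ _ => h3, fun h => by omega⟩
    · obtain rfl : k = 3 := by omega
      have h2 := pendant_clique_le_of_three (by omega) hv h1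
      exact ⟨by omega, fun h => by omega, fun h => by omega⟩
  · have h2 : joinEdges h v ≤ mainBound k v c := by
      unfold mainBound
      rw [if_neg (by omega), ← hh]
      exact le_max_right _ _
    have h3 : joinEdges h v + (c + k) % 2 ≤ componentBound k v c := by
      unfold componentBound
      rw [if_neg (by omega), ← hh]
      exact le_max_right _ _
    have h4 := two_mul_joinEdges (h := h) (n := v) (by omega)
    obtain ⟨N, hN⟩ : ∃ N, v = h + 2 + N := Nat.exists_eq_add_of_le (by omega)
    have e2 : v - (h + 2) = N := by omega
    rw [e2] at h1
    rcases Nat.mod_two_eq_zero_or_one (c + k) with hp | hp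
    · obtain ⟨g, rfl⟩ : ∃ g, h = g + 1 := ⟨h - 1, by omega⟩
      have e1 : c + k - 1 - (g + 1 + 2) = g := by omega
      rw [e1] at h1
      have hN' : g + 1 ≤ N := by omega
      have hg : 1 ≤ g := by omega
      have hr' := Nat.zero_le (r - (g + 1 + 2))
      have : e < joinEdges (g + 1) v := by
        subst hN
        linarith
      exact ⟨by omega, fun _ _ => by omega, fun h => by omega⟩
    · have e1 : c + k - 1 - (h + 2) = h := by omega
      rw [e1] at h1
      have : e + (r - (h + 2)) ≤ joinEdges h v + 1 := by
        subst hN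
        linarith
      exact ⟨by omega, fun _ h => by omega, fun h => by omega⟩

/-! ### Structure of connected graphs attaining the bounds -/

theorem hasPath_of_complete [Fintype V] {G : SimpleGraph V} (h : ∀ x y, x ≠ y → G.Adj x y) :
    HasPath G (Fintype.card V) := by
  rcases isEmpty_or_nonempty V with h0 | ⟨⟨a⟩⟩
  · exact ⟨[], ⟨by simp, by simp⟩, by simp⟩
  · obtain ⟨l, hl, -, hlen⟩ := exists_isPathList_of_clique (G := G) (S := univ)
      (fun x _ y _ => h x y) (mem_univ a)
    refine ⟨a :: l, hl, ?_⟩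
    rw [card_univ] at hlen
    simp
    omega

theorem eq_of_adjPairs_le [Fintype V] {G H : SimpleGraph V} (hGH : G ≤ H)
    (h : adjPairs H univ ≤ adjPairs G univ) : G = H := by
  classical
  have h1 : ∀ x ∈ (univ : Finset V), #(univ.filter (G.Adj x)) ≤ #(univ.filter (H.Adj x)) :=
    fun x _ => card_le_card (monotone_filter_right _ fun y _ hy => hGH hy)
  have h2 := (sum_eq_sum_iff_of_le h1).1 (le_antisymm (sum_le_sum h1) h)
  refine le_antisymm hGH fun x y hxy => ?_
  have h3 : univ.filter (G.Adj x) = univ.filter (H.Adj x) :=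
    eq_of_subset_of_card_le (monotone_filter_right _ fun y _ hy => hGH hy) (h2 x (mem_univ x)).ge
  have : y ∈ univ.filter (G.Adj x) := by rw [h3]; simpa using hxy
  simpa using this

-- If the graph were disconnected, the degree condition would split the vertices into two parts of
-- at least `h + 1` vertices each, of which at most one has a further vertex. Two such cliques have
-- too few edges.
open Classical in
theorem connected_of_degree_le [Fintype V] {G : SimpleGraph V} {h p : ℕ} (hh : 1 ≤ h)
    (hp : p ≤ 1) (hcard : Fintype.card V = 2 * h + 2 + p)
    (hdeg : ∀ x, h ≤ #(univ.filter (G.Adj x)))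
    (he : 2 * joinEdges h (2 * h + 2 + p) + 2 * p ≤ adjPairs G univ) : G.Connected := by
  have hne : Nonempty V := Fintype.card_pos_iff.1 (by omega)
  refine SimpleGraph.Connected.mk fun u v => ?_
  by_contra huv
  set X := univ.filter fun w => G.Reachable u w with hX
  have hsub : ∀ x ∈ X, univ.filter (G.Adj x) ⊆ X.erase x := by
    intro x hx y hy
    have hy' := (mem_filter.1 hy).2
    refine mem_erase.2 ⟨hy'.ne', mem_filter.2 ⟨mem_univ _, ?_⟩⟩
    exact (mem_filter.1 hx).2.trans hy'.reachable
  have hsub' : ∀ x ∈ Xᶜ, univ.filter (G.Adj x) ⊆ Xᶜ.erase x := by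
    intro x hx y hy
    have hy' := (mem_filter.1 hy).2
    refine mem_erase.2 ⟨hy'.ne', ?_⟩
    rw [mem_compl, mem_filter] at hx ⊢
    exact fun h' => hx ⟨mem_univ _, h'.2.trans hy'.symm.reachable⟩
  have hu : u ∈ X := mem_filter.2 ⟨mem_univ _, SimpleGraph.Reachable.refl u⟩
  have hv : v ∈ Xᶜ := by
    rw [mem_compl, mem_filter]
    exact fun h' => huv h'.2
  have hd1 : ∀ x ∈ X, #(univ.filter (G.Adj x)) ≤ #X - 1 := fun x hx => by
    rw [← card_erase_of_mem hx]
    exact card_le_card (hsub x hx)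
  have hd2 : ∀ x ∈ Xᶜ, #(univ.filter (G.Adj x)) ≤ #Xᶜ - 1 := fun x hx => by
    rw [← card_erase_of_mem hx]
    exact card_le_card (hsub' x hx)
  have hc := card_add_card_compl X
  have hx1 : 0 < #X := card_pos.2 ⟨u, hu⟩
  have hx2 : 0 < #Xᶜ := card_pos.2 ⟨v, hv⟩
  have hxu := (hdeg u).trans (hd1 u hu)
  have hxv := (hdeg v).trans (hd2 v hv)
  have hsum : adjPairs G univ ≤ #X * (#X - 1) + #Xᶜ * (#Xᶜ - 1) := by
    unfold adjPairs
    rw [← sum_add_sum_compl X]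
    refine Nat.add_le_add ?_ ?_
    · simpa using sum_le_card_nsmul X _ _ hd1
    · simpa using sum_le_card_nsmul Xᶜ _ _ hd2
  have hj := two_mul_joinEdges (h := h) (n := 2 * h + 2 + p) (by omega)
  rw [hcard] at hc
  obtain ⟨α, hα⟩ := Nat.exists_eq_add_of_le hxu
  obtain ⟨β, hβ⟩ := Nat.exists_eq_add_of_le hxv
  have e1 : #X = h + α + 1 := by omega
  have e2 : #Xᶜ = h + β + 1 := by omega
  have e3 : α + β = p := by omega
  rw [e1, e2] at hsum
  simp only [Nat.add_sub_cancel] at hsum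
  interval_cases p
  · obtain ⟨rfl, rfl⟩ : α = 0 ∧ β = 0 := by omega
    nlinarith
  · obtain ⟨rfl, rfl⟩ | ⟨rfl, rfl⟩ : α = 0 ∧ β = 1 ∨ α = 1 ∧ β = 0 := by omega
    · nlinarith
    · nlinarith

open Classical in
theorem degree_add_degree_lt [Fintype V] {G : SimpleGraph V} (hG : G.Connected)
    (hK : ¬ HasPath G (Fintype.card V)) (hsat : Saturated G (Fintype.card V)) {x y : V}
    (hxy : x ≠ y) (hadj : ¬ G.Adj x y) :
    #(univ.filter (G.Adj x)) + #(univ.filter (G.Adj y)) + 1 < Fintype.card V := by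
  obtain ⟨A, B, hA, hB, hnd, hlen⟩ := exists_pair_of_hasPath_sup_edge hK (hsat x y hxy hadj)
  by_contra hcon
  refine hK (hasPath_of_pair hG hA hB hnd hlen ?_)
  have : ((x :: A) ++ (y :: B)).toFinset = univ := by
    refine eq_univ_of_card _ ?_
    refine le_antisymm (card_le_univ _) ?_
    rw [List.toFinset_card_of_nodup hnd]
    simp
    omega
  rw [this]
  omega

-- After saturation, non-adjacent vertices have degree sum at most `2 * h + p`. With minimum degree
-- `h`, this makes every vertex of degree above `h + p` universal and leaves the degrees `h` and,
-- for `p = 1`, `h + 1` for the others. Counting edges determines the class sizes and shows that the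
-- saturated graph has no more edges than `G`.
open Classical in
theorem structure_of_card_eq [Fintype V] {G : SimpleGraph V} {h p : ℕ} (hh : 1 ≤ h) (hp : p ≤ 1)
    (hcard : Fintype.card V = 2 * h + 2 + p) (hK : ¬ HasPath G (2 * h + 2 + p))
    (hdeg : ∀ x, h ≤ #(univ.filter (G.Adj x)))
    (he : 2 * joinEdges h (2 * h + 2 + p) + 2 * p ≤ adjPairs G univ) :
    ∃ C : Finset V, #C = h ∧ (∀ c ∈ C, ∀ v, c ≠ v → G.Adj c v) ∧
      (p = 0 → ∀ u v, u ∉ C → v ∉ C → ¬ G.Adj u v) ∧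
      (p = 1 → ∃ a b, a ∉ C ∧ b ∉ C ∧ G.Adj a b) := by
  have hconn := connected_of_degree_le hh hp hcard hdeg he
  obtain ⟨G', hle, hK', hsat⟩ := exists_saturated hK
  have hconn' := hconn.mono hle
  rw [← hcard] at hK' hsat
  have he' := he.trans (adjPairs_mono hle univ)
  have hdeg' : ∀ x, h ≤ #(univ.filter (G'.Adj x)) := fun x =>
    (hdeg x).trans (card_le_card (monotone_filter_right _ fun y _ hy => hle hy))
  set d : V → ℕ := fun x => #(univ.filter (G'.Adj x)) with hd
  have hnonadj : ∀ x y, x ≠ y → ¬ G'.Adj x y → d x + d y ≤ 2 * h + p := by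
    intro x y hxy hadj
    have := degree_add_degree_lt hconn' hK' hsat hxy hadj
    rw [hcard] at this
    simp only [hd]
    omega
  set C := univ.filter fun x => h + p < d x with hC
  have hCuniv : ∀ c ∈ C, ∀ v, c ≠ v → G'.Adj c v := by
    intro c hc v hcv
    by_contra hadj
    have h1 := hnonadj c v hcv hadj
    have h2 := hdeg' v
    have h3 := (mem_filter.1 hc).2
    simp only [hd] at h1 h3
    omega
  have hdC : ∀ c ∈ C, d c = 2 * h + 1 + p := by
    intro c hc
    have : univ.filter (G'.Adj c) = univ.erase c := by
      ext v
      simp only [mem_filter, mem_univ, true_and, mem_erase, and_true]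
      exact ⟨fun h => h.ne', fun h => hCuniv c hc v h.symm⟩
    simp only [hd]
    rw [this, card_erase_of_mem (mem_univ c), card_univ, hcard]
    omega
  have hnotC : ∀ v, v ∉ C → d v ≤ h + p := by
    intro v hv
    by_contra hlt
    exact hv (mem_filter.2 ⟨mem_univ _, by omega⟩)
  set B := univ.filter fun x => d x = h ∧ x ∉ C with hB
  set D := univ.filter fun x => d x = h + 1 ∧ x ∉ C with hD
  have hcliqueD : ∀ x ∈ D, ∀ v, v ∉ B → x ≠ v → G'.Adj x v := by
    intro x hx v hv hxv
    by_contra hadj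
    have hx' := (mem_filter.1 hx).2
    have hvC : v ∉ C := fun hvC => hadj (hCuniv v hvC x hxv.symm).symm
    have h1 := hnonadj x v hxv hadj
    have h2 : d v ≠ h := fun h' => hv (mem_filter.2 ⟨mem_univ _, h', hvC⟩)
    have h3 : h ≤ d v := hdeg' v
    have h4 := hnotC x hx'.2
    omega
  have hcover : ∀ v, v ∈ B ∨ v ∈ C ∨ (v ∈ D ∧ p = 1) := by
    intro v
    by_cases hvC : v ∈ C
    · exact Or.inr (Or.inl hvC)
    · have h1 := hnotC v hvC
      have h2 : h ≤ d v := hdeg' v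
      by_cases h3 : d v = h
      · exact Or.inl (mem_filter.2 ⟨mem_univ _, h3, hvC⟩)
      · exact Or.inr (Or.inr ⟨mem_filter.2 ⟨mem_univ _, by omega, hvC⟩, by omega⟩)
  have hBne : B.Nonempty := by
    by_contra hempty
    rw [not_nonempty_iff_eq_empty] at hempty
    refine hK' (hasPath_of_complete fun x y hxy => ?_)
    rcases hcover x with hx | hx | hx
    · rw [hempty] at hx
      simp at hx
    · exact hCuniv x hx y hxy
    · exact hcliqueD x hx.1 y (by simp [hempty]) hxy
  have hCle : #C ≤ h := by
    obtain ⟨v, hv⟩ := hBne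
    have hv' := (mem_filter.1 hv).2
    rw [← hv'.1]
    refine card_le_card fun c hc => mem_filter.2 ⟨mem_univ _, ?_⟩
    exact (hCuniv c hc v (fun h => hv'.2 (h ▸ hc))).symm
  have hDC : Disjoint D C := by
    rw [disjoint_left]
    intro x hx
    exact ((mem_filter.1 hx).2).2
  have hBC : Disjoint B C := by
    rw [disjoint_left]
    intro x hx
    exact ((mem_filter.1 hx).2).2
  have hBD : Disjoint B D := by
    rw [disjoint_left]
    intro x hx hx'
    have h1 := ((mem_filter.1 hx).2).1
    have h2 := ((mem_filter.1 hx').2).1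
    omega
  have hDle : D.Nonempty → #D + #C ≤ h + 2 := by
    rintro ⟨v, hv⟩
    have hv' := (mem_filter.1 hv).2
    have h1 : D.erase v ∪ C ⊆ univ.filter (G'.Adj v) := by
      intro w hw
      refine mem_filter.2 ⟨mem_univ _, ?_⟩
      rcases mem_union.1 hw with hw | hw
      · rw [mem_erase] at hw
        exact hcliqueD v hv w (fun hB' => disjoint_left.1 hBD hB' hw.2) hw.1.symm
      · exact (hCuniv w hw v (fun h => hv'.2 (h ▸ hw))).symm
    have h2 := card_le_card h1
    have h3 : #(univ.filter (G'.Adj v)) = h + 1 := hv'.1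
    rw [card_union_of_disjoint (hDC.mono_left (erase_subset _ _)), card_erase_of_mem hv, h3] at h2
    have := card_pos.2 ⟨v, hv⟩
    omega
  have hj := two_mul_joinEdges (h := h) (n := 2 * h + 2 + p) (by omega)
  have hmain : #C = h ∧ (p = 1 → 2 ≤ #D) ∧ adjPairs G' univ = 2 * joinEdges h (2 * h + 2 + p) + 2 * p := by
    rcases Nat.le_one_iff_eq_zero_or_eq_one.1 hp with rfl | rfl
    · have hu : (univ : Finset V) = B ∪ C := by
        ext v
        simp only [mem_univ, mem_union, true_iff]
        rcases hcover v with h | h | h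
        · exact Or.inl h
        · exact Or.inr h
        · omega
      have hs : adjPairs G' univ = #B * h + #C * (2 * h + 1) := by
        change ∑ x, d x = _
        rw [hu, sum_union hBC, sum_congr rfl (fun x hx => ((mem_filter.1 hx).2).1),
          sum_congr rfl (fun x hx => hdC x hx)]
        simp
      have hc : #B + #C = 2 * h + 2 := by
        rw [← card_union_of_disjoint hBC, ← hu, card_univ, hcard]
      have : #C = h := by
        refine le_antisymm hCle ?_
        by_contra hlt
        obtain ⟨δ, hδ⟩ := Nat.exists_eq_add_of_lt (not_le.1 hlt)
        have hb : #B = 2 * h + 2 - #C := by omega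
        have hb' : #B = h + δ + 3 := by omega
        rw [hs, hb'] at he'
        generalize #C = c at *
        subst hδ
        nlinarith
      refine ⟨this, fun h => by omega, ?_⟩
      rw [hs, this, show #B = h + 2 by omega]
      nlinarith
    · have hu : (univ : Finset V) = (B ∪ D) ∪ C := by
        ext v
        simp only [mem_univ, mem_union, true_iff]
        rcases hcover v with h | h | h
        · exact Or.inl (Or.inl h)
        · exact Or.inr h
        · exact Or.inl (Or.inr h.1)
      have hBDC : Disjoint (B ∪ D) C := disjoint_union_left.2 ⟨hBC, hDC⟩
      have hs : adjPairs G' univ = #B * h + #D * (h + 1) + #C * (2 * h + 2) := by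
        change ∑ x, d x = _
        rw [hu, sum_union hBDC, sum_union hBD, sum_congr rfl (fun x hx => ((mem_filter.1 hx).2).1),
          sum_congr (s₁ := D) rfl (fun x hx => ((mem_filter.1 hx).2).1),
          sum_congr (s₁ := C) rfl (fun x hx => hdC x hx)]
        simp
      have hc : #B + #D + #C = 2 * h + 3 := by
        rw [← card_union_of_disjoint hBD, ← card_union_of_disjoint hBDC, ← hu, card_univ, hcard]
      rw [hs] at he' ⊢
      have hDle' : #D + #C ≤ h + 2 := by
        rcases D.eq_empty_or_nonempty with h0 | hne
        · rw [h0, card_empty]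
          omega
        · exact hDle hne
      -- This is the edge count after eliminating `#B`. Together with `#C ≤ h` and `#D + #C ≤ h + 2`
      -- it leaves only `#C = h` and `#D = 2`.
      have hkey : h * (h + 2) + 2 ≤ #C * (h + 2) + #D := by
        have hb : #B * h = (2 * h + 3 - #D - #C) * h := by
          congr 1
          omega
        obtain ⟨b, hb'⟩ : ∃ b, #B = b := ⟨_, rfl⟩
        rw [hb'] at he' hc
        generalize #C = c at *
        generalize #D = e at *
        have : (b + e + c) * h = (2 * h + 3) * h := by rw [hc]
        nlinarith
      have hCh : #C = h := by
        refine le_antisymm hCle ?_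
        by_contra hlt
        obtain ⟨δ, hδ⟩ := Nat.exists_eq_add_of_lt (not_le.1 hlt)
        generalize #C = c at *
        subst hδ
        nlinarith
      have hD2 : #D = 2 := by
        rw [hCh] at hkey hDle'
        omega
      refine ⟨hCh, fun _ => hD2.ge, ?_⟩
      rw [hCh, hD2, show #B = h + 1 by omega]
      nlinarith
  obtain ⟨h1, h2, h3⟩ := hmain
  have hGG : G = G' := eq_of_adjPairs_le hle (by rw [h3]; exact he)
  rw [hGG]
  refine ⟨C, h1, hCuniv, ?_, ?_⟩
  · rintro rfl u v hu hv huv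
    have hub : u ∈ B := by
      rcases hcover u with h | h | h
      · exact h
      · exact absurd h hu
      · omega
    have h4 : C ⊆ univ.filter (G'.Adj u) := fun c hc =>
      mem_filter.2 ⟨mem_univ _, (hCuniv c hc u (fun h => hu (h ▸ hc))).symm⟩
    have h5 := eq_of_subset_of_card_le h4 (by rw [h1]; exact ((mem_filter.1 hub).2).1.le)
    refine hv ?_
    rw [h5]
    simpa using huv
  · intro hp1
    obtain ⟨a, ha, b, hb, hab⟩ := one_lt_card.1 (h2 hp1)
    exact ⟨a, b, ((mem_filter.1 ha).2).2, ((mem_filter.1 hb).2).2,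
      hcliqueD a ha b (fun h => disjoint_left.1 hBD h hb) hab⟩

theorem exists_alternating_path {G : SimpleGraph V} {C I : Finset V}
    (hCI : Disjoint C I) (hadj : ∀ c ∈ C, ∀ i ∈ I, G.Adj c i) (hcard : #C + 1 ≤ #I) {i : V}
    (hi : i ∈ I) : ∃ l, IsPathList G (i :: l) ∧ (∀ v ∈ l, v ∈ C ∨ v ∈ I) ∧
      l.length = 2 * #C := by
  classical
  induction C using Finset.induction_on generalizing I i with
  | empty => exact ⟨[], ⟨by simp, by simp⟩, by simp, by simp⟩
  | insert c C hc ih =>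
    rw [card_insert_of_notMem hc] at hcard
    have hcard' : #(I.erase i) = #I - 1 := card_erase_of_mem hi
    obtain ⟨j, hj⟩ : (I.erase i).Nonempty := card_pos.1 (by omega)
    have hd := disjoint_insert_left.1 hCI
    obtain ⟨l, hl, hsub, hlen⟩ := ih (I := I.erase i) (hd.2.mono_right (erase_subset _ _))
      (fun c' hc' i' hi' => hadj c' (mem_insert_of_mem hc') i' (mem_of_mem_erase hi'))
      (by omega) hj
    have hjI := mem_of_mem_erase hj
    have hmem : ∀ v ∈ j :: l, v ∈ C ∨ v ∈ I.erase i := by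
      intro v hv
      rcases List.mem_cons.1 hv with rfl | hv
      · exact Or.inr hj
      · exact hsub v hv
    refine ⟨c :: j :: l, ⟨?_, ?_⟩, ?_, ?_⟩
    · exact List.isChain_cons_cons.2 ⟨(hadj c (mem_insert_self c C) i hi).symm,
        List.isChain_cons_cons.2 ⟨hadj c (mem_insert_self c C) j hjI, hl.1⟩⟩
    · refine List.nodup_cons.2 ⟨?_, List.nodup_cons.2 ⟨?_, hl.2⟩⟩
      · intro hmi
        rcases List.mem_cons.1 hmi with h | h
        · exact hd.1 (h ▸ hi)
        · rcases hmem i h with h | h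
          · exact disjoint_left.1 hd.2 h hi
          · simp at h
      · intro hmc
        rcases hmem c hmc with h | h
        · exact hc h
        · exact hd.1 (mem_of_mem_erase h)
    · intro v hv
      rcases List.mem_cons.1 hv with rfl | hv
      · exact Or.inl (mem_insert_self _ _)
      · rcases hmem v hv with h | h
        · exact Or.inl (mem_insert_of_mem h)
        · exact Or.inr (mem_of_mem_erase h)
    · simp only [List.length_cons, hlen, card_insert_of_notMem hc]
      ring

open Classical in
theorem card_filter_adj_induce (G : SimpleGraph V) (W : Finset V) (x : W) :
    #(univ.filter ((G.induce (W : Set V)).Adj x)) = #(W.filter (G.Adj x)) := by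
  refine card_bij (fun y _ => (y : V)) ?_ ?_ ?_
  · intro y hy
    exact mem_filter.2 ⟨y.2, (mem_filter.1 hy).2⟩
  · intro y _ z _ h
    exact Subtype.ext h
  · intro y hy
    obtain ⟨hyW, hxy⟩ := mem_filter.1 hy
    exact ⟨⟨y, hyW⟩, mem_filter.2 ⟨mem_univ _, hxy⟩, rfl⟩

theorem adjPairs_induce (G : SimpleGraph V) (W : Finset V) :
    adjPairs (G.induce (W : Set V)) univ = adjPairs G W := by
  classical
  unfold adjPairs
  rw [← sum_coe_sort W]
  exact sum_congr rfl fun x _ => card_filter_adj_induce G W x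

theorem HasPath.of_hom {W : Type*} {G : SimpleGraph V} {H : SimpleGraph W} {K : ℕ}
    (h : HasPath G K) (f : G →g H) (hf : Function.Injective f) : HasPath H K := by
  obtain ⟨l, hl, hlen⟩ := h
  refine ⟨l.map f, ⟨?_, hl.2.map hf⟩, by simpa using hlen⟩
  rw [List.isChain_map]
  exact hl.1.imp fun _ _ hab => f.map_adj hab

theorem HasPath.of_induce {G : SimpleGraph V} {s : Set V} {K : ℕ} (h : HasPath (G.induce s) K) :
    HasPath G K :=
  h.of_hom (SimpleGraph.Embedding.induce s).toHom Subtype.val_injective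

open Classical in
/-- `structure_of_card_eq` inside a set of vertices. -/
theorem structure_of_card_eq_finset {G : SimpleGraph V} {W : Finset V} {h p : ℕ} (hh : 1 ≤ h)
    (hp : p ≤ 1) (hcard : #W = 2 * h + 2 + p) (hK : ¬ HasPath G (2 * h + 2 + p))
    (hdeg : ∀ x ∈ W, h ≤ #(W.filter (G.Adj x)))
    (he : 2 * joinEdges h (2 * h + 2 + p) + 2 * p ≤ adjPairs G W) :
    ∃ C ⊆ W, #C = h ∧ (∀ c ∈ C, ∀ v ∈ W, c ≠ v → G.Adj c v) ∧
      (p = 0 → ∀ u ∈ W, ∀ v ∈ W, u ∉ C → v ∉ C → ¬ G.Adj u v) ∧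
      (p = 1 → ∃ a ∈ W, ∃ b ∈ W, a ∉ C ∧ b ∉ C ∧ G.Adj a b) := by
  have hcard' : Fintype.card (W : Set V) = 2 * h + 2 + p := by
    rw [← hcard]
    exact Fintype.card_coe W
  obtain ⟨C, h1, h2, h3, h4⟩ := structure_of_card_eq (G := G.induce (W : Set V)) hh hp hcard'
    (fun hp' => hK hp'.of_induce)
    (fun x => by
      refine (hdeg x x.2).trans_eq ?_
      rw [← card_filter_adj_induce G W x]
      congr!)
    (by
      refine he.trans_eq ?_
      rw [← adjPairs_induce G W])
  have hmem : ∀ v (hv : v ∈ W), v ∉ C.map (Function.Embedding.subtype _) →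
      (⟨v, hv⟩ : (W : Set V)) ∉ C := fun v hv hvC hC =>
    hvC (mem_map.2 ⟨_, hC, rfl⟩)
  refine ⟨C.map (Function.Embedding.subtype _), ?_, by simpa using h1, ?_, ?_, ?_⟩
  · intro v hv
    obtain ⟨w, -, rfl⟩ := mem_map.1 hv
    exact w.2
  · intro c hc v hv hcv
    obtain ⟨w, hw, rfl⟩ := mem_map.1 hc
    exact h2 w hw ⟨v, hv⟩ (fun h => hcv (congrArg Subtype.val h))
  · intro h0 u hu v hv huC hvC huv
    exact h3 h0 ⟨u, hu⟩ ⟨v, hv⟩ (hmem u hu huC) (hmem v hv hvC) huv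
  · intro h0
    obtain ⟨a, b, ha, hb, hab⟩ := h4 h0
    refine ⟨a, a.2, b, b.2, ?_, ?_, hab⟩
    · intro h
      obtain ⟨w, hw, hwa⟩ := mem_map.1 h
      exact ha (Subtype.ext hwa ▸ hw)
    · intro h
      obtain ⟨w, hw, hwb⟩ := mem_map.1 h
      exact hb (Subtype.ext hwb ▸ hw)

theorem joinEdges_succ {h n : ℕ} (hn : h ≤ n) : joinEdges h (n + 1) = joinEdges h n + h := by
  unfold joinEdges
  rw [Nat.sub_add_comm hn]
  ring

/-- A graph with empty core and as many edges as possible has the structure of a join of a clique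
and an independent set. -/
theorem structure_of_core_empty {G : SimpleGraph V} {h : ℕ} (hh : 1 ≤ h)
    (hS : IsMaxCore G h ∅) (hK : ¬ HasPath G (2 * h + 2)) {T : Finset V} (hT : 2 * h + 2 ≤ #T)
    (he : adjPairs G T = 2 * joinEdges h #T) :
    ∃ C ⊆ T, #C = h ∧ (∀ c ∈ C, ∀ v ∈ T, c ≠ v → G.Adj c v) ∧
      ∀ u ∈ T, ∀ v ∈ T, u ∉ C → v ∉ C → ¬ G.Adj u v := by
  classical
  obtain ⟨n, hn⟩ := Nat.exists_eq_add_of_le hT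
  induction n generalizing T with
  | zero =>
    have hdeg : ∀ x ∈ T, h ≤ #(T.filter (G.Adj x)) := by
      intro x hx
      have h1 := adjPairs_erase G hx
      have hc := card_erase_of_mem hx
      have h2 := adjPairs_le_of_isMaxCore_empty hS (T := T.erase x) (by omega)
      have h3 := joinEdges_succ (h := h) (n := #(T.erase x)) (by omega)
      rw [show #(T.erase x) + 1 = #T by omega] at h3
      omega
    obtain ⟨C, h1, h2, h3, h4, -⟩ := structure_of_card_eq_finset (p := 0) hh (by norm_num)
      (by simpa using hn) hK hdeg (by rw [he, hn]; omega)
    exact ⟨C, h1, h2, h3, h4 rfl⟩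
  | succ n ih =>
    have hnc : ¬ IsCore G h T := by
      intro hc
      have := subset_empty.1 (hS.2 T hc)
      rw [this] at hn
      simp at hn
    unfold IsCore at hnc
    push Not at hnc
    obtain ⟨x, hxT, hx⟩ := hnc
    have h1 := adjPairs_erase G hxT
    have hc := card_erase_of_mem hxT
    have h2 := adjPairs_le_of_isMaxCore_empty hS (T := T.erase x) (by omega)
    have h3 := joinEdges_succ (h := h) (n := #(T.erase x)) (by omega)
    rw [show #(T.erase x) + 1 = #T by omega] at h3
    obtain ⟨C, hCT, hCh, hCu, hCi⟩ := ih (T := T.erase x) (by omega) (by omega) (by omega)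
    have hxC : x ∉ C := fun hxC => by simpa using hCT hxC
    have hNx : ∀ i ∈ T, G.Adj x i → i ∈ C := by
      intro i hi hxi
      by_contra hiC
      have hcardI : #(T.erase x \ C) = #(T.erase x) - h := by
        rw [card_sdiff_of_subset hCT, hCh]
      -- A neighbour of `x` outside `C` would start an alternating path on `2 * h + 1` vertices,
      -- which `x` prolongs to the forbidden length.
      obtain ⟨l, hl, hsub, hlen⟩ := exists_alternating_path (G := G) (C := C) (I := T.erase x \ C)
        disjoint_sdiff (fun c hc j hj => hCu c hc j (mem_sdiff.1 hj).1
          (fun h => (mem_sdiff.1 hj).2 (h ▸ hc))) (by omega) (i := i)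
        (mem_sdiff.2 ⟨mem_erase.2 ⟨hxi.ne', hi⟩, hiC⟩)
      refine hK ⟨x :: i :: l, ⟨List.isChain_cons_cons.2 ⟨hxi, hl.1⟩,
        List.nodup_cons.2 ⟨?_, hl.2⟩⟩, ?_⟩
      · intro hm
        rcases List.mem_cons.1 hm with h | h
        · exact hxi.ne h
        · rcases hsub x h with h | h
          · exact hxC h
          · simp at h
      · simp only [List.length_cons]
        omega
    have hNC : T.filter (G.Adj x) = C := by
      refine eq_of_subset_of_card_le (fun i hi => hNx i (mem_filter.1 hi).1 (mem_filter.1 hi).2) ?_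
      omega
    refine ⟨C, hCT.trans (erase_subset _ _), hCh, ?_, ?_⟩
    · intro c hc v hv hcv
      by_cases hvx : v = x
      · rw [hvx]
        rw [← hNC] at hc
        exact (mem_filter.1 hc).2.symm
      · exact hCu c hc v (mem_erase.2 ⟨hvx, hv⟩) hcv
    · intro u hu v hv huC hvC huv
      by_cases hux : u = x
      · exact hvC (hNx v hv (hux ▸ huv))
      · by_cases hvx : v = x
        · exact huC (hNx u hu (hvx ▸ huv.symm))
        · exact hCi u (mem_erase.2 ⟨hux, hu⟩) v (mem_erase.2 ⟨hvx, hv⟩) huC hvC huv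

/-- A graph without a path on `2 h + 3` vertices whose core is a clique on `h + 2` vertices, and
with as many edges as possible, contains a join of a clique on `h` vertices with the disjoint
union of an edge and `h + 1` isolated vertices. -/
theorem exists_join_edge [Fintype V] {G : SimpleGraph V} {h : ℕ} (hh : 1 ≤ h) {S : Finset V}
    (hS : IsMaxCore G h S) (hSc : #S = h + 2)
    (hcl : ∀ x ∈ S, ∀ y ∈ S, x ≠ y → G.Adj x y) (hK : ¬ HasPath G (2 * h + 3))
    (hV : 2 * h + 3 ≤ Fintype.card V)
    (he : 2 * joinEdges h (Fintype.card V) + 2 ≤ adjPairs G univ) :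
    ∃ (C I : Finset V) (a b : V), #C = h ∧ h + 1 ≤ #I ∧ Disjoint C I ∧ a ∉ C ∧ b ∉ C ∧ a ∉ I ∧
      b ∉ I ∧ G.Adj a b ∧ ∀ c ∈ C, G.Adj c a ∧ G.Adj c b ∧ ∀ i ∈ I, G.Adj c i := by
  classical
  obtain ⟨W, hSW, -, hWc, hW⟩ := hS.exists_card_eq (subset_univ S) (q := 2 * h + 3) (by omega)
    (by rwa [card_univ])
  rw [card_univ] at hW
  have hclS := adjPairs_add_card_of_clique hcl
  rw [hSc] at hclS
  obtain ⟨N, hN⟩ := Nat.exists_eq_add_of_le hV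
  have e1 := two_mul_joinEdges (h := h) (n := Fintype.card V) (by omega)
  have e2 := two_mul_joinEdges (h := h) (n := 2 * h + 2 + 1) (by omega)
  rw [hN] at hW he e1
  rw [Nat.add_sub_cancel_left] at hW
  -- Each deleted vertex takes away at most `h` edges, exactly what the join loses, so the surplus
  -- of one edge survives in `W`.
  have hWe : 2 * joinEdges h (2 * h + 2 + 1) + 2 * 1 ≤ adjPairs G W := by nlinarith
  have hdeg : ∀ x ∈ W, h ≤ #(W.filter (G.Adj x)) := by
    intro x hx
    by_cases hxS : x ∈ S
    · exact (hS.1 x hxS).le.trans (card_le_card (filter_subset_filter _ hSW))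
    · have h1 := adjPairs_erase G hx
      -- The largest possible edge number of `W` without `x` falls short of the one of `W` by at
      -- least `h`.
      have h2 := hS.adjPairs_le (T := W.erase x) (subset_erase.2 ⟨hSW, hxS⟩)
      rw [card_erase_of_mem hx, hWc, hSc, show 2 * h + 3 - 1 - (h + 2) = h by omega] at h2
      nlinarith
  obtain ⟨C, hCW, hCh, hCu, -, hab⟩ := structure_of_card_eq_finset (p := 1) hh le_rfl hWc hK
    hdeg hWe
  obtain ⟨a, ha, b, hb, haC, hbC, hadj⟩ := hab rfl
  have hcne : ∀ c ∈ C, ∀ v, v ∉ C → c ≠ v := fun c hc v hv h => hv (h ▸ hc)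
  refine ⟨C, ((W \ C).erase a).erase b, a, b, hCh, ?_, ?_, haC, hbC, by simp, by simp, hadj, ?_⟩
  · rw [card_erase_of_mem (mem_erase.2 ⟨hadj.ne', mem_sdiff.2 ⟨hb, hbC⟩⟩),
      card_erase_of_mem (mem_sdiff.2 ⟨ha, haC⟩), card_sdiff_of_subset hCW, hCh, hWc]
    omega
  · exact disjoint_sdiff.mono_right ((erase_subset _ _).trans (erase_subset _ _))
  · intro c hc
    refine ⟨hCu c hc a ha (hcne c hc a haC), hCu c hc b hb (hcne c hc b hbC), fun i hi => ?_⟩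
    have hi' := mem_sdiff.1 (mem_of_mem_erase (mem_of_mem_erase hi))
    exact hCu c hc i hi'.1 (hcne c hc i hi'.2)

/-! ### Edge numbers of connected graphs -/

theorem two_mul_card_edgeSet [Fintype V] (G : SimpleGraph V) :
    2 * Nat.card G.edgeSet = adjPairs G univ := by
  classical
  rw [Nat.card_eq_fintype_card, ← SimpleGraph.edgeFinset_card,
    ← SimpleGraph.sum_degrees_eq_twice_card_edges]
  refine sum_congr rfl fun x _ => ?_
  rw [← SimpleGraph.card_neighborFinset_eq_degree, SimpleGraph.neighborFinset_eq_filter]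

/-- `G` is the join of a clique on `h` vertices and an independent set. -/
def IsCliqueJoin (G : SimpleGraph V) (h : ℕ) : Prop :=
  ∃ C : Finset V, #C = h ∧ (∀ c ∈ C, ∀ v, c ≠ v → G.Adj c v) ∧
    ∀ u v, u ∉ C → v ∉ C → ¬ G.Adj u v

theorem card_edgeSet_le_choose [Fintype V] (G : SimpleGraph V) :
    Nat.card G.edgeSet ≤ (Fintype.card V).choose 2 := by
  have h1 := adjPairs_le G univ
  have h2 := two_mul_choose_two (Fintype.card V)
  rw [← two_mul_card_edgeSet, card_univ] at h1
  omega

theorem cliqueBound_of_lt {k v c : ℕ} (h : v < c + k) : cliqueBound v (c + k) k = v.choose 2 := by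
  rw [cliqueBound_eq, min_eq_left (by omega), Nat.sub_self]
  simp [pathEdges]

theorem joinEdges_le_mainBound {k v c : ℕ} (h : c + k ≤ v) :
    joinEdges ((c + k) / 2 - 1) v ≤ mainBound k v c := by
  unfold mainBound
  rw [if_neg (by omega)]
  exact le_max_right _ _

/-- The number of edges of a connected graph without a path on `c + k` vertices. -/
theorem card_edgeSet_le_componentBound [Fintype V] {G : SimpleGraph V} {k c : ℕ} (hk : 3 ≤ k)
    (hc : c = 0 ∨ k ≤ c) (hG : G.Connected) (hK : ¬ HasPath G (c + k)) :
    Nat.card G.edgeSet ≤ componentBound k (Fintype.card V) c := by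
  rcases lt_or_ge (Fintype.card V) (c + k) with hlt | hge
  · refine (card_edgeSet_le_choose G).trans ?_
    rw [← cliqueBound_of_lt hlt]
    exact le_max_left _ _
  · rcases kopylov_bound hG hK (by omega) hge with h | ⟨r, h1, h2, h3⟩
    · rw [← two_mul_card_edgeSet] at h
      exact (Nat.le_of_mul_le_mul_left h two_pos).trans
        ((joinEdges_le_mainBound hge).trans (mainBound_le_componentBound _ _ _))
    · rw [← two_mul_card_edgeSet] at h3
      exact (kopylov_numeric hk hc hge h1 h2 h3).1

theorem card_edgeSet_dichotomy [Fintype V] {G : SimpleGraph V} {k c : ℕ} (hk : 4 ≤ k)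
    (hc : c = 0 ∨ k ≤ c) (hp : (c + k) % 2 = 0) (hG : G.Connected) (hK : ¬ HasPath G (c + k))
    (hV : c + k ≤ Fintype.card V) :
    Nat.card G.edgeSet < cliqueBound (Fintype.card V) (c + k) k ∨
      Nat.card G.edgeSet ≤ joinEdges ((c + k) / 2 - 1) (Fintype.card V) := by
  rcases kopylov_bound hG hK (by omega) hV with h | ⟨r, h1, h2, h3⟩
  · rw [← two_mul_card_edgeSet] at h
    exact Or.inr (Nat.le_of_mul_le_mul_left h two_pos)
  · rw [← two_mul_card_edgeSet] at h3
    have h4 := (kopylov_numeric (by omega) hc hV h1 h2 h3).2.1 hk hp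
    unfold mainBound at h4
    rw [if_neg (by omega)] at h4
    rcases lt_max_iff.1 h4 with h | h
    · exact Or.inl h
    · exact Or.inr h.le

/-- A nonempty core in the saturation gives strictly fewer edges than `mainBound` when `k ≥ 4` and
`c + k` is even. So the core is empty, the saturation adds no edge, and the structure theorem for
empty cores applies. -/
theorem isCliqueJoin_of_card_edgeSet_eq [Fintype V] {G : SimpleGraph V} {k c : ℕ} (hk : 4 ≤ k)
    (hc : c = 0 ∨ k ≤ c) (hp : (c + k) % 2 = 0) (hG : G.Connected) (hK : ¬ HasPath G (c + k))
    (hV : c + k ≤ Fintype.card V) (he : mainBound k (Fintype.card V) c ≤ Nat.card G.edgeSet) :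
    IsCliqueJoin G ((c + k) / 2 - 1) := by
  obtain ⟨G', hle, hK', hsat⟩ := exists_saturated hK
  have hG' := hG.mono hle
  have hmono := adjPairs_mono hle univ
  rw [← two_mul_card_edgeSet, ← two_mul_card_edgeSet] at hmono
  obtain ⟨S, hS⟩ := exists_isMaxCore G' ((c + k) / 2 - 1)
  rcases S.eq_empty_or_nonempty with rfl | hne
  · have h1 := adjPairs_le_of_isMaxCore_empty hS (T := univ) (by rw [card_univ]; omega)
    have h2 := joinEdges_le_mainBound hV
    rw [card_univ] at h1
    have h3 := two_mul_card_edgeSet G'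
    have h4 := two_mul_card_edgeSet G
    obtain rfl : G = G' := eq_of_adjPairs_le hle (by omega)
    obtain ⟨C, -, h5, h6, h7⟩ := structure_of_core_empty (T := univ) (by omega) hS
      (by rwa [show 2 * ((c + k) / 2 - 1) + 2 = c + k by omega]) (by rw [card_univ]; omega)
      (by rw [card_univ]; omega)
    exact ⟨C, h5, fun c hc v => h6 c hc v (mem_univ _),
      fun u v => h7 u (mem_univ _) v (mem_univ _)⟩
  · obtain ⟨h1, h2, h3, h4⟩ := core_of_saturated hG' hK' hsat (by omega) hV hS hne
    have h5 := h4.adjPairs_le (subset_univ S)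
    have h6 := adjPairs_add_card_of_clique h1
    rw [card_univ, ← two_mul_card_edgeSet] at h5
    have h7 := (kopylov_numeric (e := Nat.card G'.edgeSet) (by omega) hc hV h2 h3 (by omega)).2.1
      hk hp
    omega

/-- Exceeding `mainBound` rules out an empty core and forces the smallest possible clique as core.
Then the saturation has at most one edge more than the join, so it coincides with `G`. -/
theorem exists_join_edge_of_lt_card_edgeSet [Fintype V] {G : SimpleGraph V} {k c h : ℕ}
    (hk : 3 ≤ k) (hc : c = 0 ∨ k ≤ c) (hh : 1 ≤ h) (hp : c + k = 2 * h + 3) (hG : G.Connected)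
    (hK : ¬ HasPath G (c + k)) (hV : c + k ≤ Fintype.card V)
    (he : mainBound k (Fintype.card V) c < Nat.card G.edgeSet) :
    ∃ (C I : Finset V) (a b : V), #C = h ∧ h + 1 ≤ #I ∧ Disjoint C I ∧ a ∉ C ∧ b ∉ C ∧ a ∉ I ∧
      b ∉ I ∧ G.Adj a b ∧ ∀ c ∈ C, G.Adj c a ∧ G.Adj c b ∧ ∀ i ∈ I, G.Adj c i := by
  obtain ⟨G', hle, hK', hsat⟩ := exists_saturated hK
  have hG' := hG.mono hle
  have hmono := adjPairs_mono hle univ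
  rw [← two_mul_card_edgeSet, ← two_mul_card_edgeSet] at hmono
  have hdiv : (c + k) / 2 - 1 = h := by omega
  obtain ⟨S, hS⟩ := exists_isMaxCore G' ((c + k) / 2 - 1)
  have hj := joinEdges_le_mainBound hV
  rw [hdiv] at hj
  rcases S.eq_empty_or_nonempty with rfl | hne
  · have h1 := adjPairs_le_of_isMaxCore_empty hS (T := univ) (by rw [card_univ]; omega)
    rw [card_univ, hdiv] at h1
    have h3 := two_mul_card_edgeSet G'
    omega
  · obtain ⟨h1, h2, h3, h4⟩ := core_of_saturated hG' hK' hsat (by omega) hV hS hne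
    have h5 := h4.adjPairs_le (subset_univ S)
    have h6 := adjPairs_add_card_of_clique h1
    rw [card_univ, ← two_mul_card_edgeSet] at h5
    have h7 := (kopylov_numeric (e := Nat.card G'.edgeSet) hk hc hV h2 h3 (by omega)).2.2
      (by omega)
    have hSc : #S = h + 2 := by omega
    have h8 : Nat.card G'.edgeSet ≤ joinEdges h (Fintype.card V) + 1 := by
      have h9 := two_mul_joinEdges (h := h) (n := Fintype.card V) (by omega)
      obtain ⟨N, hN⟩ : ∃ N, Fintype.card V = h + 2 + N := Nat.exists_eq_add_of_le (by omega)
      rw [hSc, hN, show c + k - 1 - (h + 2) = h by omega, Nat.add_sub_cancel_left] at h5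
      rw [hSc] at h6
      rw [hN] at h9 ⊢
      linarith
    have h10 := two_mul_card_edgeSet G'
    have h11 := two_mul_card_edgeSet G
    obtain rfl : G = G' := eq_of_adjPairs_le hle (by omega)
    rw [hdiv] at hS
    exact exists_join_edge hh hS hSc h1 (by rwa [← hp]) (by omega) (by omega)

/-! ### Packing the linear forest into components -/

theorem linearForest_adj {m : ℕ} {k : Fin m → ℕ} {x y : Σ i : Fin m, Fin (k i)}
    (h : (linearForest k).Adj x y) :
    ∃ (i : Fin m) (a b : Fin (k i)), (a.val + 1 = b.val ∨ b.val + 1 = a.val) ∧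
      x = ⟨i, a⟩ ∧ y = ⟨i, b⟩ := by
  obtain ⟨i, a, b, hab, hx, hy⟩ := h
  exact ⟨i, a, b, SimpleGraph.pathGraph_adj.1 hab, hx, hy⟩

/-- A packing of the paths into disjoint longer paths yields a copy of the linear forest. -/
theorem linearForest_isContained_of_packing {m : ℕ} {k : Fin m → ℕ} {G : SimpleGraph V}
    {ι : Type*} [DecidableEq ι] (f : Fin m → ι) (p : ι → List V)
    (hp : ∀ D, IsPathList G (p D)) (hdisj : ∀ D E v, v ∈ p D → v ∈ p E → D = E)
    (hlen : ∀ D, ∑ i with f i = D, k i ≤ (p D).length) : (linearForest k).IsContained G := by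
  -- The paths assigned to the same long path are laid out one after the other in the order of their
  -- indices; `off i` is where the `i`-th one starts.
  set off : Fin m → ℕ := fun i => ∑ j with j < i ∧ f j = f i, k j with hoff
  have hoff_lt : ∀ i j, i < j → f i = f j → off i + k i ≤ off j := by
    intro i j hij hf
    have : k i = ∑ l ∈ ({i} : Finset (Fin m)), k l := by simp
    simp only [hoff]
    rw [this, ← sum_union]
    · refine sum_le_sum_of_subset fun l hl => ?_
      simp only [mem_union, mem_filter, mem_univ, true_and, mem_singleton] at hl ⊢
      rcases hl with hl | rfl
      · exact ⟨hl.1.trans hij, hl.2.trans hf⟩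
      · exact ⟨hij, hf⟩
    · simp
  have hoff_le : ∀ i, off i + k i ≤ (p (f i)).length := by
    intro i
    refine le_trans ?_ (hlen (f i))
    have : k i = ∑ l ∈ ({i} : Finset (Fin m)), k l := by simp
    simp only [hoff]
    rw [this, ← sum_union]
    · refine sum_le_sum_of_subset fun l hl => ?_
      simp only [mem_union, mem_filter, mem_univ, true_and, mem_singleton] at hl ⊢
      rcases hl with hl | rfl
      · exact hl.2
      · rfl
    · simp
  have hidx : ∀ i (a : Fin (k i)), off i + a.val < (p (f i)).length := fun i a =>
    lt_of_lt_of_le (Nat.add_lt_add_left a.2 _) (hoff_le i)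
  set φ : (Σ i : Fin m, Fin (k i)) → V := fun x => (p (f x.1))[off x.1 + x.2.val]'(hidx x.1 x.2)
    with hφ
  refine ⟨⟨⟨φ, ?_⟩, ?_⟩⟩
  · intro x y hxy
    obtain ⟨i, a, b, hab, rfl, rfl⟩ := linearForest_adj hxy
    have hch := List.isChain_iff_getElem.1 (hp (f i)).1
    simp only [hφ]
    rcases hab with h | h
    · have := hch (off i + a.val) (by have := hidx i b; omega)
      simpa only [Nat.add_assoc, h] using this
    · have := (hch (off i + b.val) (by have := hidx i a; omega)).symm
      simpa only [Nat.add_assoc, h] using this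
  · rintro ⟨i, a⟩ ⟨j, b⟩ hab
    change φ ⟨i, a⟩ = φ ⟨j, b⟩ at hab
    simp only [hφ] at hab
    have hfij : f i = f j := by
      refine hdisj (f i) (f j) _ (List.getElem_mem (hidx i a)) ?_
      rw [hab]
      exact List.getElem_mem _
    have hpos : off i + a.val = off j + b.val := by
      have h1 : (p (f i))[off i + a.val]'(hidx i a) =
          (p (f i))[off j + b.val]'(by rw [hfij]; exact hidx j b) := by
        rw [hab]
        congr 1
        rw [hfij]
      exact (List.Nodup.getElem_inj_iff (hp (f i)).2).1 h1
    rcases lt_trichotomy i j with h | h | h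
    · have := hoff_lt i j h hfij
      have := a.2
      omega
    · subst h
      have : a = b := Fin.ext (by omega)
      rw [this]
    · have := hoff_lt j i h hfij.symm
      have := b.2
      omega

theorem exists_pathList_of_component {G : SimpleGraph V} {D : G.ConnectedComponent} {K : ℕ}
    (h : HasPath D.toSimpleGraph K) :
    ∃ l, IsPathList G l ∧ (∀ v ∈ l, v ∈ D.supp) ∧ K ≤ l.length := by
  obtain ⟨l, hl, hlen⟩ := h
  refine ⟨l.map Subtype.val, ⟨?_, hl.2.map Subtype.val_injective⟩, ?_, by simpa using hlen⟩
  · rw [List.isChain_map]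
    exact hl.1.imp fun a b hab => hab
  · intro v hv
    obtain ⟨w, -, rfl⟩ := List.mem_map.1 hv
    exact w.2

open Classical in
/-- If `G` does not contain the linear forest, the greedy packing of the paths into the components
of `G`, starting with the longest ones, fails at some path `j`. -/
theorem exists_component_weights [Fintype V] [Nonempty V] {m : ℕ} {k : Fin m → ℕ}
    (hk : Antitone k) {G : SimpleGraph V} (hG : (linearForest k).Free G) :
    ∃ (j : Fin m) (c : G.ConnectedComponent → ℕ), ∑ D, c D = ∑ i ∈ Iio j, k i ∧
      ∀ D : G.ConnectedComponent, ¬ HasPath D.toSimpleGraph (c D + k j) ∧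
        (c D = 0 ∨ k j ≤ c D) ∧ HasPath D.toSimpleGraph (c D) := by
  -- `P j` says that the first `j` paths can be distributed so that every component has one path as
  -- long as everything assigned to it. The index sought is a `j` at which `P` holds for the last
  -- time before failing.
  let P : ℕ → Prop := fun j => ∃ f : Fin m → G.ConnectedComponent, ∀ D : G.ConnectedComponent,
    HasPath D.toSimpleGraph (∑ i with i.val < j ∧ f i = D, k i)
  have hP0 : P 0 := by
    refine ⟨fun _ => G.connectedComponentMk (Classical.arbitrary V), fun D => ?_⟩
    simp only [not_lt_zero, false_and, filter_false, sum_empty]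
    exact ⟨[], ⟨by simp, by simp⟩, by simp⟩
  have hPm : ¬ P m := by
    rintro ⟨f, hf⟩
    choose p hp hsub hlen using fun D => exists_pathList_of_component (hf D)
    refine hG (linearForest_isContained_of_packing f p hp ?_ ?_)
    · intro D E v hD hE
      have h1 := hsub D v hD
      have h2 := hsub E v hE
      rw [SimpleGraph.ConnectedComponent.mem_supp_iff] at h1 h2
      rw [← h1, ← h2]
    · intro D
      refine le_of_eq_of_le ?_ (hlen D)
      simp
  obtain ⟨j, hjm, hPj, hPj'⟩ : ∃ j < m, P j ∧ ¬ P (j + 1) := by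
    by_contra hcon
    push Not at hcon
    have : ∀ j ≤ m, P j := by
      intro j
      induction j with
      | zero => exact fun _ => hP0
      | succ j ih => exact fun h => hcon j h (ih (by omega))
    exact hPm (this m le_rfl)
  obtain ⟨f, hf⟩ := hPj
  set j' : Fin m := ⟨j, hjm⟩ with hj'
  refine ⟨j', fun D => ∑ i with i.val < j ∧ f i = D, k i, ?_, fun D => ⟨?_, ?_, hf D⟩⟩
  · have : (Iio j' : Finset (Fin m)) = univ.filter fun i => i.val < j := by
      ext i
      simp [hj', Fin.lt_def]
    rw [this, ← sum_fiberwise (univ.filter fun i : Fin m => i.val < j) f k]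
    refine sum_congr rfl fun D _ => ?_
    rw [filter_filter]
  · intro hD
    -- If `D` had room for one more path, sending the path `j` to `D` would extend the distribution.
    refine hPj' ⟨Function.update f j' D, fun E => ?_⟩
    by_cases hE : E = D
    · subst hE
      refine hD.mono (le_of_eq ?_)
      have : (univ.filter fun i : Fin m => i.val < j + 1 ∧ Function.update f j' E i = E) =
          insert j' (univ.filter fun i : Fin m => i.val < j ∧ f i = E) := by
        ext i
        simp only [mem_filter, mem_univ, true_and, mem_insert]
        by_cases hi : i = j'
        · subst hi
          simp [hj']
        · rw [Function.update_of_ne hi]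
          have : i.val ≠ j := fun h => hi (Fin.ext h)
          constructor
          · exact fun h => Or.inr ⟨by omega, h.2⟩
          · exact fun h => ⟨by have := (h.resolve_left hi).1; omega, (h.resolve_left hi).2⟩
      rw [this, sum_insert, add_comm]
      simp [hj']
    · refine (hf E).mono (le_of_eq ?_)
      congr 1
      ext i
      simp only [mem_filter, mem_univ, true_and]
      by_cases hi : i = j'
      · subst hi
        simp [hj', Ne.symm hE]
      · rw [Function.update_of_ne hi]
        have : i.val ≠ j := fun h => hi (Fin.ext h)
        constructor
        · exact fun h => ⟨by omega, h.2⟩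
        · exact fun h => ⟨by omega, h.2⟩
  · rcases (univ.filter fun i : Fin m => i.val < j ∧ f i = D).eq_empty_or_nonempty with h0 | ⟨i, hi⟩
    · left
      simp only [h0, sum_empty]
    · right
      refine (hk (a := i) (b := j') ?_).trans (single_le_sum (f := k) (fun _ _ => Nat.zero_le _) hi)
      have := (mem_filter.1 hi).2.1
      rw [Fin.le_def]
      exact this.le

/-! ### Splitting into components and adding up the bounds -/

open Classical in
theorem card_edgeSet_disjointUnion {ι : Type*} [Fintype ι] {W : ι → Type*} [∀ i, Fintype (W i)]
    (G : ∀ i, SimpleGraph (W i)) :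
    Nat.card (disjointUnion G).edgeSet = ∑ i, Nat.card (G i).edgeSet := by
  refine Nat.eq_of_mul_eq_mul_left two_pos ?_
  rw [two_mul_card_edgeSet, mul_sum, sum_congr rfl fun i _ => two_mul_card_edgeSet (G i)]
  unfold adjPairs
  rw [univ_sigma_univ.symm, sum_sigma]
  refine sum_congr rfl fun i _ => sum_congr rfl fun a _ => ?_
  symm
  refine card_bij (fun b _ => (⟨i, b⟩ : Σ i, W i)) ?_ ?_ ?_
  · intro b hb
    refine mem_filter.2 ⟨by simp, i, a, b, (mem_filter.1 hb).2, rfl, rfl⟩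
  · intro b _ b' _ h
    simpa using h
  · intro b hb
    obtain ⟨j, a', b', h, h1, h2⟩ := (mem_filter.1 hb).2
    obtain rfl : i = j := congrArg Sigma.fst h1
    obtain rfl : a = a' := by simpa using h1
    exact ⟨b', mem_filter.2 ⟨mem_univ _, h⟩, h2.symm⟩

theorem disjointUnion_adj_iff {ι : Type*} {W : ι → Type*} {G : ∀ i, SimpleGraph (W i)} {i : ι}
    {a b : W i} : (disjointUnion G).Adj ⟨i, a⟩ ⟨i, b⟩ ↔ (G i).Adj a b := by
  constructor
  · rintro ⟨j, a', b', h, h1, h2⟩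
    obtain rfl : i = j := congrArg Sigma.fst h1
    obtain rfl : a = a' := by simpa using h1
    obtain rfl : b = b' := by simpa using h2
    exact h
  · exact fun h => ⟨i, a, b, h, rfl, rfl⟩

theorem fst_eq_of_disjointUnion_adj {ι : Type*} {W : ι → Type*} {G : ∀ i, SimpleGraph (W i)}
    {x y : Σ i, W i} (h : (disjointUnion G).Adj x y) : x.1 = y.1 := by
  obtain ⟨i, a, b, -, rfl, rfl⟩ := h
  rfl

/-- A graph is the disjoint union of its connected components. -/
def isoComponents (G : SimpleGraph V) :
    G ≃g disjointUnion fun D : G.ConnectedComponent => D.toSimpleGraph where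
  toFun v := ⟨G.connectedComponentMk v, v, rfl⟩
  invFun x := x.2.val
  left_inv v := rfl
  right_inv := by
    rintro ⟨D, v, hv⟩
    obtain rfl : G.connectedComponentMk v = D := hv
    rfl
  map_rel_iff' := by
    intro u v
    constructor
    · rintro ⟨D, a, b, h, h1, h2⟩
      have e1 : u = a.val := congrArg (fun x : Σ D : G.ConnectedComponent, D => x.2.val) h1
      have e2 : v = b.val := congrArg (fun x : Σ D : G.ConnectedComponent, D => x.2.val) h2
      rw [e1, e2]
      exact h
    · intro h
      have h1 : G.connectedComponentMk u = G.connectedComponentMk v :=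
        SimpleGraph.ConnectedComponent.connectedComponentMk_eq_of_adj h
      refine ⟨G.connectedComponentMk u, ⟨u, rfl⟩, ⟨v, h1.symm⟩, h, rfl, ?_⟩
      change (⟨G.connectedComponentMk v, ⟨v, rfl⟩⟩ : Σ D : G.ConnectedComponent, D) = _
      generalize_proofs p1 p2
      revert p2
      generalize G.connectedComponentMk u = D at *
      rintro p2
      subst h1
      rfl

theorem card_edgeSet_congr {W : Type*} {G : SimpleGraph V} {H : SimpleGraph W} (e : G ≃g H) :
    Nat.card G.edgeSet = Nat.card H.edgeSet :=
  Nat.card_congr e.mapEdgeSet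

theorem card_edgeSet_sum {W : Type*} [Finite V] [Finite W] (G : SimpleGraph V)
    (H : SimpleGraph W) :
    Nat.card (G ⊕g H).edgeSet = Nat.card G.edgeSet + Nat.card H.edgeSet := by
  rw [Nat.card_congr SimpleGraph.edgeSetSumEquiv, Nat.card_sum]

open Classical in
theorem card_edgeSet_eq_sum_components [Fintype V] (G : SimpleGraph V) :
    Nat.card G.edgeSet = ∑ D : G.ConnectedComponent, Nat.card D.toSimpleGraph.edgeSet := by
  rw [card_edgeSet_congr (isoComponents G), card_edgeSet_disjointUnion]

open Classical in
theorem card_eq_sum_components [Fintype V] (G : SimpleGraph V) :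
    Fintype.card V = ∑ D : G.ConnectedComponent, Fintype.card D := by
  rw [Fintype.card_congr (isoComponents G).toEquiv, Fintype.card_sigma]

/-- A graph splits as a disjoint union along a set of vertices without outgoing edges. -/
noncomputable def isoSum (G : SimpleGraph V) (s : Set V)
    (hs : ∀ u ∈ s, ∀ v ∉ s, ¬ G.Adj u v) : G ≃g G.induce s ⊕g G.induce sᶜ := by
  classical
  refine RelIso.symm ⟨Equiv.Set.sumCompl s, ?_⟩
  rintro (⟨u, hu⟩ | ⟨u, hu⟩) (⟨v, hv⟩ | ⟨v, hv⟩)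
  · simp
  · simpa using hs u hu v hv
  · simpa using fun h : G.Adj u v => hs v hv u hu h.symm
  · simp

theorem exists_component_of_isChain {G : SimpleGraph V} {l : List V} (hl : l.IsChain G.Adj)
    (hne : l ≠ []) : ∃ D : G.ConnectedComponent, ∀ v ∈ l, v ∈ D.supp := by
  induction l with
  | nil => exact absurd rfl hne
  | cons a l ih =>
    rcases l with _ | ⟨b, l⟩
    · exact ⟨G.connectedComponentMk a, by simp⟩
    · rw [List.isChain_cons_cons] at hl
      obtain ⟨D, hD⟩ := ih hl.2 (by simp)
      refine ⟨D, fun v hv => ?_⟩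
      rcases List.mem_cons.1 hv with rfl | hv
      · have := hD b (by simp)
        rw [SimpleGraph.ConnectedComponent.mem_supp_iff] at this ⊢
        rw [← this]
        exact SimpleGraph.ConnectedComponent.connectedComponentMk_eq_of_adj hl.1
      · exact hD v hv

theorem hasPath_induce {G : SimpleGraph V} {s : Set V} {l : List V} (hl : IsPathList G l)
    (hs : ∀ v ∈ l, v ∈ s) : HasPath (G.induce s) l.length := by
  refine ⟨l.attachWith (· ∈ s) hs, ⟨?_, ?_⟩, by simp⟩
  · rw [List.isChain_attachWith]
    exact hl.1.imp_of_mem_imp fun a b ha hb hab => ⟨hs a ha, hs b hb, hab⟩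
  · refine List.Nodup.of_map Subtype.val ?_
    rw [List.attachWith_map_subtype_val]
    exact hl.2

open Classical in
/-- The edges of the components add up to at most `componentBound`, and to at most `mainBound`
if there are several components. -/
theorem sum_componentBound_le {ι : Type*} {k : ℕ} (hk : 3 ≤ k) {s : Finset ι} {v c : ι → ℕ}
    (hc : ∀ i ∈ s, c i = 0 ∨ k ≤ c i) (hcv : ∀ i ∈ s, c i ≤ v i) (hv : ∀ i ∈ s, 0 < v i) :
    (s.Nonempty → ∑ i ∈ s, componentBound k (v i) (c i) ≤
      componentBound k (∑ i ∈ s, v i) (∑ i ∈ s, c i)) ∧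
    (2 ≤ #s → ∑ i ∈ s, componentBound k (v i) (c i) ≤
      mainBound k (∑ i ∈ s, v i) (∑ i ∈ s, c i)) := by
  induction s using Finset.induction_on with
  | empty => simp
  | insert a s ha ih =>
    obtain ⟨ih, -⟩ := ih (fun i hi => hc i (mem_insert_of_mem hi))
      (fun i hi => hcv i (mem_insert_of_mem hi)) (fun i hi => hv i (mem_insert_of_mem hi))
    rw [sum_insert ha, sum_insert ha, sum_insert ha, card_insert_of_notMem ha]
    rcases s.eq_empty_or_nonempty with rfl | hne
    · simp
    · have h1 := ih hne
      have h2 : ∑ i ∈ s, c i = 0 ∨ k ≤ ∑ i ∈ s, c i := by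
        by_cases h0 : ∀ i ∈ s, c i = 0
        · exact Or.inl (sum_eq_zero h0)
        · push Not at h0
          obtain ⟨i, hi, hi0⟩ := h0
          exact Or.inr (((hc i (mem_insert_of_mem hi)).resolve_left hi0).trans
            (single_le_sum (fun _ _ => Nat.zero_le _) hi))
      have h3 : 0 < ∑ i ∈ s, v i := sum_pos (fun i hi => hv i (mem_insert_of_mem hi)) hne
      have h4 := componentBound_add_le hk (hc a (mem_insert_self _ _)) h2
        (hcv a (mem_insert_self _ _))
        (sum_le_sum fun i hi => hcv i (mem_insert_of_mem hi)) (hv a (mem_insert_self _ _)) h3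
      have h5 := mainBound_le_componentBound k (v a + ∑ i ∈ s, v i) (c a + ∑ i ∈ s, c i)
      exact ⟨fun _ => by omega, fun _ => by omega⟩

theorem card_component_pos [Fintype V] {G : SimpleGraph V} (D : G.ConnectedComponent)
    [Fintype D] : 0 < Fintype.card D := by
  obtain ⟨v, hv⟩ := D.nonempty_supp
  exact Fintype.card_pos_iff.2 ⟨⟨v, hv⟩⟩

theorem HasPath.le_card [Fintype V] {G : SimpleGraph V} {K : ℕ} (h : HasPath G K) :
    K ≤ Fintype.card V := by
  obtain ⟨l, hl, hlen⟩ := h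
  exact hlen.trans hl.2.length_le_card

theorem connected_of_forall_component {G : SimpleGraph V} (D : G.ConnectedComponent)
    (h : ∀ E : G.ConnectedComponent, E = D) : G.Connected := by
  obtain ⟨v, -⟩ := D.nonempty_supp
  have : Nonempty V := ⟨v⟩
  refine SimpleGraph.Connected.mk fun u w => ?_
  rw [← SimpleGraph.ConnectedComponent.eq]
  exact (h _).trans (h _).symm

theorem HasPath.component {G : SimpleGraph V} {D : G.ConnectedComponent}
    (h : ∀ E : G.ConnectedComponent, E = D) {K : ℕ} (hK : HasPath G K) :
    HasPath D.toSimpleGraph K := by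
  obtain ⟨l, hl, hlen⟩ := hK
  exact (hasPath_induce hl fun v _ => h _).mono hlen

-- Merging at least two components already brings the sum of the componentwise bounds below
-- `mainBound`. The extra edge of the odd case can therefore survive only in a connected graph.
open Classical in
theorem card_edgeSet_le_mainBound_or_connected [Fintype V] [Nonempty V] {G : SimpleGraph V} {k : ℕ}
    (hk : 3 ≤ k) {c : G.ConnectedComponent → ℕ}
    (hc : ∀ D : G.ConnectedComponent, ¬ HasPath D.toSimpleGraph (c D + k) ∧ (c D = 0 ∨ k ≤ c D) ∧
      HasPath D.toSimpleGraph (c D)) :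
    Nat.card G.edgeSet ≤ mainBound k (Fintype.card V) (∑ D, c D) ∨
      (G.Connected ∧ ¬ HasPath G (∑ D, c D + k) ∧
        Nat.card G.edgeSet ≤ componentBound k (Fintype.card V) (∑ D, c D)) := by
  have h1 : Nat.card G.edgeSet ≤ ∑ D : G.ConnectedComponent, componentBound k (Fintype.card D) (c D) := by
    rw [card_edgeSet_eq_sum_components]
    exact sum_le_sum fun D _ => card_edgeSet_le_componentBound hk (hc D).2.1
      D.connected_toSimpleGraph (hc D).1
  have h2 := sum_componentBound_le hk (s := univ) (v := fun D : G.ConnectedComponent => Fintype.card D)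
    (c := c) (fun D _ => (hc D).2.1) (fun D _ => (hc D).2.2.le_card)
    (fun D _ => card_component_pos D)
  rw [← card_eq_sum_components] at h2
  rcases le_or_gt 2 #(univ : Finset G.ConnectedComponent) with h | h
  · exact Or.inl (h1.trans (h2.2 h))
  · right
    set D := G.connectedComponentMk (Classical.arbitrary V)
    have hD : ∀ E, E = D := fun E => card_le_one.1 (Nat.le_of_lt_succ h) E (mem_univ _) D (mem_univ _)
    have hu : (univ : Finset G.ConnectedComponent) = {D} := by
      ext E
      simp [hD E]
    refine ⟨connected_of_forall_component D hD, fun hp => (hc D).1 ?_, h1.trans (h2.1 ⟨D, mem_univ _⟩)⟩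
    rw [hu, sum_singleton] at hp
    exact hp.component hD

/-! ### Equality: graphs without one path, and graphs attaining `mainBound` -/

open Classical in
theorem card_edgeSet_le_pathEdges [Fintype V] {G : SimpleGraph V} {k : ℕ} (hk : 3 ≤ k)
    (hG : ¬ HasPath G k) (D : G.ConnectedComponent) :
    Nat.card D.toSimpleGraph.edgeSet ≤ pathEdges k (Fintype.card D) := by
  rw [← componentBound_zero hk]
  refine card_edgeSet_le_componentBound hk (Or.inl rfl) D.connected_toSimpleGraph ?_
  rw [Nat.zero_add]
  exact fun h => hG h.of_induce

theorem sum_pathEdges_le {ι : Type*} {k : ℕ} (hk : 2 ≤ k) (s : Finset ι) (v : ι → ℕ) :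
    ∑ i ∈ s, pathEdges k (v i) ≤ pathEdges k (∑ i ∈ s, v i) := by
  classical
  induction s using Finset.induction_on with
  | empty => simp
  | insert a s ha ih =>
    rw [sum_insert ha, sum_insert ha]
    exact (Nat.add_le_add_left ih _).trans (pathEdges_add_le hk _ _)

/-- A graph without a path on `k` vertices has at most `pathEdges k n` edges. -/
theorem card_edgeSet_le_pathEdges_card [Fintype V] {G : SimpleGraph V} {k : ℕ} (hk : 3 ≤ k)
    (hG : ¬ HasPath G k) : Nat.card G.edgeSet ≤ pathEdges k (Fintype.card V) := by
  classical
  rw [card_edgeSet_eq_sum_components, card_eq_sum_components G]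
  exact (sum_le_sum fun D _ => card_edgeSet_le_pathEdges hk hG D).trans
    (sum_pathEdges_le (by omega) _ _)

theorem eq_top_of_card_edgeSet [Fintype V] {G : SimpleGraph V}
    (h : (Fintype.card V).choose 2 ≤ Nat.card G.edgeSet) : G = ⊤ := by
  refine eq_of_adjPairs_le le_top ?_
  rw [← two_mul_card_edgeSet, ← two_mul_card_edgeSet]
  exact Nat.mul_le_mul_left 2 ((card_edgeSet_le_choose ⊤).trans h)

open Classical in
/-- The structure of the extremal graphs for a path with an even number of vertices. -/
theorem structure_of_card_edgeSet_eq_pathEdges [Fintype V] [Nonempty V] {G : SimpleGraph V} {k : ℕ}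
    (hk : 4 ≤ k) (hp : k % 2 = 0) (hG : ¬ HasPath G k)
    (he : Nat.card G.edgeSet = pathEdges k (Fintype.card V)) :
    ∃ D : G.ConnectedComponent,
      (∀ E, E ≠ D → Fintype.card E = k - 1 ∧ E.toSimpleGraph = ⊤) ∧
      ((Fintype.card D ≤ k - 1 ∧ D.toSimpleGraph = ⊤) ∨
        (k ≤ Fintype.card D ∧ IsCliqueJoin D.toSimpleGraph (k / 2 - 1) ∧
          (Fintype.card D % (k - 1) = k / 2 ∨ Fintype.card D % (k - 1) = (k - 2) / 2))) := by
  have h1 : ∀ D ∈ (univ : Finset G.ConnectedComponent),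
      Nat.card D.toSimpleGraph.edgeSet ≤ pathEdges k (Fintype.card D) :=
    fun D _ => card_edgeSet_le_pathEdges (by omega) hG D
  have h2 := sum_pathEdges_le (k := k) (by omega) univ
    fun D : G.ConnectedComponent => Fintype.card D
  rw [← card_eq_sum_components, ← he, card_edgeSet_eq_sum_components G] at h2
  have h3 := (sum_eq_sum_iff_of_le h1).1 (le_antisymm (sum_le_sum h1) h2)
  have hstr : ∀ D : G.ConnectedComponent, (Fintype.card D ≤ k - 1 ∧ D.toSimpleGraph = ⊤) ∨
        (k ≤ Fintype.card D ∧ IsCliqueJoin D.toSimpleGraph (k / 2 - 1) ∧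
          (Fintype.card D % (k - 1) = k / 2 ∨ Fintype.card D % (k - 1) = (k - 2) / 2)) := by
    intro D
    have h4 := h3 D (mem_univ D)
    have hconn := D.connected_toSimpleGraph
    have hnp : ¬ HasPath D.toSimpleGraph (0 + k) := by
      rw [Nat.zero_add]
      exact fun h => hG h.of_induce
    rcases Nat.lt_or_ge (Fintype.card D) k with hlt | hge
    · refine Or.inl ⟨by omega, eq_top_of_card_edgeSet ?_⟩
      rw [h4, pathEdges_of_le (by omega)]
    · refine Or.inr ⟨hge, ?_, ?_⟩
      · have := isCliqueJoin_of_card_edgeSet_eq hk (Or.inl rfl) (by simpa using hp) hconn hnp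
          (by simpa using hge) (by rw [mainBound_zero (by omega), h4])
        simpa using this
      · refine mod_eq_of_joinEdges_eq (by omega) hp hge ?_
        have h5 := joinEdges_add_le_pathEdges (by omega : 3 ≤ k) hge
        have h6 := card_edgeSet_dichotomy hk (Or.inl rfl) (by simpa using hp) hconn hnp
          (by simpa using hge)
        rw [cliqueBound_zero, h4, Nat.zero_add] at h6
        omega
  -- Two components with nonzero residues modulo `k - 1` would lose strictly against their union, so
  -- at most one component is exceptional. All others have residue `0`, which excludes clique joins
  -- and leaves copies of `K_{k-1}`.
  have hmod : ∃ D : G.ConnectedComponent, ∀ E : G.ConnectedComponent, E ≠ D →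
      Fintype.card E % (k - 1) = 0 := by
    by_cases hall : ∀ E : G.ConnectedComponent, Fintype.card E % (k - 1) = 0
    · exact ⟨G.connectedComponentMk (Classical.arbitrary V), fun E _ => hall E⟩
    · push Not at hall
      obtain ⟨D, hD⟩ := hall
      refine ⟨D, fun E hE => ?_⟩
      by_contra hE0
      have h4 := pathEdges_add_lt (by omega : 2 ≤ k) hD hE0
      have h5 := sum_pathEdges_le (k := k) (by omega) ((univ.erase D).erase E)
        fun D : G.ConnectedComponent => Fintype.card D
      have h6 : ∑ D : G.ConnectedComponent, pathEdges k (Fintype.card D) =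
          pathEdges k (Fintype.card V) := by
        rw [← he, card_edgeSet_eq_sum_components G]
        exact (sum_congr rfl h3).symm
      have h7 := card_eq_sum_components G
      have hED : E ∈ univ.erase D := mem_erase.2 ⟨hE, mem_univ _⟩
      rw [← add_sum_erase _ _ (mem_univ D), ← add_sum_erase _ _ hED] at h6 h7
      have h8 := pathEdges_add_le (by omega : 2 ≤ k) (Fintype.card D + Fintype.card E)
        (∑ D ∈ (univ.erase D).erase E, Fintype.card D)
      rw [add_assoc, ← h7] at h8
      omega
  obtain ⟨D, hD⟩ := hmod
  refine ⟨D, fun E hE => ?_, hstr D⟩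
  have h4 := hD E hE
  have h5 := card_component_pos E
  rcases hstr E with h | h
  · refine ⟨?_, h.2⟩
    by_contra hne
    rw [Nat.mod_eq_of_lt (by omega)] at h4
    omega
  · omega

open Classical in
/-- The structure of the graphs attaining `mainBound` in the case where all weights are even. -/
theorem structure_of_card_edgeSet_eq_mainBound [Fintype V] [Nonempty V] {G : SimpleGraph V} {k : ℕ}
    (hk : 4 ≤ k) {c : G.ConnectedComponent → ℕ}
    (hc : ∀ D : G.ConnectedComponent, ¬ HasPath D.toSimpleGraph (c D + k) ∧ (c D = 0 ∨ k ≤ c D) ∧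
      HasPath D.toSimpleGraph (c D)) (hp : (∑ D, c D + k) % 2 = 0) (hpos : 0 < ∑ D, c D)
    (hV : ∑ D, c D + k ≤ Fintype.card V)
    (he : mainBound k (Fintype.card V) (∑ D, c D) ≤ Nat.card G.edgeSet) :
    (IsCliqueJoin G ((∑ D, c D + k) / 2 - 1) ∧
      Nat.card G.edgeSet = joinEdges ((∑ D, c D + k) / 2 - 1) (Fintype.card V)) ∨
    ∃ s : Set V, (∀ u ∈ s, ∀ v ∉ s, ¬ G.Adj u v) ∧ Nat.card s = ∑ D, c D + k - 1 ∧
      G.induce s = ⊤ ∧ ¬ HasPath (G.induce sᶜ) k ∧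
      Nat.card (G.induce sᶜ).edgeSet = pathEdges k (Nat.card (sᶜ : Set V)) ∧
      Nat.card G.edgeSet = cliqueBound (Fintype.card V) (∑ D, c D + k) k := by
  obtain ⟨D, -, hD0⟩ : ∃ D ∈ (univ : Finset G.ConnectedComponent), c D ≠ 0 := by
    by_contra hcon
    push Not at hcon
    rw [sum_eq_zero hcon] at hpos
    omega
  have hDk := (hc D).2.1.resolve_left hD0
  have hDc := (hc D).2.2.le_card
  have hle : ∀ E : G.ConnectedComponent,
      Nat.card E.toSimpleGraph.edgeSet ≤ componentBound k (Fintype.card E) (c E) := fun E =>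
    card_edgeSet_le_componentBound (by omega) (hc E).2.1 E.connected_toSimpleGraph (hc E).1
  have hn := card_eq_sum_components G
  have hE := card_edgeSet_eq_sum_components G
  rw [← add_sum_erase _ _ (mem_univ D)] at hn hE
  have hsum := (sum_componentBound_le (k := k) (by omega) (s := univ.erase D)
    (v := fun D : G.ConnectedComponent => Fintype.card D)
    (c := c) (fun D _ => (hc D).2.1) (fun D _ => (hc D).2.2.le_card)
    (fun D _ => card_component_pos D)).1
  have hsumle : ∑ E ∈ univ.erase D, Nat.card E.toSimpleGraph.edgeSet ≤
      ∑ E ∈ univ.erase D, componentBound k (Fintype.card E) (c E) := sum_le_sum fun E _ => hle E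
  -- Two components of positive weight would make the total strictly smaller than `mainBound`.
  have hrest : ∀ E, E ≠ D → c E = 0 := by
    intro E hED
    by_contra hE0
    have hEk := (hc E).2.1.resolve_left hE0
    have hEm : E ∈ univ.erase D := mem_erase.2 ⟨hED, mem_univ _⟩
    have hlt := componentBound_add_lt (by omega : 3 ≤ k) hDk
      (hEk.trans (single_le_sum (f := c) (fun _ _ => Nat.zero_le _) hEm)) hDc
      (sum_le_sum fun E (_ : E ∈ univ.erase D) => (hc E).2.2.le_card)
    rw [← hn, add_sum_erase _ c (mem_univ D)] at hlt
    have := hsum ⟨E, hEm⟩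
    have := hle D
    omega
  have hcD : ∑ E, c E = c D := sum_eq_single_of_mem D (mem_univ _) fun E _ h => hrest E h
  rw [hcD] at hp hV he ⊢
  have hcut : ∀ u ∈ D.supp, ∀ v ∉ D.supp, ¬ G.Adj u v := by
    intro u hu v hv huv
    rw [SimpleGraph.ConnectedComponent.mem_supp_iff] at hu hv
    exact hv (hu ▸ (SimpleGraph.ConnectedComponent.connectedComponentMk_eq_of_adj huv).symm)
  set H := G.induce D.suppᶜ with hH
  have hHk : ¬ HasPath H k := by
    rintro ⟨l, hl, hlen⟩
    have hlV : (l.map Subtype.val).IsChain G.Adj := by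
      rw [List.isChain_map]
      exact hl.1.imp fun a b h => h
    obtain ⟨E, hEl⟩ := exists_component_of_isChain hlV (by
      rw [Ne, List.map_eq_nil_iff]
      rintro rfl
      simp at hlen
      omega)
    have hED : E ≠ D := by
      rintro rfl
      rcases l with _ | ⟨a, l⟩
      · simp at hlen
        omega
      · exact a.2 (hEl a (by simp))
    refine (hc E).1 ?_
    rw [hrest E hED, Nat.zero_add]
    exact (hasPath_induce (G := G) ⟨hlV, hl.2.map Subtype.val_injective⟩ hEl).mono (by simpa)
  have hHe := card_edgeSet_le_pathEdges_card (by omega : 3 ≤ k) hHk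
  have hsplit : Nat.card G.edgeSet = Nat.card D.toSimpleGraph.edgeSet + Nat.card H.edgeSet := by
    rw [card_edgeSet_congr (isoSum G D.supp hcut), card_edgeSet_sum]
    rfl
  have hcards : Fintype.card V = Fintype.card D + Fintype.card (D.suppᶜ : Set V) := by
    rw [Fintype.card_congr (isoSum G D.supp hcut).toEquiv, Fintype.card_sum]
    exact congrArg (· + _) (Fintype.card_congr (Equiv.refl _))
  rcases Nat.eq_zero_or_pos (Fintype.card (D.suppᶜ : Set V)) with hw | hw
  · left
    have hall : ∀ E : G.ConnectedComponent, E = D := by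
      intro E
      obtain ⟨v, hv⟩ := E.nonempty_supp
      by_contra hED
      have hvD : v ∈ D.suppᶜ := by
        intro hvD
        rw [SimpleGraph.ConnectedComponent.mem_supp_iff] at hv hvD
        exact hED (hv.symm.trans hvD)
      exact (Fintype.card_eq_zero_iff.1 hw).false ⟨v, hvD⟩
    have hconn := connected_of_forall_component D hall
    have hnp : ¬ HasPath G (c D + k) := fun h => (hc D).1 (h.component hall)
    refine ⟨isCliqueJoin_of_card_edgeSet_eq hk (Or.inr hDk) hp hconn hnp hV he, ?_⟩
    have h1 := joinEdges_le_mainBound hV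
    have h2 : cliqueBound (Fintype.card V) (c D + k) k ≤ mainBound k (Fintype.card V) (c D) :=
      le_max_left _ _
    have := card_edgeSet_dichotomy hk (Or.inr hDk) hp hconn hnp hV
    omega
  · right
    have hm : cliqueBound (Fintype.card V) (c D + k) k ≤ mainBound k (Fintype.card V) (c D) :=
      le_max_left _ _
    have h1 := cliqueBound_add_pathEdges_le (by omega : 2 ≤ k) hDk hDc
      (Fintype.card (D.suppᶜ : Set V))
    rw [← hcards] at h1
    -- When other vertices exist, a component `D` with at least `c D + k` vertices falls strictly
    -- short, under the clique bound as well as under the join bound. So `D` is small, and equality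
    -- makes it complete on exactly `c D + k - 1` vertices.
    have hsmall : Fintype.card D < c D + k := by
      by_contra hge
      rw [not_lt] at hge
      rcases card_edgeSet_dichotomy hk (Or.inr hDk) hp D.connected_toSimpleGraph (hc D).1 hge with
        h | h
      · have := h1.1
        omega
      · have h2 := joinEdges_add_pathEdges_lt (by omega : 3 ≤ k) hDk hge hw
        rw [← hcards] at h2
        have h3 := joinEdges_le_mainBound hV
        omega
    have hDe := card_edgeSet_le_choose D.toSimpleGraph
    have hcl := cliqueBound_of_lt hsmall
    have hDcard : Fintype.card D = c D + k - 1 := by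
      by_contra hne
      have := h1.2 hw (by omega)
      omega
    have h2 := h1.1
    refine ⟨D.supp, hcut, ?_,
      eq_top_of_card_edgeSet (G := D.toSimpleGraph) (by omega), hHk, ?_, by omega⟩
    · rw [← hDcard]
      exact Nat.card_eq_fintype_card (α := D)
    · rw [Nat.card_eq_fintype_card (α := (D.suppᶜ : Set V))]
      change Nat.card H.edgeSet = _
      omega

/-! ### Isomorphisms with the listed graphs -/

theorem nonempty_iso_completeGraph [Finite V] {G : SimpleGraph V} (hG : G = ⊤) {q : ℕ}
    (hV : Nat.card V = q) : Nonempty (G ≃g SimpleGraph.completeGraph (Fin q)) := by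
  subst hG
  exact ⟨⟨Finite.equivFinOfCardEq hV, by simp⟩⟩

theorem nonempty_iso_cliqueJoinEmpty [Fintype V] {G : SimpleGraph V} {c q : ℕ}
    (hG : IsCliqueJoin G c) (hV : Fintype.card V = c + q) :
    Nonempty (G ≃g cliqueJoinEmpty c q) := by
  classical
  obtain ⟨C, hC, h1, h2⟩ := hG
  have e1 : {v // v ∈ C} ≃ Fin c := Fintype.equivFinOfCardEq (by simpa using hC)
  have e2 : {v // v ∉ C} ≃ Fin q := Fintype.equivFinOfCardEq (by
    rw [Fintype.card_subtype_compl, Fintype.card_coe, hV, hC, Nat.add_sub_cancel_left])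
  refine ⟨RelIso.symm ⟨(Equiv.sumCongr e1.symm e2.symm).trans (Equiv.sumCompl (· ∈ C)), ?_⟩⟩
  rintro (u | u) (v | v)
  · have : (e1.symm u : V) ≠ e1.symm v ↔ u ≠ v := by simp
    simpa [cliqueJoinEmpty, join] using
      ⟨fun h => this.1 h.ne, fun h => h1 _ (e1.symm u).2 _ (this.2 h)⟩
  · simpa [cliqueJoinEmpty, join] using
      h1 _ (e1.symm u).2 _ fun h : (e1.symm u : V) = e2.symm v =>
        (e2.symm v).2 (h ▸ (e1.symm u).2)
  · simpa [cliqueJoinEmpty, join] using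
      (h1 _ (e1.symm v).2 _ fun h : (e1.symm v : V) = e2.symm u =>
        (e2.symm u).2 (h ▸ (e1.symm v).2)).symm
  · simpa [cliqueJoinEmpty, join] using h2 _ _ (e2.symm u).2 (e2.symm v).2

/-- If the vertices are partitioned into `t` classes of size `q` and the edges are the pairs of
distinct vertices in the same class, then the graph is `t · K_q`. -/
theorem nonempty_iso_cliques {ι : Type*} [Finite V] {G : SimpleGraph V} (f : V → ι) {t q : ℕ}
    (ht : Nat.card ι = t) [Finite ι] (hq : ∀ i, Nat.card {v // f v = i} = q)
    (hG : ∀ u v, G.Adj u v ↔ u ≠ v ∧ f u = f v) : Nonempty (G ≃g cliques t q) := by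
  let e : V ≃ Σ _ : Fin t, Fin q := (Equiv.sigmaFiberEquiv f).symm.trans
    (Equiv.sigmaCongr (Finite.equivFinOfCardEq ht) fun i => Finite.equivFinOfCardEq (hq i))
  have he : ∀ v, (e v).1 = Finite.equivFinOfCardEq ht (f v) := fun v => rfl
  refine ⟨⟨e, fun {u v} => ?_⟩⟩
  rw [hG]
  constructor
  · rintro ⟨i, a, b, hab, h1, h2⟩
    refine ⟨?_, ?_⟩
    · rintro rfl
      rw [h1] at h2
      exact hab (by simpa using h2)
    · apply (Finite.equivFinOfCardEq ht).injective
      rw [← he, ← he, h1, h2]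
  · rintro ⟨h1, h2⟩
    have h3 : (e u).1 = (e v).1 := by rw [he, he, h2]
    have h4 : e u ≠ e v := fun h => h1 (e.injective h)
    change (disjointUnion _).Adj (e u) (e v)
    generalize e u = x at *
    generalize e v = y at *
    obtain ⟨i, a⟩ := x
    obtain ⟨j, b⟩ := y
    obtain rfl : i = j := h3
    exact ⟨i, a, b, fun h => h4 (by rw [h]), rfl, rfl⟩

/-- The disjoint union with the empty graph. -/
def isoSumEmpty {W : Type*} [IsEmpty W] (G : SimpleGraph V) (H : SimpleGraph W) : G ≃g G ⊕g H where
  toEquiv := (Equiv.sumEmpty V W).symm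
  map_rel_iff' := by simp

theorem nonempty_iso_cliques_of_components [Finite V] {G : SimpleGraph V} {q t : ℕ}
    {s : Set V} (P : G.ConnectedComponent → Prop) (hs : ∀ v, v ∈ s ↔ P (G.connectedComponentMk v))
    (ht : Nat.card {D // P D} = t)
    (hP : ∀ D, P D → Nat.card D = q ∧ D.toSimpleGraph = ⊤) :
    Nonempty (G.induce s ≃g cliques t q) := by
  refine nonempty_iso_cliques
    (fun v : s => (⟨G.connectedComponentMk v, (hs v).1 v.2⟩ : {D // P D})) ht ?_ ?_
  · rintro ⟨D, hD⟩
    rw [← (hP D hD).1]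
    refine Nat.card_congr ⟨fun v => ⟨v.1.1, congrArg Subtype.val v.2⟩,
      fun v => ⟨⟨v.1, (hs _).2 ?_⟩, Subtype.ext v.2⟩, fun v => rfl, fun v => rfl⟩
    have : G.connectedComponentMk v.1 = D := v.2
    rwa [this]
  · rintro ⟨u, hu⟩ ⟨v, hv⟩
    simp only [SimpleGraph.comap_adj, Function.Embedding.subtype_apply, ne_eq, Subtype.mk.injEq]
    constructor
    · exact fun h => ⟨h.ne, SimpleGraph.ConnectedComponent.connectedComponentMk_eq_of_adj h⟩
    · rintro ⟨h1, h2⟩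
      have h3 := (hP _ ((hs u).1 hu)).2
      have : (G.connectedComponentMk u).toSimpleGraph.Adj ⟨u, rfl⟩ ⟨v, h2.symm⟩ := by
        rw [h3]
        exact fun h => h1 (congrArg Subtype.val h)
      exact this

/-- An extremal graph for a path on an even number of vertices is of the listed form. -/
theorem isPathExtremalGraph_of_card_edgeSet {k N : ℕ} {G : SimpleGraph (Fin N)}
    (hk : 4 ≤ k) (hp : k % 2 = 0) (hN : 0 < N) (hG : ¬ HasPath G k)
    (he : Nat.card G.edgeSet = pathEdges k N) : IsPathExtremalGraph k G := by
  classical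
  have : Nonempty (Fin N) := ⟨⟨0, hN⟩⟩
  obtain ⟨D, hD, hD'⟩ := structure_of_card_edgeSet_eq_pathEdges hk hp hG (by simpa using he)
  have hcut : ∀ u ∈ D.supp, ∀ v ∉ D.supp, ¬ G.Adj u v := by
    intro u hu v hv huv
    rw [SimpleGraph.ConnectedComponent.mem_supp_iff] at hu hv
    exact hv (hu ▸ (SimpleGraph.ConnectedComponent.connectedComponentMk_eq_of_adj huv).symm)
  obtain ⟨e⟩ := nonempty_iso_cliques_of_components (s := D.suppᶜ) (q := k - 1) (G := G)
    (fun E => E ≠ D) (fun v => by simp) rfl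
    (fun E hE => ⟨by rw [Nat.card_eq_fintype_card]; exact (hD E hE).1, (hD E hE).2⟩)
  set T := Nat.card {E // E ≠ D}
  have f : G ≃g cliques T (k - 1) ⊕g D.toSimpleGraph :=
    (isoSum G D.supp hcut).trans
      (SimpleGraph.Iso.sumComm.trans (SimpleGraph.Iso.sumCongr e SimpleGraph.Iso.refl))
  have hcard : N = (k - 1) * T + Nat.card D := by
    have := Nat.card_congr f.toEquiv
    rw [Nat.card_sum] at this
    simpa [mul_comm] using this
  have hDc : Nat.card D = Fintype.card D := Nat.card_eq_fintype_card
  rw [← hDc] at hD'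
  rcases hD' with ⟨hle, htop⟩ | ⟨hge, hcj, hmod⟩
  -- A component `D` on exactly `k - 1` vertices is one more clique, with remainder `r = 0`;
  -- otherwise its order is the remainder itself.
  · rcases hle.eq_or_lt with heq | hlt
    · obtain ⟨e'⟩ := nonempty_iso_cliques_of_components (s := Set.univ) (q := k - 1) (G := G)
        (fun E => True) (fun v => by simp) rfl (fun E _ => by
          by_cases hE : E = D
          · rw [hE]
            exact ⟨heq, htop⟩
          · exact ⟨by rw [Nat.card_eq_fintype_card]; exact (hD E hE).1, (hD E hE).2⟩)
      set T' := Nat.card {E : G.ConnectedComponent // True}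
      have f' : G ≃g cliques T' (k - 1) ⊕g SimpleGraph.completeGraph (Fin 0) :=
        (SimpleGraph.induceUnivIso G).symm.trans (e'.trans (isoSumEmpty _ _))
      have hcard' : N = (k - 1) * T' + 0 := by
        have := Nat.card_congr f'.toEquiv
        rw [Nat.card_sum] at this
        simpa [mul_comm] using this
      exact ⟨T', 0, hcard', by omega, Or.inl ⟨f'⟩⟩
    · obtain ⟨g⟩ := nonempty_iso_completeGraph htop rfl
      exact ⟨T, Nat.card D, hcard, hlt,
        Or.inl ⟨f.trans (SimpleGraph.Iso.sumCongr SimpleGraph.Iso.refl g)⟩⟩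
  · set r := Nat.card D % (k - 1) with hr
    have hrk : r < k - 1 := Nat.mod_lt _ (by omega)
    -- The clique join has the order of `s + 1` cliques and the remainder, so it replaces `s + 1` of
    -- the `t = T + (s + 1)` cliques.
    obtain ⟨s, hs⟩ : ∃ s, Nat.card D / (k - 1) = s + 1 :=
      ⟨Nat.card D / (k - 1) - 1, by
        have := Nat.div_pos (by omega : k - 1 ≤ Nat.card D) (by omega)
        omega⟩
    have hM : Nat.card D = (k - 1) * (s + 1) + r := by
      rw [← hs, hr, Nat.div_add_mod]
    have hM' : (k - 1) * (s + 1) = s * (k - 1) + (k - 1) := by ring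
    obtain ⟨g⟩ := nonempty_iso_cliqueJoinEmpty (q := k / 2 + s * (k - 1) + r) hcj
      (by rw [← hDc]; omega)
    refine ⟨T + (s + 1), r, ?_, hrk, Or.inr ⟨hmod, s, by omega, ?_⟩⟩
    · rw [hcard, hM]
      ring
    · have h1 : T + (s + 1) - s - 1 = T := by omega
      have h2 : (k - 2) / 2 = k / 2 - 1 := by omega
      rw [h1, h2]
      exact ⟨f.trans (SimpleGraph.Iso.sumCongr SimpleGraph.Iso.refl g)⟩

theorem exists_iso_clique_sum {n q k : ℕ} {G : SimpleGraph (Fin n)} (hk : 4 ≤ k)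
    (hp : k % 2 = 0) (hq : q < n) {s : Set (Fin n)} (hs : ∀ u ∈ s, ∀ v ∉ s, ¬ G.Adj u v)
    (hcard : Nat.card s = q) (htop : G.induce s = ⊤) (hG : ¬ HasPath (G.induce sᶜ) k)
    (he : Nat.card (G.induce sᶜ).edgeSet = pathEdges k (Nat.card (sᶜ : Set (Fin n)))) :
    ∃ H : SimpleGraph (Fin (n - q)), IsPathExtremalGraph k H ∧
      Nonempty (G ≃g SimpleGraph.completeGraph (Fin q) ⊕g H) := by
  classical
  have hc : n = Nat.card s + Nat.card (sᶜ : Set (Fin n)) := by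
    have := Nat.card_congr (isoSum G s hs).toEquiv
    rw [Nat.card_sum] at this
    simpa using this
  have hc' : Fintype.card (sᶜ : Set (Fin n)) = n - q := by
    rw [← Nat.card_eq_fintype_card]
    omega
  set e := (G.induce sᶜ).overFinIso hc'
  obtain ⟨f⟩ := nonempty_iso_completeGraph htop hcard
  refine ⟨(G.induce sᶜ).overFin hc', isPathExtremalGraph_of_card_edgeSet hk hp (by omega) ?_ ?_,
    ⟨(isoSum G s hs).trans (SimpleGraph.Iso.sumCongr f e)⟩⟩
  · exact fun h => hG (h.of_hom e.symm.toHom e.symm.injective)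
  · rw [← card_edgeSet_congr e, he]
    congr 1
    omega

/-! ### The constructions: freeness and edge counts -/

theorem HasPath.exists_hom {G : SimpleGraph V} {K : ℕ} (h : HasPath G K) :
    ∃ f : SimpleGraph.pathGraph K →g G, Function.Injective f := by
  obtain ⟨l, hl, hlen⟩ := h
  refine ⟨⟨fun x => l[x.val]'(x.2.trans_le hlen), ?_⟩, ?_⟩
  · have key : ∀ i (hi : i + 1 < l.length), G.Adj l[i] l[i + 1] := fun i hi =>
      List.isChain_iff_getElem.1 hl.1 i hi
    intro x y hxy
    rcases SimpleGraph.pathGraph_adj.1 hxy with h | h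
    · have := key x.val (by omega)
      simpa only [h] using this
    · have := key y.val (by omega)
      simpa only [h] using this.symm
  · intro x y hxy
    have := (hl.2.getElem_inj_iff).1 hxy
    exact Fin.ext this

theorem hasPath_pathGraph (K : ℕ) : HasPath (SimpleGraph.pathGraph K) K := by
  refine ⟨List.finRange K, ⟨?_, List.nodup_finRange K⟩, by simp⟩
  rw [List.isChain_iff_getElem]
  intro i hi
  rw [SimpleGraph.pathGraph_adj]
  simp

theorem hasPath_of_copy {m : ℕ} {k : Fin m → ℕ} {G : SimpleGraph V}
    (h : (linearForest k).IsContained G) (j : Fin m) : HasPath G (k j) := by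
  obtain ⟨f⟩ := h
  refine (hasPath_pathGraph (k j)).of_hom
    ⟨fun x => f ⟨j, x⟩, fun {x y} hxy => f.toHom.map_adj ⟨j, x, y, hxy, rfl, rfl⟩⟩ ?_
  intro x y hxy
  simpa using f.injective hxy

theorem free_of_not_hasPath {m : ℕ} {k : Fin m → ℕ} {G : SimpleGraph V} (j : Fin m)
    (h : ¬ HasPath G (k j)) : (linearForest k).Free G :=
  fun hc => h (hasPath_of_copy hc j)

/-- Used with `φ` the index of a summand: the connected image of a path stays inside one summand of
a disjoint union. -/
theorem eq_of_pathGraph_hom {K : ℕ} {ι : Sort*} {G : SimpleGraph V} {φ : V → ι}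
    (hφ : ∀ u v, G.Adj u v → φ u = φ v) (f : SimpleGraph.pathGraph K →g G) (x y : Fin K) :
    φ (f x) = φ (f y) := by
  obtain ⟨p⟩ := SimpleGraph.pathGraph_preconnected K x y
  induction p with
  | nil => rfl
  | cons h _ ih => exact (hφ _ _ (f.map_adj h)).trans ih

theorem HasPath.of_disjointUnion {ι : Type*} {W : ι → Type*} {G : ∀ i, SimpleGraph (W i)} {K : ℕ}
    (hK : 0 < K) (h : HasPath (disjointUnion G) K) : ∃ i, HasPath (G i) K := by
  obtain ⟨f, hf⟩ := h.exists_hom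
  have h1 := eq_of_pathGraph_hom (φ := Sigma.fst) (fun u v => fst_eq_of_disjointUnion_adj) f
    ⟨0, hK⟩
  set i := (f ⟨0, hK⟩).1
  have h2 : ∀ x, ∃ a : W i, f x = ⟨i, a⟩ := by
    intro x
    have h3 := h1 x
    generalize f x = z at h3
    obtain ⟨j, a⟩ := z
    obtain rfl : i = j := h3
    exact ⟨a, rfl⟩
  choose g hg using h2
  refine ⟨i, (hasPath_pathGraph K).of_hom ⟨g, fun {x y} hxy => ?_⟩ ?_⟩
  · have := f.map_adj hxy
    rw [hg, hg] at this
    exact disjointUnion_adj_iff.1 this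
  · intro x y hxy
    apply hf
    rw [hg, hg]
    exact congrArg _ hxy

theorem isLeft_eq_of_adj {W : Type*} {A : SimpleGraph V} {B : SimpleGraph W} (u v : V ⊕ W)
    (h : (A ⊕g B).Adj u v) : u.isLeft = v.isLeft := by
  rcases u with u | u <;> rcases v with v | v <;> simp_all

theorem HasPath.of_sum_left {W : Type*} {A : SimpleGraph V} {B : SimpleGraph W} {K : ℕ}
    (f : SimpleGraph.pathGraph K →g A ⊕g B) (hf : Function.Injective f)
    (h : ∀ x, (f x).isLeft = true) : HasPath A K := by
  simp only [Sum.isLeft_iff] at h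
  choose g hg using h
  refine (hasPath_pathGraph K).of_hom ⟨g, fun {x y} hxy => ?_⟩ ?_
  · simpa [hg] using f.map_adj hxy
  · intro x y hxy
    apply hf
    rw [hg, hg]
    exact congrArg _ hxy

theorem HasPath.of_sum_right {W : Type*} {A : SimpleGraph V} {B : SimpleGraph W} {K : ℕ}
    (f : SimpleGraph.pathGraph K →g A ⊕g B) (hf : Function.Injective f)
    (h : ∀ x, (f x).isLeft = false) : HasPath B K := by
  simp only [Sum.isLeft_eq_false, Sum.isRight_iff] at h
  choose g hg using h
  refine (hasPath_pathGraph K).of_hom ⟨g, fun {x y} hxy => ?_⟩ ?_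
  · simpa [hg] using f.map_adj hxy
  · intro x y hxy
    apply hf
    rw [hg, hg]
    exact congrArg _ hxy

theorem HasPath.of_sum {W : Type*} {A : SimpleGraph V} {B : SimpleGraph W} {K : ℕ} (hK : 0 < K)
    (h : HasPath (A ⊕g B) K) : HasPath A K ∨ HasPath B K := by
  obtain ⟨f, hf⟩ := h.exists_hom
  have h1 := eq_of_pathGraph_hom (φ := Sum.isLeft) isLeft_eq_of_adj f
  rcases h2 : (f ⟨0, hK⟩).isLeft
  · exact Or.inr (HasPath.of_sum_right f hf fun x => (h1 _ _).trans h2)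
  · exact Or.inl (HasPath.of_sum_left f hf fun x => (h1 _ _).trans h2)

/-- A graph with fewer than `k 0 + … + k j` vertices together with a graph without a path on `k j`
vertices does not contain the linear forest. -/
theorem linearForest_free_sum {W : Type*} {A : SimpleGraph V} {B : SimpleGraph W} {m : ℕ}
    {k : Fin m → ℕ} (hk : Antitone k) (j : Fin m) [Finite V]
    (hA : Nat.card V < partialSum k j) (hB : ¬ HasPath B (k j)) :
    (linearForest k).Free (A ⊕g B) := by
  rintro ⟨f⟩
  -- The paths up to `j` have at least `k j` vertices, so none of them fits into `B`; all of them
  -- lie in `A`, which has too few vertices.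
  have key : ∀ i ≤ j, ∀ x : Fin (k i), (f ⟨i, x⟩).isLeft = true := by
    intro i hij x
    let g : SimpleGraph.pathGraph (k i) →g A ⊕g B :=
      ⟨fun x => f ⟨i, x⟩, fun {x y} hxy => f.toHom.map_adj ⟨i, x, y, hxy, rfl, rfl⟩⟩
    have h1 := eq_of_pathGraph_hom (φ := Sum.isLeft) isLeft_eq_of_adj g x
    by_contra hx
    refine hB (HasPath.mono (HasPath.of_sum_right g (fun a b hab => ?_) fun y => ?_) (hk hij))
    · simpa using f.injective hab
    · rw [← h1 y]
      exact Bool.eq_false_iff.2 hx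
  simp only [Sum.isLeft_iff] at key
  choose g hg using key
  have hinj : Function.Injective
      (fun z : Σ i : {i // i ≤ j}, Fin (k i) => g z.1.1 z.1.2 z.2) := by
    rintro ⟨⟨i, hi⟩, x⟩ ⟨⟨i', hi'⟩, x'⟩ hxx
    have h2 : f ⟨i, x⟩ = f ⟨i', x'⟩ := by
      rw [hg i hi, hg i' hi']
      exact congrArg _ hxx
    have h3 := f.injective h2
    obtain rfl : i = i' := congrArg Sigma.fst h3
    obtain rfl : x = x' := by simpa using h3
    rfl
  have h4 := Nat.card_le_card_of_injective _ hinj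
  rw [Nat.card_sigma] at h4
  simp only [Nat.card_eq_fintype_card, Fintype.card_fin] at h4
  have h5 : ∑ i : {i // i ≤ j}, k i = partialSum k j := by
    unfold partialSum
    exact (Finset.sum_subtype (Iic j) (by simp) k).symm
  rw [h5] at h4
  omega

/-- The clique of a clique join is a vertex cover, which bounds the linear forests. -/
theorem sum_half_le_of_isContained_cliqueJoinEmpty {m : ℕ} {k : Fin m → ℕ} {c q : ℕ}
    (h : (linearForest k).IsContained (cliqueJoinEmpty c q)) : ∑ i, k i / 2 ≤ c := by
  obtain ⟨f⟩ := h
  have key : ∀ i (x : Fin (k i / 2)), ∃ (y : Fin (k i)) (a : Fin c), y.val / 2 = x.val ∧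
      f ⟨i, y⟩ = Sum.inl a := by
    intro i x
    have hx := x.2
    -- The vertices `2x` and `2x + 1` of a path are adjacent, so one of them is mapped into the
    -- clique. These pairs are disjoint.
    let y : Fin (k i) := ⟨2 * x.val, by omega⟩
    let z : Fin (k i) := ⟨2 * x.val + 1, by omega⟩
    have hadj : (cliqueJoinEmpty c q).Adj (f ⟨i, y⟩) (f ⟨i, z⟩) :=
      f.toHom.map_adj ⟨i, y, z, SimpleGraph.pathGraph_adj.2 (Or.inl rfl), rfl, rfl⟩
    rcases hy : f ⟨i, y⟩ with a | a
    · exact ⟨y, a, by simp [y], hy⟩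
    · rcases hz : f ⟨i, z⟩ with b | b
      · exact ⟨z, b, by simp only [z]; omega, hz⟩
      · rw [hy, hz] at hadj
        simp [cliqueJoinEmpty, join] at hadj
  choose y a hy ha using key
  have hinj : Function.Injective (fun z : Σ i, Fin (k i / 2) => a z.1 z.2) := by
    rintro ⟨i, x⟩ ⟨i', x'⟩ hxx
    have h2 : f ⟨i, y i x⟩ = f ⟨i', y i' x'⟩ := by
      rw [ha, ha]
      exact congrArg _ hxx
    have h3 := f.injective h2
    obtain rfl : i = i' := congrArg Sigma.fst h3
    have h4 : y i x = y i x' := by simpa using h3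
    have h5 : x = x' := by
      apply Fin.ext
      rw [← hy, ← hy, h4]
    rw [h5]
  have h4 := Fintype.card_le_of_injective _ hinj
  simpa using h4

theorem HasPath.linearForest_isContained {G : SimpleGraph V} {K : ℕ} (h : HasPath G K) :
    (linearForest fun _ : Fin 1 => K).IsContained G := by
  obtain ⟨l, hl, hlen⟩ := h
  exact linearForest_isContained_of_packing (fun _ => ()) (fun _ => l) (fun _ => hl)
    (fun _ _ _ _ _ => rfl) (fun D => by simpa using hlen)

theorem not_hasPath_cliqueJoinEmpty {c q K : ℕ} (h : c < K / 2) :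
    ¬ HasPath (cliqueJoinEmpty c q) K := by
  intro hp
  have := sum_half_le_of_isContained_cliqueJoinEmpty hp.linearForest_isContained
  simp at this
  omega

/-- Rounding down loses one half per odd term, and there is at most one such term. -/
theorem sum_half {m : ℕ} {k : Fin m → ℕ} (hodd : ∀ i j, Odd (k i) → Odd (k j) → i = j) :
    ∑ i, k i / 2 = (∑ i, k i) / 2 := by
  have h1 : ∑ i, k i = 2 * ∑ i, k i / 2 + ∑ i, k i % 2 := by
    rw [mul_sum, ← sum_add_distrib]
    exact sum_congr rfl fun i _ => by omega
  have h2 : ∑ i, k i % 2 ≤ 1 := by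
    by_cases h : ∃ i, Odd (k i)
    · obtain ⟨i, hi⟩ := h
      rw [sum_eq_single_of_mem i (mem_univ i)]
      · omega
      · intro j _ hj
        have : ¬ Odd (k j) := fun h => hj (hodd j i h hi)
        rw [Nat.odd_iff] at this
        omega
    · push Not at h
      rw [sum_eq_zero]
      · omega
      · intro j _
        have := h j
        rw [Nat.odd_iff] at this
        omega
  omega

theorem card_edgeSet_completeGraph (q : ℕ) :
    Nat.card (SimpleGraph.completeGraph (Fin q)).edgeSet = q.choose 2 := by
  classical
  have := SimpleGraph.card_edgeFinset_top_eq_card_choose_two (V := Fin q)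
  rw [Fintype.card_fin] at this
  rw [← this, Nat.card_eq_fintype_card, ← SimpleGraph.edgeFinset_card]

theorem card_edgeSet_cliques (t q : ℕ) : Nat.card (cliques t q).edgeSet = t * q.choose 2 := by
  unfold cliques
  rw [card_edgeSet_disjointUnion, sum_congr rfl fun i _ => card_edgeSet_completeGraph q]
  simp

theorem card_edgeSet_cliqueJoinEmpty (c q : ℕ) :
    Nat.card (cliqueJoinEmpty c q).edgeSet = joinEdges c (c + q) := by
  classical
  refine Nat.eq_of_mul_eq_mul_left two_pos ?_
  rw [two_mul_card_edgeSet]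
  unfold adjPairs
  rw [Fintype.sum_sum_type]
  have h1 : ∀ a : Fin c, #(univ.filter ((cliqueJoinEmpty c q).Adj (Sum.inl a))) = c - 1 + q := by
    intro a
    have : univ.filter ((cliqueJoinEmpty c q).Adj (Sum.inl a)) = univ.erase (Sum.inl a) := by
      ext z
      rw [mem_filter, mem_erase]
      rcases z with z | z
      · simp [cliqueJoinEmpty, join, ne_comm]
      · simp [cliqueJoinEmpty, join]
    rw [this, card_erase_of_mem (mem_univ _)]
    have := a.2
    rw [card_univ, Fintype.card_sum, Fintype.card_fin, Fintype.card_fin]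
    omega
  have h2 : ∀ b : Fin q, #(univ.filter ((cliqueJoinEmpty c q).Adj (Sum.inr b))) = c := by
    intro b
    have : univ.filter ((cliqueJoinEmpty c q).Adj (Sum.inr b)) =
        univ.map Function.Embedding.inl := by
      ext z
      rw [mem_filter]
      rcases z with z | z <;> simp [cliqueJoinEmpty, join]
    rw [this]
    simp
  rw [sum_congr rfl fun a _ => h1 a, sum_congr rfl fun a _ => h2 a]
  have h3 := two_mul_choose_two c
  simp only [sum_const, card_univ, Fintype.card_fin, smul_eq_mul]
  unfold joinEdges
  rw [Nat.add_sub_cancel_left]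
  rcases c with _ | c
  · simp
  · rw [Nat.add_sub_cancel]
    nlinarith

theorem pathEdges_mul_add {k t r : ℕ} (hr : r < k - 1) :
    pathEdges k ((k - 1) * t + r) = t * (k - 1).choose 2 + r.choose 2 := by
  unfold pathEdges
  rw [Nat.mul_add_div (by omega), Nat.mul_add_mod, Nat.div_eq_of_lt hr, Nat.mod_eq_of_lt hr,
    Nat.add_zero]

/-- The join has `(s + 1) * (k - 1) + r` vertices. For the two middle residues it ties with disjoint
cliques, which is why the additional extremal graphs occur. -/
theorem joinEdges_eq_pathEdges {k s r : ℕ} (hk : 4 ≤ k) (hp : k % 2 = 0)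
    (hr : r = k / 2 ∨ r = (k - 2) / 2) :
    joinEdges ((k - 2) / 2) ((k - 2) / 2 + (k / 2 + s * (k - 1) + r)) =
      (s + 1) * (k - 1).choose 2 + r.choose 2 := by
  obtain ⟨c, rfl⟩ : ∃ c, k = 2 * c + 2 := ⟨k / 2 - 1, by omega⟩
  have h1 : (2 * c + 2 - 2) / 2 = c := by omega
  have h2 : (2 * c + 2) / 2 = c + 1 := by omega
  have h3 : 2 * c + 2 - 1 = 2 * c + 1 := by omega
  rw [h1, h2, h3]
  rw [h1, h2] at hr
  unfold joinEdges
  rw [Nat.add_sub_cancel_left]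
  have h4 := two_mul_choose_two c
  have h5 := two_mul_choose_two (2 * c + 1)
  have h6 := two_mul_choose_two r
  have h7 : (2 * c + 1).choose 2 = (2 * c + 1) * c := by nlinarith
  rw [h7]
  refine Nat.eq_of_mul_eq_mul_left two_pos ?_
  rcases hr with rfl | rfl <;> nlinarith

theorem not_hasPath_cliques_sum {k t r : ℕ} (hk : 3 ≤ k) (hr : r < k - 1) :
    ¬ HasPath (cliques t (k - 1) ⊕g SimpleGraph.completeGraph (Fin r)) k := by
  intro h
  rcases h.of_sum (by omega) with h | h
  · obtain ⟨i, hi⟩ := HasPath.of_disjointUnion (by omega) h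
    have := hi.le_card
    rw [Fintype.card_fin] at this
    omega
  · have := h.le_card
    rw [Fintype.card_fin] at this
    omega

theorem HasPath.iso {W : Type*} {G : SimpleGraph V} {H : SimpleGraph W} {K : ℕ} (h : HasPath G K)
    (e : G ≃g H) : HasPath H K :=
  h.of_hom e.toHom e.injective

theorem IsPathExtremalGraph.card_edgeSet {k N : ℕ} {G : SimpleGraph (Fin N)} (hk : 4 ≤ k)
    (hp : k % 2 = 0) (hG : IsPathExtremalGraph k G) : Nat.card G.edgeSet = pathEdges k N := by
  obtain ⟨t, r, rfl, hr, ⟨⟨e⟩⟩ | ⟨hr', s, hs, ⟨e⟩⟩⟩ := hG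
  · rw [card_edgeSet_congr e, card_edgeSet_sum, card_edgeSet_cliques, card_edgeSet_completeGraph,
      pathEdges_mul_add hr]
  · rw [card_edgeSet_congr e, card_edgeSet_sum, card_edgeSet_cliques, card_edgeSet_cliqueJoinEmpty,
      joinEdges_eq_pathEdges hk hp hr', pathEdges_mul_add hr, ← add_assoc, ← add_mul]
    congr 2
    omega

theorem IsPathExtremalGraph.not_hasPath {k N : ℕ} {G : SimpleGraph (Fin N)} (hk : 4 ≤ k)
    (hp : k % 2 = 0) (hG : IsPathExtremalGraph k G) : ¬ HasPath G k := by
  obtain ⟨t, r, rfl, hr, ⟨⟨e⟩⟩ | ⟨hr', s, hs, ⟨e⟩⟩⟩ := hG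
  · exact fun h => not_hasPath_cliques_sum (by omega) hr (h.iso e)
  · intro h
    rcases (h.iso e).of_sum (by omega) with h | h
    · obtain ⟨i, hi⟩ := HasPath.of_disjointUnion (by omega) h
      have := hi.le_card
      rw [Fintype.card_fin] at this
      omega
    · exact not_hasPath_cliqueJoinEmpty (by omega) h

theorem cliqueBound_eq_add_pathEdges {n S k : ℕ} (h : S ≤ n) (hS : 0 < S) :
    cliqueBound n S k = (S - 1).choose 2 + pathEdges k (n - (S - 1)) := by
  unfold cliqueBound pathEdges
  rw [if_neg (by omega), add_assoc]

theorem joinBound_eq_joinEdges {n S : ℕ} (h : S ≤ n) (hS : 2 ≤ S) :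
    joinBound n S = joinEdges (S / 2 - 1) n := by
  unfold joinBound joinEdges
  have h1 : (S - 2) / 2 = S / 2 - 1 := by omega
  have h2 : n - S / 2 + 1 = n - (S / 2 - 1) := by omega
  rw [h1, h2]

theorem card_edgeSet_le_extremalNumber {n : ℕ} [Finite V] {W : Type*} {G : SimpleGraph V}
    {H : SimpleGraph W} (hV : Nat.card V = n) (h : H.Free G) :
    Nat.card G.edgeSet ≤ SimpleGraph.extremalNumber n H := by
  classical
  have := Fintype.ofFinite V
  have h1 := SimpleGraph.card_edgeFinset_le_extremalNumber h
  rw [← Nat.card_eq_fintype_card, hV, SimpleGraph.edgeFinset_card] at h1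
  rwa [Nat.card_eq_fintype_card]

theorem partialSum_eq {m : ℕ} (k : Fin m → ℕ) (j : Fin m) :
    partialSum k j = ∑ i ∈ Iio j, k i + k j := by
  unfold partialSum
  rw [← Iio_insert, sum_insert (by simp), add_comm]

theorem partialSum_le {m : ℕ} (k : Fin m → ℕ) (j : Fin m) : partialSum k j ≤ ∑ i, k i :=
  sum_le_sum_of_subset (subset_univ _)

theorem cliqueBound_le_extremalNumber {m : ℕ} {k : Fin m → ℕ} (hk : Antitone k)
    (hk3 : ∀ i, 3 ≤ k i) {n : ℕ} (hn : ∑ i, k i ≤ n) (j : Fin m) :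
    cliqueBound n (partialSum k j) (k j) ≤ SimpleGraph.extremalNumber n (linearForest k) := by
  have h1 := partialSum_eq k j
  have h2 := partialSum_le k j
  have h3 := hk3 j
  set N := n - (partialSum k j - 1)
  have hr : N % (k j - 1) < k j - 1 := Nat.mod_lt _ (by omega)
  have hN := Nat.div_add_mod N (k j - 1)
  have hfree := linearForest_free_sum
    (A := SimpleGraph.completeGraph (Fin (partialSum k j - 1))) hk j (by simp; omega)
    (not_hasPath_cliques_sum (t := N / (k j - 1)) h3 hr)
  refine le_trans (le_of_eq ?_) (card_edgeSet_le_extremalNumber ?_ hfree)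
  · rw [card_edgeSet_sum, card_edgeSet_sum, card_edgeSet_cliques, card_edgeSet_completeGraph,
      card_edgeSet_completeGraph, ← pathEdges_mul_add hr, hN,
      cliqueBound_eq_add_pathEdges (by omega) (by omega)]
  · rw [Nat.card_eq_fintype_card, Fintype.card_sum, Fintype.card_sum, Fintype.card_sigma]
    simp only [Fintype.card_fin, sum_const, card_univ, smul_eq_mul]
    rw [mul_comm _ (k j - 1), hN]
    omega

theorem cliqueJoinEmpty_free {m : ℕ} {k : Fin m → ℕ}
    (hodd : ∀ i j, Odd (k i) → Odd (k j) → i = j) (h2 : 2 ≤ ∑ i, k i) (q : ℕ) :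
    (linearForest k).Free (cliqueJoinEmpty ((∑ i, k i) / 2 - 1) q) := by
  intro h
  have := sum_half_le_of_isContained_cliqueJoinEmpty h
  rw [sum_half hodd] at this
  omega

theorem joinBound_le_extremalNumber {m : ℕ} {k : Fin m → ℕ}
    (hodd : ∀ i j, Odd (k i) → Odd (k j) → i = j) (h2 : 2 ≤ ∑ i, k i) {n : ℕ}
    (hn : ∑ i, k i ≤ n) :
    joinBound n (∑ i, k i) ≤ SimpleGraph.extremalNumber n (linearForest k) := by
  refine le_trans (le_of_eq ?_) (card_edgeSet_le_extremalNumber ?_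
    (cliqueJoinEmpty_free hodd h2 (n - ((∑ i, k i) / 2 - 1))))
  · rw [card_edgeSet_cliqueJoinEmpty, joinBound_eq_joinEdges hn h2]
    congr 1
    omega
  · simp
    omega

theorem pathsBound_le_extremalNumber {m : ℕ} {k : Fin m → ℕ} (hk : Antitone k)
    (hk3 : ∀ i, 3 ≤ k i) (hodd : ∀ i j, Odd (k i) → Odd (k j) → i = j)
    (h2 : 2 ≤ ∑ i, k i) {n : ℕ} (hn : ∑ i, k i ≤ n) :
    pathsBound n k ≤ SimpleGraph.extremalNumber n (linearForest k) :=
  max_le (Finset.sup_le fun j _ => cliqueBound_le_extremalNumber hk hk3 hn j)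
    (joinBound_le_extremalNumber hodd h2 hn)

/-! ### The exceptional odd case and the upper bound -/

/-- A complete bipartite graph together with an edge joined to the smaller side contains the linear
forests with one odd path and at least one even path. -/
theorem linearForest_isContained_of_join_edge {m : ℕ} {k : Fin m → ℕ} {G : SimpleGraph V} {h q : ℕ}
    {C I : Finset V} {a b : V} (hC : #C = h) (hI : h + 1 ≤ #I) (hCI : Disjoint C I) (haC : a ∉ C)
    (hbC : b ∉ C) (haI : a ∉ I) (hbI : b ∉ I) (hab : G.Adj a b)
    (hadj : ∀ c ∈ C, G.Adj c a ∧ G.Adj c b ∧ ∀ i ∈ I, G.Adj c i) (j : Fin m)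
    (hj : k j = 2 * q + 2) (hs : ∑ i, k i = 2 * h + 3) (hjs : q ≤ h) :
    (linearForest k).IsContained G := by
  classical
  -- The `q` vertices of `C₂` carry an alternating path from `b`, which with `a` in front has `2q +
  -- 2` vertices. The remaining `h - q` vertices of `C` carry one on `2(h - q) + 1` vertices,
  -- exactly enough for all other paths in a row.
  obtain ⟨C₂, hC₂, hC₂c⟩ := exists_subset_card_eq (hC ▸ hjs : q ≤ #C)
  obtain ⟨I₂, hI₂, hI₂c⟩ := exists_subset_card_eq (by omega : q ≤ #I)
  have hC₁ : #(C \ C₂) = h - q := by rw [card_sdiff_of_subset hC₂, hC, hC₂c]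
  have hI₁ : h - q + 1 ≤ #(I \ I₂) := by
    rw [card_sdiff_of_subset hI₂, hI₂c]
    omega
  obtain ⟨i, hi⟩ : (I \ I₂).Nonempty := card_pos.1 (by omega)
  obtain ⟨l₁, hl₁, hsub₁, hlen₁⟩ := exists_alternating_path (G := G) (C := C \ C₂) (I := I \ I₂)
    (hCI.mono sdiff_subset sdiff_subset)
    (fun c hc i hi => (hadj c (sdiff_subset hc)).2.2 i (sdiff_subset hi)) (by omega) hi
  have hbC₂ : b ∉ C₂ := fun h => hbC (hC₂ h)
  have hbI₂ : b ∉ I₂ := fun h => hbI (hI₂ h)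
  obtain ⟨l₂, hl₂, hsub₂, hlen₂⟩ := exists_alternating_path (G := G) (C := C₂) (I := insert b I₂)
    (disjoint_insert_right.2 ⟨hbC₂, hCI.mono hC₂ hI₂⟩)
    (fun c hc i hi => by
      rcases mem_insert.1 hi with rfl | hi
      · exact (hadj c (hC₂ hc)).2.1
      · exact (hadj c (hC₂ hc)).2.2 i (hI₂ hi))
    (by rw [card_insert_of_notMem hbI₂]; omega) (mem_insert_self b I₂)
  have hm₁ : ∀ v ∈ i :: l₁, v ∈ C \ C₂ ∨ v ∈ I \ I₂ := by
    intro v hv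
    rcases List.mem_cons.1 hv with rfl | hv
    · exact Or.inr hi
    · exact hsub₁ v hv
  have hm₂ : ∀ v ∈ b :: l₂, v ∈ C₂ ∨ v = b ∨ v ∈ I₂ := by
    intro v hv
    rcases List.mem_cons.1 hv with rfl | hv
    · exact Or.inr (Or.inl rfl)
    · simpa using hsub₂ v hv
  have ha₂ : a ∉ b :: l₂ := by
    intro h
    rcases hm₂ a h with h | h | h
    · exact haC (hC₂ h)
    · exact hab.ne h
    · exact haI (hI₂ h)
  have hdisj : ∀ v ∈ i :: l₁, v ∉ a :: b :: l₂ := by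
    intro v hv₁ hv₂
    have h1 := hm₁ v hv₁
    rw [mem_sdiff, mem_sdiff] at h1
    rcases List.mem_cons.1 hv₂ with rfl | hv₂
    · tauto
    · rcases hm₂ v hv₂ with h2 | rfl | h2
      · rcases h1 with h1 | h1
        · exact h1.2 h2
        · exact disjoint_left.1 hCI (hC₂ h2) h1.1
      · tauto
      · rcases h1 with h1 | h1
        · exact disjoint_left.1 hCI h1.1 (hI₂ h2)
        · exact h1.2 h2
  refine linearForest_isContained_of_packing (fun i => decide (i = j))
    (fun x => if x = true then a :: b :: l₂ else i :: l₁) ?_ ?_ ?_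
  · rintro (_ | _)
    · exact hl₁
    · exact ⟨List.isChain_cons_cons.2 ⟨hab, hl₂.1⟩, List.nodup_cons.2 ⟨ha₂, hl₂.2⟩⟩
  · rintro (_ | _) (_ | _) v h1 h2
    · rfl
    · exact absurd h2 (hdisj v h1)
    · exact absurd h1 (hdisj v h2)
    · rfl
  · have h1 : ∑ i with i = j, k i = k j := by simp [filter_eq']
    have h2 := sum_filter_add_sum_filter_not univ (fun i => i = j) k
    rintro (_ | _)
    · simp only [decide_eq_false_iff_not, Bool.false_eq_true, if_false, List.length_cons]
      omega
    · simp only [decide_eq_true_eq, if_true, List.length_cons]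
      omega

theorem exists_even_of_odd_sum {m : ℕ} {k : Fin m → ℕ}
    (hodd : ∀ i j, Odd (k i) → Odd (k j) → i = j) {i₀ : Fin m} (i₁ : Fin m) (h : i₀ ≠ i₁) :
    ∃ j, k j % 2 = 0 := by
  by_contra hcon
  push Not at hcon
  exact h (hodd i₀ i₁ (Nat.odd_iff.2 (by have := hcon i₀; omega))
    (Nat.odd_iff.2 (by have := hcon i₁; omega)))

theorem joinEdges_strictMono {h h' n : ℕ} (hlt : h < h') (hn : h' + 1 < n) :
    joinEdges h n < joinEdges h' n := by
  have h1 := two_mul_joinEdges (by omega : h ≤ n)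
  have h2 := two_mul_joinEdges (by omega : h' ≤ n)
  obtain ⟨d, rfl⟩ := Nat.exists_eq_add_of_lt hlt
  obtain ⟨e, rfl⟩ := Nat.exists_eq_add_of_lt hn
  nlinarith [Nat.zero_le (d * d), Nat.zero_le (d * h), Nat.zero_le (d * e)]

theorem joinEdges_mono {h h' n : ℕ} (hle : h ≤ h') (hn : h' + 1 < n) :
    joinEdges h n ≤ joinEdges h' n := by
  rcases hle.eq_or_lt with rfl | hlt
  · exact le_rfl
  · exact (joinEdges_strictMono hlt hn).le

theorem partialSum_lt {m : ℕ} {k : Fin m → ℕ} {j i : Fin m} (hji : j < i) :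
    partialSum k j + k i ≤ ∑ i, k i := by
  unfold partialSum
  rw [add_comm, ← sum_insert (by simp [hji] : i ∉ Iic j)]
  exact sum_le_sum_of_subset (subset_univ _)

theorem partialSum_eq_of_last {m : ℕ} {k : Fin m → ℕ} {j : Fin m} (hj : ∀ i, ¬ j < i) :
    partialSum k j = ∑ i, k i := by
  unfold partialSum
  congr 1
  ext i
  simpa using hj i

theorem cliqueBound_le_pathsBound {m : ℕ} (n : ℕ) (k : Fin m → ℕ) (j : Fin m) :
    cliqueBound n (partialSum k j) (k j) ≤ pathsBound n k :=
  (Finset.le_sup (f := fun j => cliqueBound n (partialSum k j) (k j)) (mem_univ j)).trans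
    (le_max_left _ _)

theorem joinBound_le_pathsBound {m : ℕ} (n : ℕ) (k : Fin m → ℕ) :
    joinBound n (∑ i, k i) ≤ pathsBound n k :=
  le_max_right _ _

theorem sum_Iio_eq_zero_or_le {m : ℕ} {k : Fin m → ℕ} (hk : Antitone k) (j : Fin m) :
    ∑ i ∈ Iio j, k i = 0 ∨ k j ≤ ∑ i ∈ Iio j, k i := by
  rcases (Iio j).eq_empty_or_nonempty with h | ⟨i, hi⟩
  · left
    rw [h, sum_empty]
  · right
    exact (hk (mem_Iio.1 hi).le).trans (single_le_sum (fun _ _ => Nat.zero_le _) hi)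

/-- The strict inequality before the last index is what absorbs the extra edge of an odd connected
graph, and what excludes clique joins on shorter partial sums from being extremal. -/
theorem joinEdges_partialSum_le {m : ℕ} {k : Fin m → ℕ} (hk3 : ∀ i, 3 ≤ k i) {n : ℕ}
    (hn : ∑ i, k i ≤ n) (j : Fin m) :
    joinEdges (partialSum k j / 2 - 1) n ≤ joinBound n (∑ i, k i) ∧
      ((∃ i, j < i) → joinEdges (partialSum k j / 2 - 1) n < joinBound n (∑ i, k i)) := by
  have h1 := partialSum_le k j
  have h2 := partialSum_eq k j
  have h3 := hk3 j
  rw [joinBound_eq_joinEdges hn (by omega)]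
  refine ⟨joinEdges_mono (by omega) (by omega), ?_⟩
  rintro ⟨i, hi⟩
  have h4 := partialSum_lt (k := k) hi
  have h5 := hk3 i
  exact joinEdges_strictMono (by omega) (by omega)

theorem mainBound_le_pathsBound {m : ℕ} {k : Fin m → ℕ} (hk3 : ∀ i, 3 ≤ k i) {n : ℕ}
    (hn : ∑ i, k i ≤ n) (j : Fin m) :
    mainBound (k j) n (∑ i ∈ Iio j, k i) ≤ pathsBound n k := by
  have h1 := (joinEdges_partialSum_le hk3 hn j).1
  have h2 := cliqueBound_le_pathsBound n k j
  have h3 := joinBound_le_pathsBound n k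
  rw [partialSum_eq] at h1 h2
  refine max_le h2 ?_
  split_ifs <;> omega

/-- The upper bound for the number of edges of a graph without the linear forest. -/
theorem card_edgeSet_le_of_free {m : ℕ} {k : Fin m → ℕ} (hk : Antitone k) (hk3 : ∀ i, 3 ≤ k i)
    (hodd : ∀ i j, Odd (k i) → Odd (k j) → i = j) {n : ℕ} (hn : ∑ i, k i ≤ n) (hm : 0 < m)
    {G : SimpleGraph (Fin n)} (hG : (linearForest k).Free G) :
    Nat.card G.edgeSet ≤ pathsBound n k := by
  classical
  have h0 := single_le_sum (f := k) (fun _ _ => Nat.zero_le _) (mem_univ ⟨0, hm⟩)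
  have h0' := hk3 ⟨0, hm⟩
  have : Nonempty (Fin n) := ⟨⟨0, by omega⟩⟩
  obtain ⟨j, c, hcs, hc⟩ := exists_component_weights hk hG
  have hmain := mainBound_le_pathsBound hk3 hn j
  have hj := partialSum_eq k j
  have hjn := partialSum_le k j
  have hj3 := hk3 j
  rcases card_edgeSet_le_mainBound_or_connected hj3 hc with h | ⟨hconn, hnp, hle⟩
  · rw [Fintype.card_fin, hcs] at h
    exact h.trans hmain
  · rw [Fintype.card_fin] at hle
    rw [hcs] at hnp hle
    have hc0 := sum_Iio_eq_zero_or_le hk j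
    set s := ∑ i ∈ Iio j, k i
    by_contra hcon
    rw [not_le] at hcon
    -- For even `s + k j` there is no extra edge and `componentBound` equals `mainBound`. For `s =
    -- 0` the two coincide as well.
    by_cases hpar : (s + k j) % 2 = 0
    · unfold componentBound at hle
      unfold mainBound at hmain
      rw [hpar, Nat.add_zero] at hle
      omega
    · rcases Nat.eq_zero_or_pos s with hs0 | hs0
      · rw [hs0, componentBound_zero hj3, ← mainBound_zero hj3] at hle
        rw [hs0] at hmain
        omega
      · by_cases hlast : ∃ i, j < i
        · have h1 := (joinEdges_partialSum_le hk3 hn j).2 hlast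
          have h2 := cliqueBound_le_pathsBound n k j
          have h3 := joinBound_le_pathsBound n k
          rw [hj] at h1 h2
          unfold componentBound at hle
          split_ifs at hle <;> omega
        -- Now the forest has an odd number `2 * h + 3` of vertices, and `G` exceeds `mainBound`, so
        -- `G` contains the join with an edge. There are at least two paths and at most one is odd,
        -- so an even one exists and the forest embeds.
        · have hj' := partialSum_eq_of_last (k := k) (by simpa using hlast)
          obtain ⟨h, hh⟩ : ∃ h, s + k j = 2 * h + 3 := ⟨(s + k j - 3) / 2, by omega⟩
          have hkj := hc0.resolve_left (by omega)
          obtain ⟨C, I, a, b, hC, hI, hCI, haC, hbC, haI, hbI, hab, hadj⟩ :=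
            exists_join_edge_of_lt_card_edgeSet hj3 hc0 (by omega : 1 ≤ h) hh hconn hnp
              (by rw [Fintype.card_fin]; omega)
              (by rw [Fintype.card_fin]; omega)
          obtain ⟨i, hi⟩ : (Iio j).Nonempty := by
            by_contra hne
            rw [not_nonempty_iff_eq_empty] at hne
            have : s = 0 := by
              change ∑ i ∈ Iio j, k i = 0
              rw [hne, sum_empty]
            omega
          have hij := (mem_Iio.1 hi).ne
          have hbig : ∀ x, k x + 3 ≤ ∑ i, k i := by
            intro x
            obtain ⟨y, hy⟩ : ∃ y, y ≠ x := by
              by_cases hx : x = i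
              · exact ⟨j, hx ▸ hij.symm⟩
              · exact ⟨i, fun h => hx h.symm⟩
            have h1 := sum_le_sum_of_subset (f := k) (subset_univ ({x, y} : Finset (Fin m)))
            rw [sum_pair hy.symm] at h1
            have := hk3 y
            omega
          obtain ⟨x, hx⟩ := exists_even_of_odd_sum hodd j hij
          have hx3 := hk3 x
          have hxb := hbig x
          exact hG (linearForest_isContained_of_join_edge (q := k x / 2 - 1) hC hI hCI haC hbC haI
            hbI hab hadj x (by omega) (by omega) (by omega))

/-! ### The extremal number and the extremal graphs -/

theorem HasPath.exists_component {G : SimpleGraph V} {K : ℕ} (hK : 0 < K) (h : HasPath G K) :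
    ∃ D : G.ConnectedComponent, HasPath D.toSimpleGraph K := by
  obtain ⟨l, hl, hlen⟩ := h
  obtain ⟨D, hD⟩ := exists_component_of_isChain hl.1 (by
    rintro rfl
    simp at hlen
    omega)
  exact ⟨D, (hasPath_induce hl hD).mono hlen⟩

theorem partialSum_zero {m : ℕ} (hm : 0 < m) (k : Fin m → ℕ) :
    partialSum k ⟨0, hm⟩ = k ⟨0, hm⟩ := by
  rw [partialSum_eq, add_eq_right]
  refine sum_eq_zero fun i hi => absurd (mem_Iio.1 hi) ?_
  rw [Fin.lt_def]
  exact Nat.not_lt_zero _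

theorem extremalNumber_linearForest {m : ℕ} (hm : 0 < m) {k : Fin m → ℕ} (hk : Antitone k)
    (hk3 : ∀ i, 3 ≤ k i) (hodd : ∀ i j, Odd (k i) → Odd (k j) → i = j) {n : ℕ}
    (hn : ∑ i, k i ≤ n) :
    SimpleGraph.extremalNumber n (linearForest k) = pathsBound n k := by
  have h0 := single_le_sum (f := k) (fun _ _ => Nat.zero_le _) (mem_univ ⟨0, hm⟩)
  have h0' := hk3 ⟨0, hm⟩
  refine le_antisymm ?_ (pathsBound_le_extremalNumber hk hk3 hodd (by omega) hn)
  have := SimpleGraph.extremalNumber_le_iff (V := Fin n) (linearForest k) (pathsBound n k)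
  rw [Fintype.card_fin] at this
  refine this.2 fun G _ hG => ?_
  have h1 := card_edgeSet_le_of_free hk hk3 hodd hn hm hG
  rwa [Nat.card_eq_fintype_card, ← SimpleGraph.edgeFinset_card] at h1

/-- The structure of the extremal graphs if all paths have an even number of vertices. -/
theorem structure_of_card_edgeSet_eq_pathsBound {m : ℕ} (hm : 0 < m) {k : Fin m → ℕ}
    (hk : Antitone k) (hk3 : ∀ i, 3 ≤ k i) (heven : ∀ i, Even (k i)) {n : ℕ}
    (hn : ∑ i, k i ≤ n) {G : SimpleGraph (Fin n)} (hG : (linearForest k).Free G)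
    (he : Nat.card G.edgeSet = pathsBound n k) :
    (cliqueBound n (k ⟨0, hm⟩) (k ⟨0, hm⟩) = pathsBound n k ∧
        IsPathExtremalGraph (k ⟨0, hm⟩) G) ∨
      (∃ j : Fin m, 0 < j.val ∧ cliqueBound n (partialSum k j) (k j) = pathsBound n k ∧
        ∃ H : SimpleGraph (Fin (n - (partialSum k j - 1))), IsPathExtremalGraph (k j) H ∧
          Nonempty (G ≃g SimpleGraph.completeGraph (Fin (partialSum k j - 1)) ⊕g H)) ∨
      (joinBound n (∑ i, k i) = pathsBound n k ∧
        Nonempty (G ≃g cliqueJoinEmpty ((∑ i, k i) / 2 - 1) (n - ((∑ i, k i) / 2 - 1)))) := by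
  classical
  have h0 := single_le_sum (f := k) (fun _ _ => Nat.zero_le _) (mem_univ ⟨0, hm⟩)
  have h0' := hk3 ⟨0, hm⟩
  have : Nonempty (Fin n) := ⟨⟨0, by omega⟩⟩
  obtain ⟨j, c, hcs, hc⟩ := exists_component_weights hk hG
  have hj := partialSum_eq k j
  have hjn := partialSum_le k j
  have hp : k j % 2 = 0 := Nat.even_iff.1 (heven j)
  have hj4 : 4 ≤ k j := by
    have := hk3 j
    omega
  have hcb := cliqueBound_le_pathsBound n k j
  have hjb := joinBound_le_pathsBound n k
  -- If the packing already fails at the first path, all weights vanish and `G` has no path on `k 0`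
  -- vertices, so `G` is extremal for that single path.
  rcases Nat.eq_zero_or_pos j.val with hj0 | hj0
  · obtain rfl : j = ⟨0, hm⟩ := Fin.ext hj0
    left
    have hps := partialSum_zero hm k
    have hc0 := hcs.trans (by omega : ∑ i ∈ Iio (⟨0, hm⟩ : Fin m), k i = 0)
    have hnp : ¬ HasPath G (k ⟨0, hm⟩) := by
      intro h
      obtain ⟨D, hD⟩ := h.exists_component (by omega)
      refine (hc D).1 ?_
      rwa [sum_eq_zero_iff.1 hc0 D (@mem_univ _ (_) D), Nat.zero_add]
    have h1 := card_edgeSet_le_pathEdges_card (by omega) hnp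
    have h2 := cliqueBound_zero (k ⟨0, hm⟩) n
    rw [Fintype.card_fin] at h1
    rw [Nat.zero_add] at h2
    rw [hps] at hcb
    exact ⟨by omega, isPathExtremalGraph_of_card_edgeSet hj4 hp (by omega) hnp (by omega)⟩
  · right
    have hs0 : 0 < ∑ i ∈ Iio j, k i :=
      (h0'.trans (single_le_sum (f := k) (fun _ _ => Nat.zero_le _)
        (mem_Iio.2 (Fin.lt_def.2 hj0) : (⟨0, hm⟩ : Fin m) ∈ Iio j))).trans_lt' (by omega)
    have hev : (∑ i ∈ Iio j, k i) % 2 = 0 :=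
      Nat.even_iff.1 (even_sum _ fun i _ => heven i)
    have hmain := mainBound_le_pathsBound hk3 hn j
    have hstr := structure_of_card_edgeSet_eq_mainBound hj4 hc (by omega) (by omega)
      (by rw [Fintype.card_fin]; omega) (by rw [Fintype.card_fin, hcs]; omega)
    rw [hcs, ← hj, Fintype.card_fin] at hstr
    rcases hstr with ⟨hcj, hce⟩ | ⟨s, hcut, hcard, htop, hnp, hse, hce⟩
    · right
      have h1 := joinEdges_partialSum_le hk3 hn j
      -- A clique join for an index before the last has strictly fewer edges than the join bound for
      -- the whole sum.
      have h2 : partialSum k j = ∑ i, k i := partialSum_eq_of_last fun i hi => by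
        have := h1.2 ⟨i, hi⟩
        omega
      rw [h2] at h1 hce hcj
      refine ⟨by omega, nonempty_iso_cliqueJoinEmpty hcj ?_⟩
      rw [Fintype.card_fin]
      omega
    · left
      exact ⟨j, hj0, by omega, exists_iso_clique_sum hj4 hp (by omega) hcut hcard htop hnp hse⟩

theorem free_and_card_edgeSet_of_structure {m : ℕ} (hm : 0 < m) {k : Fin m → ℕ}
    (hk : Antitone k) (hk3 : ∀ i, 3 ≤ k i) (heven : ∀ i, Even (k i)) {n : ℕ}
    (hn : ∑ i, k i ≤ n) {G : SimpleGraph (Fin n)}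
    (h : (cliqueBound n (k ⟨0, hm⟩) (k ⟨0, hm⟩) = pathsBound n k ∧
        IsPathExtremalGraph (k ⟨0, hm⟩) G) ∨
      (∃ j : Fin m, 0 < j.val ∧ cliqueBound n (partialSum k j) (k j) = pathsBound n k ∧
        ∃ H : SimpleGraph (Fin (n - (partialSum k j - 1))), IsPathExtremalGraph (k j) H ∧
          Nonempty (G ≃g SimpleGraph.completeGraph (Fin (partialSum k j - 1)) ⊕g H)) ∨
      (joinBound n (∑ i, k i) = pathsBound n k ∧
        Nonempty (G ≃g cliqueJoinEmpty ((∑ i, k i) / 2 - 1) (n - ((∑ i, k i) / 2 - 1))))) :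
    (linearForest k).Free G ∧ Nat.card G.edgeSet = pathsBound n k := by
  have hk2 : ∀ j, k j % 2 = 0 := fun j => Nat.even_iff.1 (heven j)
  have hk4 : ∀ j, 4 ≤ k j := fun j => by
    have := hk3 j
    have := hk2 j
    omega
  have h0 := single_le_sum (f := k) (fun _ _ => Nat.zero_le _) (mem_univ ⟨0, hm⟩)
  have h0' := hk3 ⟨0, hm⟩
  rcases h with ⟨hb, hG⟩ | ⟨j, -, hb, H, hH, ⟨e⟩⟩ | ⟨hb, ⟨e⟩⟩
  · refine ⟨free_of_not_hasPath ⟨0, hm⟩ (hG.not_hasPath (hk4 _) (hk2 _)), ?_⟩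
    have h2 := cliqueBound_zero (k ⟨0, hm⟩) n
    rw [Nat.zero_add] at h2
    rw [hG.card_edgeSet (hk4 _) (hk2 _), ← h2, hb]
  · have h1 := partialSum_le k j
    have h2 := partialSum_eq k j
    have h3 := hk3 j
    refine ⟨(SimpleGraph.free_congr SimpleGraph.Iso.refl e).2
      (linearForest_free_sum hk j (by rw [Nat.card_eq_fintype_card, Fintype.card_fin]; omega)
        (hH.not_hasPath (hk4 j) (hk2 j))), ?_⟩
    rw [card_edgeSet_congr e, card_edgeSet_sum, card_edgeSet_completeGraph,
      hH.card_edgeSet (hk4 j) (hk2 j), ← hb,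
      cliqueBound_eq_add_pathEdges (by omega) (by omega)]
  · refine ⟨(SimpleGraph.free_congr SimpleGraph.Iso.refl e).2 (cliqueJoinEmpty_free
      (fun i _ hi => absurd (heven i) (Nat.not_even_iff_odd.2 hi)) (by omega) _), ?_⟩
    rw [card_edgeSet_congr e, card_edgeSet_cliqueJoinEmpty, ← hb,
      joinBound_eq_joinEdges hn (by omega)]
    congr 1
    omega

end DisjointPaths

theorem theorem1p7 {m : ℕ} (hm : 0 < m) (k : Fin m → ℕ) (hk : Antitone k) (hk3 : ∀ i, 3 ≤ k i)
    (hodd : ∀ i j, Odd (k i) → Odd (k j) → i = j) (n : ℕ) (hn : ∑ i, k i ≤ n) :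
    SimpleGraph.extremalNumber n (DisjointPaths.linearForest k) = DisjointPaths.pathsBound n k ∧
    ((∀ i, Even (k i)) → ∀ (G : SimpleGraph (Fin n)) [DecidableRel G.Adj],
      G.IsExtremal (DisjointPaths.linearForest k).Free ↔
        -- `G` is an extremal graph for the longest path
        (DisjointPaths.cliqueBound n (k ⟨0, hm⟩) (k ⟨0, hm⟩) = DisjointPaths.pathsBound n k ∧
          DisjointPaths.IsPathExtremalGraph (k ⟨0, hm⟩) G) ∨
        -- `G` is a clique together with an extremal graph for the `j`-th path, `j` not the first
        (∃ j : Fin m, 0 < j.val ∧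
          DisjointPaths.cliqueBound n (DisjointPaths.partialSum k j) (k j)
            = DisjointPaths.pathsBound n k ∧
          ∃ H : SimpleGraph (Fin (n - (DisjointPaths.partialSum k j - 1))),
            DisjointPaths.IsPathExtremalGraph (k j) H ∧
            Nonempty (G ≃g
              SimpleGraph.completeGraph (Fin (DisjointPaths.partialSum k j - 1)) ⊕g H)) ∨
        -- `G` is a clique joined to isolated vertices
        (DisjointPaths.joinBound n (∑ i, k i) = DisjointPaths.pathsBound n k ∧
          Nonempty (G ≃g DisjointPaths.cliqueJoinEmpty ((∑ i, k i) / 2 - 1)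
            (n - ((∑ i, k i) / 2 - 1))))) := by
  refine ⟨DisjointPaths.extremalNumber_linearForest hm hk hk3 hodd hn, fun heven G _ => ?_⟩
  have h1 : G.edgeFinset.card = Nat.card G.edgeSet := by
    rw [SimpleGraph.edgeFinset_card, Nat.card_eq_fintype_card]
  rw [SimpleGraph.isExtremal_free_iff, Fintype.card_fin,
    DisjointPaths.extremalNumber_linearForest hm hk hk3 hodd hn, h1]
  exact ⟨fun h => DisjointPaths.structure_of_card_edgeSet_eq_pathsBound hm hk hk3 heven hn h.1 h.2,
    DisjointPaths.free_and_card_edgeSet_of_structure hm hk hk3 heven hn⟩
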